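/- Let $d\ge 1$, $\sigma>0$, $\sigma_\xi>0$ and $\theta^{opt}\in\mathbb{R}^d$. Consider the symmetric Gaussian mixture $\mathcal P_Y=\tfrac12 N(\theta^{opt},\sigma^2 I_d)+\tfrac12 N(-\theta^{opt},\sigma^2 I_d)$. For $y,\theta,\tilde\theta\in\mathbb{R}^d$ let $$\phi(y,\tilde\theta)=\frac{e^{-\|y-\tilde\theta\|^2/(2\sigma^2)}}{e^{-\|y-\tilde\theta\|^2/(2\sigma^2)}+e^{-\|y+\tilde\theta\|^2/(2\sigma^2)}},$$ $$Q(\theta,\tilde\theta;y)=\log\tfrac12-\tfrac d2\log 2\pi-\tfrac d2\log\sigma^2-\frac{\phi(y,\tilde\theta)}{2\sigma^2}\|y-\theta\|^2-\frac{1-\phi(y,\tilde\theta)}{2\sigma^2}\|y+\theta\|^2,$$ and let $\nabla_1Q$ be the gradient of $Q$ with respect to its first argument. Let $$F(\theta)=\frac1{\sigma^2}\Big(\tfrac12\|\theta\|^2-2\,\mathbb{E}_{y\sim\mathcal P_Y}\big[s(\langle y,\theta\rangle)\big]\Big),\qquad s(t)=\int_0^t\frac{du}{1+e^{-2u/\sigma^2}}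 .$$ Assume that $\|\theta^{opt}\|$ is sufficiently large that the Hessian $A=\nabla^2F(\theta^{opt})$ is positive definite. Let $\gamma_n=C n^{-\alpha}$ for $n\ge1$, with $C>0$ and $\tfrac12<\alpha<1$. Let $y_1,y_2,\dots$ be distributed according to $\mathcal P_Y$ and $\xi_1,\xi_2,\dots$ according to $N(0,\sigma_\xi^2I_d)$, and let $\theta_0$ be an $\mathbb{R}^d$-valued random vector (possibly deterministic), such that $\theta_0,y_1,\xi_1,y_2,\xi_2,\dots$ are mutually independent. Define, for $n\ge0$, $$\theta_{n+1}=\theta_n-\gamma_{n+1}\big(-\nabla_1Q(\theta_n,\theta_n;y_{n+1})+\xi_{n+1}\big).$$ Then, with probability $1$, the sequence $(\theta_n)_{n\ge0}$ converges to $\theta^{opt}$ or to $-\theta^{opt}$. -/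

import Mathlib

open MeasureTheory ProbabilityTheory Filter Topology

noncomputable section

namespace GaussianMixture

/-- The law `½ N(θ, σ² I) + ½ N(-θ, σ² I)` of one observation. -/
def mixtureLaw {d : ℕ} (σ : ℝ) (θ : EuclideanSpace ℝ (Fin d)) :
    Measure (EuclideanSpace ℝ (Fin d)) :=
  (2⁻¹ : ENNReal) • multivariateGaussian θ (σ ^ 2 • (1 : Matrix (Fin d) (Fin d) ℝ)) +
    (2⁻¹ : ENNReal) • multivariateGaussian (-θ) (σ ^ 2 • (1 : Matrix (Fin d) (Fin d) ℝ))

/-- The complete-data log-likelihood `l(θ; y, a)`, with latent label `a ∈ {0, 1}`. -/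
def completeLogLik {d : ℕ} (σ : ℝ) (θ y : EuclideanSpace ℝ (Fin d)) (a : ℝ) : ℝ :=
  Real.log (1 / 2) - (d : ℝ) / 2 * Real.log (2 * Real.pi) - (d : ℝ) / 2 * Real.log (σ ^ 2)
    - a / (2 * σ ^ 2) * ‖y - θ‖ ^ 2 - (1 - a) / (2 * σ ^ 2) * ‖y + θ‖ ^ 2

/-- The posterior probability `φ(y, θ')` of the label `a = 1` given the observation `y`,
under the parameter `θ'`. -/
def labelPosterior {d : ℕ} (σ : ℝ) (y θ' : EuclideanSpace ℝ (Fin d)) : ℝ :=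
  Real.exp (-(1 / (2 * σ ^ 2)) * ‖y - θ'‖ ^ 2) /
    (Real.exp (-(1 / (2 * σ ^ 2)) * ‖y - θ'‖ ^ 2) +
      Real.exp (-(1 / (2 * σ ^ 2)) * ‖y + θ'‖ ^ 2))

/-- The EM surrogate `Q(θ, θ'; y) = E[l(θ; y, a) | y, θ']`: the label `a` is `1` with
probability `φ(y, θ')` and `0` with probability `1 - φ(y, θ')`. -/
def emQ {d : ℕ} (σ : ℝ) (θ θ' y : EuclideanSpace ℝ (Fin d)) : ℝ :=
  labelPosterior σ y θ' * completeLogLik σ θ y 1 +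
    (1 - labelPosterior σ y θ') * completeLogLik σ θ y 0

/-- `∇₁ Q(θ, θ'; y)`: the gradient of `Q` in its first argument. -/
def gradEmQ {d : ℕ} (σ : ℝ) (θ θ' y : EuclideanSpace ℝ (Fin d)) :
    EuclideanSpace ℝ (Fin d) :=
  gradient (fun ϑ => emQ σ ϑ θ' y) θ

/-- `s(t) = ∫₀ᵗ 1 / (1 + exp (-2u/σ²)) du`. -/
def logisticPrimitive (σ t : ℝ) : ℝ :=
  ∫ u in (0 : ℝ)..t, 1 / (1 + Real.exp (-(2 / σ ^ 2) * u))

/-- The population objective `F(θ) = σ⁻² (½ ‖θ‖² - 2 E[s(⟨y, θ⟩)])`, with `y` drawn from the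
mixture with parameter `θopt`. -/
def objective {d : ℕ} (σ : ℝ) (θopt θ : EuclideanSpace ℝ (Fin d)) : ℝ :=
  1 / σ ^ 2 * (1 / 2 * ‖θ‖ ^ 2 -
    2 * ∫ y, logisticPrimitive σ (inner ℝ y θ) ∂(mixtureLaw σ θopt))

/-- The Hessian `∇² F(θ)` of a function on `ℝᵈ`, as a linear map. -/
def hessian {d : ℕ} (F : EuclideanSpace ℝ (Fin d) → ℝ) (θ : EuclideanSpace ℝ (Fin d)) :
    EuclideanSpace ℝ (Fin d) →L[ℝ] EuclideanSpace ℝ (Fin d) :=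
  fderiv ℝ (gradient F) θ

/-- The Robbins-Monro step size `γ_n = C n^{-α}`. -/
def stepSize (C α : ℝ) (n : ℕ) : ℝ := C * (n : ℝ) ^ (-α)

end GaussianMixture

end

/-!
The update is a Robbins-Monro recursion. With the EM map `M θ = E[tanh (⟨y, θ⟩ / σ²) y]`, the
objective has gradient `(θ - M θ) / σ²` (`hasGradientAt_objective`), and one update is
`θ ↦ θ + (γ / σ²) (M θ - θ) + γ N`, where the noise `N` is centred given the past and bounded, in
every state, by one function of `y` and `ξ` with three moments (`update_eq`, `updateNoise`).

*Convergence to a fixed point.* Since `∑ γ² < ∞`, the accumulated noise is an `L²`-bounded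
martingale and converges (`ae_exists_tendsto_sum_updateNoise`). The rest is deterministic along one
trajectory (`exists_tendsto_fixedPoint`). As `M` is bounded, so is the trajectory. The law of `y` is
invariant under reflections orthogonal to `θopt`, and `tanh` is strictly `1`-Lipschitz, so `M`
strictly shrinks the component orthogonal to `θopt` (`inner_emMap_lt_of_orthogonal`), and this
component tends to zero. What remains is a scalar recursion on the line `ℝ θopt`, which has to
converge to a zero of its drift, as the zeros are finitely many. Since `tanh` is strictly concave on
the positive half-line and `θopt` is a fixed point, the zeros are `0` and `± θopt`
(`eq_zero_or_of_inner_emMap_smul_eq`).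

*The origin is not a limit.* Near the origin, the component `u = ⟨θ, θopt⟩ / ‖θopt‖` is expanded by
the drift by a factor `1 + 2 c γ`, at least. The hyperplane `u = 0` is invariant, so the error of
this expansion is proportional to `u` (`abs_inner_emMap_sub_le`, `exists_le_inner_emMap_sub_mul`).
The potential `log (1 + u² / (K γ))`, which measures `u` on the scale `√γ` on which expansion and
noise balance, therefore grows in mean by a multiple of `γ` per step
(`integral_log_potential_ge`): where `u` is small, by the noise, which is nondegenerate because of
the disturbances `ξ`, and where `u` is large, by the expansion. Near the origin it is at most
`O(log (1 / γ)) = O(log n)`, whereas `∑ γ` grows like `n ^ (1 - α)`. So almost no trajectory stays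
near the origin forever (`measure_forall_mem_eq_zero`, `ae_not_tendsto_zero`).

Positive definiteness of the Hessian enters through `θopt ≠ 0`: for `θopt = 0` the objective is
degenerate at the origin (`inner_hessian_objective_zero`).
-/

namespace GaussianMixture

/-! ### The hyperbolic tangent and the function `log (1 + x²)` -/

theorem hasDerivAt_tanh (x : ℝ) : HasDerivAt Real.tanh (1 - Real.tanh x ^ 2) x := by
  have h := (Real.hasDerivAt_sinh x).div (Real.hasDerivAt_cosh x) (Real.cosh_pos x).ne'
  have hf : Real.tanh = fun y => Real.sinh y / Real.cosh y := by
    ext y; exact Real.tanh_eq_sinh_div_cosh y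
  have hc := (Real.cosh_pos x).ne'
  have he : 1 - Real.tanh x ^ 2
      = (Real.cosh x * Real.cosh x - Real.sinh x * Real.sinh x) / Real.cosh x ^ 2 := by
    rw [Real.tanh_eq_sinh_div_cosh]
    field_simp
  rw [he, hf]
  exact h

@[fun_prop]
theorem continuous_tanh : Continuous Real.tanh :=
  continuous_iff_continuousAt.2 fun x => (hasDerivAt_tanh x).continuousAt

theorem strictMono_tanh : StrictMono Real.tanh := by
  refine strictMono_of_deriv_pos fun x => ?_
  rw [(hasDerivAt_tanh x).deriv]
  linarith [Real.tanh_sq_lt_one x]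

theorem strictMono_sub_tanh_of_nonneg : StrictMonoOn (fun x => x - Real.tanh x) (Set.Ici 0) := by
  refine strictMonoOn_of_deriv_pos (convex_Ici 0)
    (continuous_id.sub continuous_tanh).continuousOn fun x hx => ?_
  rw [interior_Ici] at hx
  have h : HasDerivAt (fun x => x - Real.tanh x) (1 - (1 - Real.tanh x ^ 2)) x :=
    (hasDerivAt_id x).sub (hasDerivAt_tanh x)
  rw [h.deriv]
  have : 0 < Real.tanh x := by simpa using strictMono_tanh hx
  nlinarith

theorem strictMono_sub_tanh : StrictMono (fun x => x - Real.tanh x) := by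
  refine StrictMonoOn.Iic_union_Ici (a := 0) ?_ strictMono_sub_tanh_of_nonneg
  intro x hx y hy hxy
  have := strictMono_sub_tanh_of_nonneg (a := -y) (b := -x) (by simpa using hy) (by simpa using hx)
    (by linarith)
  simp only [Real.tanh_neg] at this ⊢
  linarith

/-- `tanh` is strictly `1`-Lipschitz, in the product form in which it meets an expectation. -/
theorem tanh_sub_mul_sub_lt {x y : ℝ} (h : x ≠ y) :
    (Real.tanh x - Real.tanh y) * (x - y) < (x - y) ^ 2 := by
  rcases lt_or_gt_of_ne h with h | h
  · have := strictMono_sub_tanh h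
    simp only at this
    nlinarith
  · have := strictMono_sub_tanh h
    simp only at this
    nlinarith

theorem abs_tanh_sub_le (x y : ℝ) : |Real.tanh x - Real.tanh y| ≤ |x - y| := by
  wlog h : y ≤ x generalizing x y
  · rw [abs_sub_comm, abs_sub_comm x]; exact this y x (by linarith)
  have h1 := strictMono_sub_tanh.monotone h
  have h2 := strictMono_tanh.monotone h
  rw [abs_of_nonneg (by linarith), abs_of_nonneg (by linarith)]
  linarith

theorem abs_tanh_le (x : ℝ) : |Real.tanh x| ≤ |x| := by simpa using abs_tanh_sub_le x 0

/-- First-order expansion of `tanh` at any base point, with a remainder controlled by the distance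
of the segment to the origin. -/
theorem abs_tanh_add_sub_le (x w : ℝ) :
    |Real.tanh (x + w) - Real.tanh w - x| ≤ |x| * (|x| + |w|) ^ 2 := by
  have hd : ∀ t ∈ Set.uIcc w (x + w),
      HasDerivWithinAt (fun s => Real.tanh s - s) (1 - Real.tanh t ^ 2 - 1)
        (Set.uIcc w (x + w)) t :=
    fun t _ => ((hasDerivAt_tanh t).sub (hasDerivAt_id t)).hasDerivWithinAt
  have hb : ∀ t ∈ Set.uIcc w (x + w), ‖1 - Real.tanh t ^ 2 - 1‖ ≤ (|x| + |w|) ^ 2 := by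
    intro t ht
    have h1 : |t - w| ≤ |x| := by
      simpa using Set.abs_sub_left_of_mem_uIcc ht
    have h2 : |t| ≤ |x| + |w| := by
      have := abs_add_le (t - w) w
      simp only [sub_add_cancel] at this
      linarith
    have h3 := (abs_tanh_le t).trans h2
    rw [Real.norm_eq_abs, show 1 - Real.tanh t ^ 2 - 1 = -(Real.tanh t ^ 2) by ring, abs_neg,
      abs_pow]
    exact pow_le_pow_left₀ (abs_nonneg _) h3 2
  have := (convex_uIcc w (x + w)).norm_image_sub_le_of_norm_hasDerivWithin_le hd hb
    Set.left_mem_uIcc Set.right_mem_uIcc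
  simp only [Real.norm_eq_abs, add_sub_cancel_right] at this
  rw [mul_comm]
  convert this using 2
  ring

/-- Strict concavity of `tanh` on the positive half-line, tested against the origin. -/
theorem mul_tanh_lt_tanh_mul {l t : ℝ} (hl : 0 < l) (hl1 : l < 1) (ht : 0 < t) :
    l * Real.tanh t < Real.tanh (l * t) := by
  have hmono : StrictMonoOn (fun s => Real.tanh (l * s) - l * Real.tanh s) (Set.Ici 0) := by
    refine strictMonoOn_of_deriv_pos (convex_Ici 0) ?_ fun x hx => ?_
    · exact ((continuous_tanh.comp (continuous_const.mul continuous_id)).sub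
        (continuous_const.mul continuous_tanh)).continuousOn
    · rw [interior_Ici] at hx
      have hx : 0 < x := hx
      have h1 : HasDerivAt (fun s => Real.tanh (l * s)) ((1 - Real.tanh (l * x) ^ 2) * (l * 1)) x :=
        (hasDerivAt_tanh (l * x)).comp x ((hasDerivAt_id x).const_mul l)
      rw [(h1.fun_sub ((hasDerivAt_tanh x).const_mul l)).deriv]
      have h2 : Real.tanh (l * x) < Real.tanh x := strictMono_tanh (by nlinarith)
      have h3 : 0 < Real.tanh (l * x) := by simpa using strictMono_tanh (mul_pos hl hx)
      nlinarith [mul_pos hl (by nlinarith : 0 < Real.tanh x ^ 2 - Real.tanh (l * x) ^ 2)]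
  have := hmono (Set.self_mem_Ici) (show t ∈ Set.Ici (0 : ℝ) from ht.le) ht
  simp only [mul_zero, Real.tanh_zero] at this
  linarith

theorem tanh_mul_mul_lt {l t : ℝ} (hl : 0 < l) (hl1 : l < 1) (ht : t ≠ 0) :
    l * (Real.tanh t * t) < Real.tanh (l * t) * t := by
  rcases lt_or_gt_of_ne ht with h | h
  · have := mul_tanh_lt_tanh_mul hl hl1 (t := -t) (by linarith)
    rw [mul_neg, Real.tanh_neg, Real.tanh_neg] at this
    nlinarith
  · have := mul_tanh_lt_tanh_mul hl hl1 h
    nlinarith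

theorem hasDerivAt_log_one_add_sq (x : ℝ) :
    HasDerivAt (fun t => Real.log (1 + t ^ 2)) (2 * x / (1 + x ^ 2)) x := by
  have h : HasDerivAt (fun t : ℝ => 1 + t ^ 2) (2 * x) x := by
    simpa using (hasDerivAt_pow 2 x).const_add 1
  exact h.log (by positivity)

/-- Third-order Taylor bound, from below, for `log (1 + w²)`. -/
theorem log_one_add_sq_add_ge (w x : ℝ) :
    Real.log (1 + w ^ 2) + 2 * w / (1 + w ^ 2) * x + (1 - w ^ 2) / (1 + w ^ 2) ^ 2 * x ^ 2
      - 2 * |x| ^ 3 ≤ Real.log (1 + (w + x) ^ 2) := by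
  -- it is enough to treat increments of one sign
  wlog hx : 0 ≤ x generalizing w x
  · have := this (-w) (-x) (by linarith)
    rw [show (-w + -x) ^ 2 = (w + x) ^ 2 by ring, abs_neg] at this
    have e : 2 * -w / (1 + (-w) ^ 2) * -x = 2 * w / (1 + w ^ 2) * x := by
      rw [neg_sq]; ring
    rwa [e, neg_sq, neg_sq] at this
  rw [abs_of_nonneg hx]
  have hw : 0 < 1 + w ^ 2 := by positivity
  have hmono : MonotoneOn (fun t => Real.log (1 + (w + t) ^ 2) - (2 * w / (1 + w ^ 2) * t
      + (1 - w ^ 2) / (1 + w ^ 2) ^ 2 * t ^ 2 - 2 * t ^ 3)) (Set.Ici 0) := by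
    have hder : ∀ t, HasDerivAt (fun t => Real.log (1 + (w + t) ^ 2) - (2 * w / (1 + w ^ 2) * t
        + (1 - w ^ 2) / (1 + w ^ 2) ^ 2 * t ^ 2 - 2 * t ^ 3))
        (2 * (w + t) / (1 + (w + t) ^ 2) - (2 * w / (1 + w ^ 2)
        + (1 - w ^ 2) / (1 + w ^ 2) ^ 2 * (2 * t) - 2 * (3 * t ^ 2))) t := by
      intro t
      have h1 : HasDerivAt (fun t => Real.log (1 + (w + t) ^ 2))
          (2 * (w + t) / (1 + (w + t) ^ 2)) t :=
        (hasDerivAt_log_one_add_sq (w + t)).comp_const_add w t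
      have h2 : HasDerivAt (fun t : ℝ => 2 * w / (1 + w ^ 2) * t) (2 * w / (1 + w ^ 2)) t := by
        simpa using (hasDerivAt_id t).const_mul (2 * w / (1 + w ^ 2))
      have h3 : HasDerivAt (fun t : ℝ => (1 - w ^ 2) / (1 + w ^ 2) ^ 2 * t ^ 2)
          ((1 - w ^ 2) / (1 + w ^ 2) ^ 2 * (2 * t)) t := by
        simpa using (hasDerivAt_pow 2 t).const_mul ((1 - w ^ 2) / (1 + w ^ 2) ^ 2)
      have h4 : HasDerivAt (fun t : ℝ => 2 * t ^ 3) (2 * (3 * t ^ 2)) t := by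
        simpa using (hasDerivAt_pow 3 t).const_mul 2
      exact h1.fun_sub ((h2.fun_add h3).fun_sub h4)
    refine monotoneOn_of_deriv_nonneg (convex_Ici 0)
      (fun t _ => (hder t).continuousAt.continuousWithinAt)
      (fun t _ => (hder t).differentiableAt.differentiableWithinAt) fun t ht => ?_
    rw [interior_Ici] at ht
    have ht : 0 < t := ht
    rw [(hder t).deriv]
    have hwt : 0 < 1 + (w + t) ^ 2 := by positivity
    have key : 2 * (w + t) / (1 + (w + t) ^ 2) - (2 * w / (1 + w ^ 2)
        + (1 - w ^ 2) / (1 + w ^ 2) ^ 2 * (2 * t) - 2 * (3 * t ^ 2))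
        = 2 * t ^ 2 * (3 * (1 + w ^ 2) ^ 2 * (1 + (w + t) ^ 2)
            + (w + t) * (w ^ 2 - 1) - 2 * w) /
          ((1 + w ^ 2) ^ 2 * (1 + (w + t) ^ 2)) := by
      field_simp
      ring
    rw [key]
    have h5 : 0 ≤ 3 * (1 + w ^ 2) ^ 2 * (1 + (w + t) ^ 2) + (w + t) * (w ^ 2 - 1) - 2 * w := by
      have e1 : 0 ≤ 1 + 2 * (w + t) ^ 2 - (w + t) := by nlinarith [sq_nonneg (w + t - 1)]
      have e2 : 0 ≤ 1 + 2 * (w + t) ^ 2 + (w + t) := by nlinarith [sq_nonneg (w + t + 1)]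
      have e3 : 0 ≤ (1 + w ^ 2) * (1 + 2 * (w + t) ^ 2) + (w + t) * (w ^ 2 - 1) := by
        nlinarith [mul_nonneg (sq_nonneg w) e2]
      have e4 : 0 ≤ 2 * (1 + w ^ 2) * (1 + (w + t) ^ 2) + (w + t) * (w ^ 2 - 1) - 2 * w := by
        nlinarith [sq_nonneg (w - 1)]
      nlinarith [mul_nonneg (sq_nonneg w) hwt.le, mul_nonneg (sq_nonneg (w ^ 2)) hwt.le]
    positivity
  have := hmono (Set.self_mem_Ici) (show x ∈ Set.Ici (0 : ℝ) from hx) hx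
  simp only [mul_zero, add_zero] at this
  norm_num at this
  linarith

/-! ### Deterministic dynamics of perturbed relaxations -/

/-- A sequence with vanishing increments that does not increase while in `[p, q]` cannot cross this
interval upwards at late times. -/
theorem eventually_le_of_frequently_lt {a : ℕ → ℝ} {p q : ℝ} (hpq : p < q)
    (hinc : Tendsto (fun n => a (n + 1) - a n) atTop (𝓝 0))
    (hstep : ∀ᶠ n in atTop, p ≤ a n → a n ≤ q → a (n + 1) ≤ a n)
    (hfreq : ∃ᶠ n in atTop, a n < p) : ∀ᶠ n in atTop, a n ≤ q := by
  have h1 : ∀ᶠ n in atTop, a (n + 1) - a n < q - p :=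
    hinc.eventually (gt_mem_nhds (by linarith))
  obtain ⟨N, hN⟩ := eventually_atTop.1 (hstep.and h1)
  obtain ⟨m, hm, ham⟩ := (frequently_atTop.1 hfreq) N
  refine eventually_atTop.2 ⟨m, fun n hn => ?_⟩
  induction n, hn using Nat.le_induction with
  | base => linarith
  | succ n hn ih =>
    obtain ⟨h2, h3⟩ := hN n (hm.trans hn)
    by_cases hp : p ≤ a n
    · exact (h2 hp ih).trans ih
    · linarith

/-- A sequence that decreases by a multiple of non-summable steps whenever it is above `p` returns
below `p`. -/
theorem frequently_lt_of_drift {a lam : ℕ → ℝ} {p κ : ℝ} (hκ : 0 < κ)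
    (hsum : Tendsto (fun n => ∑ k ∈ Finset.range n, lam k) atTop atTop)
    (hstep : ∀ᶠ n in atTop, p ≤ a n → a (n + 1) ≤ a n - κ * lam n) :
    ∃ᶠ n in atTop, a n < p := by
  intro hcon
  obtain ⟨N, hN⟩ := eventually_atTop.1 (hstep.and hcon)
  have h1 : ∀ n, N ≤ n → a n ≤ a N + κ * ∑ k ∈ Finset.range N, lam k
      - κ * ∑ k ∈ Finset.range n, lam k := by
    intro n hn
    induction n, hn using Nat.le_induction with
    | base => linarith
    | succ n hn ih =>
      have h2 := (hN n hn).1 (not_lt.1 (hN n hn).2)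
      rw [Finset.sum_range_succ]
      linarith
  have h3 : ∀ᶠ n in atTop, (a N + κ * ∑ k ∈ Finset.range N, lam k - p) / κ + 1
      ≤ ∑ k ∈ Finset.range n, lam k := hsum.eventually_ge_atTop _
  obtain ⟨n, hn, hn'⟩ := (h3.and (eventually_ge_atTop N)).exists
  have h4 := h1 n hn'
  have h5 := not_lt.1 (hN n hn').2
  have h6 : (a N + κ * ∑ k ∈ Finset.range N, lam k - p) / κ < ∑ k ∈ Finset.range n, lam k := by
    linarith
  rw [div_lt_iff₀ hκ] at h6
  linarith

section ScalarDynamics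

variable {a lam ε : ℕ → ℝ} {g : ℝ → ℝ}

theorem tendsto_increment_zero {R : ℝ} (hlam0 : Tendsto lam atTop (𝓝 0))
    (hg : Continuous g) (hε : Tendsto ε atTop (𝓝 0)) (hR : ∀ n, |a n| ≤ R)
    (ha : ∀ n, a (n + 1) = a n + lam n * (g (a n) + ε n)) :
    Tendsto (fun n => a (n + 1) - a n) atTop (𝓝 0) := by
  obtain ⟨K, hK⟩ := (isCompact_Icc (a := -R) (b := R)).exists_bound_of_continuousOn hg.continuousOn
  have h1 : Tendsto (fun n => lam n * ε n) atTop (𝓝 0) := by simpa using hlam0.mul hε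
  have h2 : Tendsto (fun n => lam n * g (a n)) atTop (𝓝 0) :=
    bdd_le_mul_tendsto_zero' K (Eventually.of_forall fun n => hK _ (abs_le.1 (hR n))) hlam0
      |>.congr fun n => mul_comm _ _
  have h3 := h2.add h1
  rw [add_zero] at h3
  refine h3.congr fun n => ?_
  rw [ha n]
  ring

/-- A point of negative drift is not crossed infinitely often. -/
theorem not_crossing_of_neg {R p q c : ℝ} (hlam : ∀ n, 0 < lam n)
    (hlam0 : Tendsto lam atTop (𝓝 0))
    (hg : Continuous g) (hε : Tendsto ε atTop (𝓝 0)) (hR : ∀ n, |a n| ≤ R)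
    (ha : ∀ n, a (n + 1) = a n + lam n * (g (a n) + ε n))
    (hpc : p < c) (hcq : c < q) (hgc : g c < 0) :
    ¬((∃ᶠ n in atTop, a n < p) ∧ ∃ᶠ n in atTop, q < a n) := by
  rintro ⟨h1, h2⟩
  have hnear : ∀ᶠ t in 𝓝 c, g t < g c / 2 ∧ p < t ∧ t < q :=
    (hg.continuousAt.eventually (gt_mem_nhds (by linarith))).and
      ((lt_mem_nhds hpc).and (gt_mem_nhds hcq))
  obtain ⟨δ, hδ, hball⟩ := Metric.eventually_nhds_iff_ball.1 hnear
  have hin : ∀ t, c - δ / 2 ≤ t → t ≤ c + δ / 2 → g t < g c / 2 ∧ p < t ∧ t < q := by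
    intro t ht1 ht2
    refine hball t ?_
    rw [Metric.mem_ball, Real.dist_eq, abs_lt]
    constructor <;> linarith
  have hstep : ∀ᶠ n in atTop, c - δ / 2 ≤ a n → a n ≤ c + δ / 2 → a (n + 1) ≤ a n := by
    have : ∀ᶠ n in atTop, ε n < -(g c / 2) := hε.eventually (gt_mem_nhds (by linarith))
    filter_upwards [this] with n hn h3 h4
    have h5 := (hin _ h3 h4).1
    rw [ha n]
    nlinarith [hlam n]
  have h6 := eventually_le_of_frequently_lt (by linarith : c - δ / 2 < c + δ / 2)
    (tendsto_increment_zero hlam0 hg hε hR ha) hstep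
    (h1.mono fun n hn => hn.trans (hin _ le_rfl (by linarith)).2.1)
  obtain ⟨n, h7, h8⟩ := (h2.and_eventually h6).exists
  linarith [(hin (c + δ / 2) (by linarith) le_rfl).2.2]

/-- The drift at a limit is not negative: otherwise the non-summable steps would carry the sequence
away. -/
theorem nonneg_of_tendsto {l : ℝ} (hlam : ∀ n, 0 < lam n)
    (hsum : Tendsto (fun n => ∑ k ∈ Finset.range n, lam k) atTop atTop)
    (hg : Continuous g) (hε : Tendsto ε atTop (𝓝 0))
    (ha : ∀ n, a (n + 1) = a n + lam n * (g (a n) + ε n))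
    (hl : Tendsto a atTop (𝓝 l)) : 0 ≤ g l := by
  by_contra! hneg
  have h1 : Tendsto (fun n => g (a n) + ε n) atTop (𝓝 (g l + 0)) :=
    ((hg.tendsto l).comp hl).add hε
  rw [add_zero] at h1
  have h2 : ∃ᶠ n in atTop, a n < l - 1 := by
    refine frequently_lt_of_drift (κ := -(g l / 2)) (by linarith) hsum ?_
    filter_upwards [h1.eventually (gt_mem_nhds (show g l < g l / 2 by linarith))] with n hn _
    rw [ha n]
    nlinarith [hlam n]
  obtain ⟨n, h3, h4⟩ := (h2.and_eventually
    (hl.eventually (lt_mem_nhds (show l - 1 < l by linarith)))).exists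
  linarith

/-- A bounded scalar recursion with vanishing, non-summable steps and an asymptotically vanishing
perturbation converges to a zero of its drift, provided the drift has finitely many zeros. -/
theorem exists_tendsto_zero_of_drift {R : ℝ} (hlam : ∀ n, 0 < lam n)
    (hlam0 : Tendsto lam atTop (𝓝 0))
    (hsum : Tendsto (fun n => ∑ k ∈ Finset.range n, lam k) atTop atTop)
    (hg : Continuous g) (hz : {t | g t = 0}.Finite)
    (hε : Tendsto ε atTop (𝓝 0)) (hR : ∀ n, |a n| ≤ R)
    (ha : ∀ n, a (n + 1) = a n + lam n * (g (a n) + ε n)) :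
    ∃ l, g l = 0 ∧ Tendsto a atTop (𝓝 l) := by
  have hg' : Continuous fun t => -g (-t) := (hg.comp continuous_neg).neg
  have hε' : Tendsto (fun n => -ε n) atTop (𝓝 0) := by simpa using hε.neg
  have ha' : ∀ n, -a (n + 1) = -a n + lam n * (-g (-(-a n)) + -ε n) := by
    intro n
    rw [ha n, neg_neg]
    ring
  have hcross : ∀ p ∈ (Set.univ : Set ℝ), ∀ q ∈ (Set.univ : Set ℝ), p < q →
      ¬((∃ᶠ n in atTop, a n < p) ∧ ∃ᶠ n in atTop, q < a n) := by
    rintro p - q - hpq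
    -- between two levels there is a point of nonzero drift, which cannot be crossed infinitely
    -- often in one of the directions
    obtain ⟨c, hc, hgc⟩ := ((Set.Ioo_infinite hpq).sdiff hz).nonempty
    rcases lt_or_gt_of_ne (show g c ≠ 0 from hgc) with h | h
    · exact not_crossing_of_neg hlam hlam0 hg hε hR ha hc.1 hc.2 h
    · rintro ⟨h1, h2⟩
      refine not_crossing_of_neg (a := fun n => -a n) (p := -q) (q := -p) (c := -c) (R := R)
        hlam hlam0 hg' hε' (fun n => by simpa using hR n) ha' (by linarith [hc.2])
        (by linarith [hc.1]) (by simpa using h) ⟨?_, ?_⟩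
      · exact h2.mono fun n hn => by linarith
      · exact h1.mono fun n hn => by linarith
  obtain ⟨l, hl⟩ := tendsto_of_no_upcrossings dense_univ hcross
    (isBoundedUnder_of ⟨R, fun n => (abs_le.1 (hR n)).2⟩)
    (isBoundedUnder_of ⟨-R, fun n => (abs_le.1 (hR n)).1⟩)
  refine ⟨l, le_antisymm ?_ (nonneg_of_tendsto hlam hsum hg hε ha hl), hl⟩
  have := nonneg_of_tendsto hlam hsum hg' hε' ha' hl.neg
  simpa using this

end ScalarDynamics

section VectorDynamics

variable {E : Type*} [NormedAddCommGroup E] [InnerProductSpace ℝ E]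

/-- Moving averages of a bounded sequence are bounded. -/
theorem exists_norm_bound_of_averaging {z b : ℕ → E} {lam : ℕ → ℝ} {B : ℝ}
    (hlam : ∀ n, 0 < lam n) (hlam0 : Tendsto lam atTop (𝓝 0)) (hb : ∀ n, ‖b n‖ ≤ B)
    (hz : ∀ n, z (n + 1) = (1 - lam n) • z n + lam n • b n) : ∃ R, ∀ n, ‖z n‖ ≤ R := by
  obtain ⟨N, hN⟩ := eventually_atTop.1 (hlam0.eventually (gt_mem_nhds (zero_lt_one' ℝ)))
  have htail : ∀ n, N ≤ n → ‖z n‖ ≤ max ‖z N‖ B := by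
    intro n hn
    induction n, hn using Nat.le_induction with
    | base => exact le_max_left _ _
    | succ n hn ih =>
      have h1 := (hN n hn).le
      rw [hz n]
      calc ‖(1 - lam n) • z n + lam n • b n‖ ≤ (1 - lam n) * ‖z n‖ + lam n * ‖b n‖ := by
            refine (norm_add_le _ _).trans_eq ?_
            rw [norm_smul, norm_smul, Real.norm_of_nonneg (by linarith),
              Real.norm_of_nonneg (hlam n).le]
        _ ≤ (1 - lam n) * max ‖z N‖ B + lam n * max ‖z N‖ B := by
            refine add_le_add (mul_le_mul_of_nonneg_left ih (by linarith))
              (mul_le_mul_of_nonneg_left ((hb n).trans (le_max_right _ _)) (hlam n).le)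
        _ = max ‖z N‖ B := by ring
  refine ⟨max ‖z N‖ B + ∑ k ∈ Finset.range N, ‖z k‖, fun n => ?_⟩
  rcases le_or_gt N n with h | h
  · exact (htail n h).trans (le_add_of_nonneg_right (Finset.sum_nonneg fun _ _ => norm_nonneg _))
  · refine (Finset.single_le_sum (f := fun k => ‖z k‖) (fun _ _ => norm_nonneg _)
      (Finset.mem_range.2 h)).trans (le_add_of_nonneg_left ?_)
    exact (norm_nonneg _).trans (le_max_left _ _)

variable [FiniteDimensional ℝ E]

theorem tendsto_sub_of_continuous_of_bounded {F : Type*} [NormedAddCommGroup F] {f : E → F}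
    (hf : Continuous f) {x y : ℕ → E} {R : ℝ} (hx : ∀ n, ‖x n‖ ≤ R) (hy : ∀ n, ‖y n‖ ≤ R)
    (h : Tendsto (fun n => x n - y n) atTop (𝓝 0)) :
    Tendsto (fun n => f (x n) - f (y n)) atTop (𝓝 0) := by
  have := FiniteDimensional.proper_real E
  have huc := (isCompact_closedBall (0 : E) R).uniformContinuousOn_of_continuous hf.continuousOn
  rw [Metric.uniformContinuousOn_iff] at huc
  rw [Metric.tendsto_nhds]
  intro r hr
  obtain ⟨δ, hδ, hd⟩ := huc r hr
  filter_upwards [Metric.tendsto_nhds.1 h δ hδ] with n hn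
  rw [dist_zero_right, ← dist_eq_norm] at hn ⊢
  exact hd _ (by simpa using hx n) _ (by simpa using hy n) hn

/-- If the drift `M x - x` strictly contracts the component `T x` of the state (`T` being an
orthogonal projection), that component of a perturbed recursion dies out. -/
theorem tendsto_projection_zero {M : E → E} (hM : Continuous M) (T : E →L[ℝ] E)
    (hT : ∀ x y, inner ℝ (T x) (T y) = inner ℝ x (T y))
    (hcontr : ∀ x, T x ≠ 0 → inner ℝ (M x) (T x) < ‖T x‖ ^ 2)
    {x z : ℕ → E} {lam : ℕ → ℝ} {R : ℝ} (hlam : ∀ n, 0 < lam n)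
    (hlam0 : Tendsto lam atTop (𝓝 0))
    (hsum : Tendsto (fun n => ∑ k ∈ Finset.range n, lam k) atTop atTop)
    (hx : ∀ n, ‖x n‖ ≤ R) (hzR : ∀ n, ‖z n‖ ≤ R)
    (hxz : Tendsto (fun n => x n - z n) atTop (𝓝 0))
    (hz : ∀ n, z (n + 1) = z n + lam n • (M (x n) - x n)) :
    Tendsto (fun n => T (z n)) atTop (𝓝 0) := by
  have := FiniteDimensional.proper_real E
  obtain ⟨K, hK⟩ := (isCompact_closedBall (0 : E) R).exists_bound_of_continuousOn
    (f := fun x => T (M x - x)) (T.continuous.comp (hM.sub continuous_id)).continuousOn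
  have hw : ∀ n, ‖T (M (x n) - x n)‖ ≤ K := fun n => hK _ (by simpa using hx n)
  have hrec : ∀ n, ‖T (z (n + 1))‖ ^ 2 = ‖T (z n)‖ ^ 2
      + lam n * (2 * inner ℝ (T (z n)) (T (M (x n) - x n))
      + lam n * ‖T (M (x n) - x n)‖ ^ 2) := by
    intro n
    rw [hz n, map_add, map_smul, norm_add_sq_real, inner_smul_right, norm_smul, mul_pow,
      Real.norm_eq_abs, sq_abs]
    ring
  have hδ : Tendsto (fun n => inner ℝ (T (x n - z n)) (T (M (x n) - x n))) atTop (𝓝 0) := by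
    have h0 : Tendsto (fun n => ‖T (x n - z n)‖ * K) atTop (𝓝 0) := by
      have := ((T.continuous.tendsto 0).comp hxz).norm.mul_const K
      simpa using this
    refine squeeze_zero_norm (fun n => ?_) h0
    exact (norm_inner_le_norm _ _).trans (mul_le_mul_of_nonneg_left (hw n) (norm_nonneg _))
  have hinner : ∀ n, inner ℝ (T (z n)) (T (M (x n) - x n))
      = (inner ℝ (M (x n)) (T (x n)) - ‖T (x n)‖ ^ 2)
        - inner ℝ (T (x n - z n)) (T (M (x n) - x n)) := by
    intro n
    have e1 : inner ℝ (T (x n)) (T (M (x n) - x n))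
        = inner ℝ (M (x n)) (T (x n)) - ‖T (x n)‖ ^ 2 := by
      rw [real_inner_comm, hT, inner_sub_left, ← hT, ← hT (x n) (x n), real_inner_self_eq_norm_sq]
    rw [← e1, ← inner_sub_left, ← map_sub T (x n), sub_sub_cancel]
  have hsq : Tendsto (fun n => ‖T (x n)‖ ^ 2 - ‖T (z n)‖ ^ 2) atTop (𝓝 0) :=
    tendsto_sub_of_continuous_of_bounded (f := fun x => ‖T x‖ ^ 2)
      (T.continuous.norm.pow 2) hx hzR hxz
  have hl2 : Tendsto (fun n => lam n * ‖T (M (x n) - x n)‖ ^ 2) atTop (𝓝 0) := by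
    refine (bdd_le_mul_tendsto_zero' (K ^ 2) (Eventually.of_forall fun n => ?_) hlam0).congr
      fun n => mul_comm (‖T (M (x n) - x n)‖ ^ 2) (lam n)
    rw [abs_pow, abs_norm]
    exact pow_le_pow_left₀ (norm_nonneg _) (hw n) 2
  have hinc : Tendsto (fun n => ‖T (z (n + 1))‖ ^ 2 - ‖T (z n)‖ ^ 2) atTop (𝓝 0) := by
    have hzinc : Tendsto (fun n => z (n + 1) - z n) atTop (𝓝 0) := by
      obtain ⟨K', hK'⟩ := (isCompact_closedBall (0 : E) R).exists_bound_of_continuousOn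
        (f := fun x => M x - x) (hM.sub continuous_id).continuousOn
      have h0 : Tendsto (fun n => lam n * K') atTop (𝓝 0) := by simpa using hlam0.mul_const K'
      refine squeeze_zero_norm (fun n => ?_) h0
      rw [hz n, add_sub_cancel_left, norm_smul, Real.norm_of_nonneg (hlam n).le]
      exact mul_le_mul_of_nonneg_left (hK' _ (by simpa using hx n)) (hlam n).le
    exact tendsto_sub_of_continuous_of_bounded (f := fun x => ‖T x‖ ^ 2)
      (T.continuous.norm.pow 2) (fun n => hzR (n + 1)) hzR hzinc
  have hmain : ∀ η, 0 < η → ∀ᶠ n in atTop, ‖T (z n)‖ ^ 2 ≤ 2 * η := by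
    intro η hη
    -- on the bounded states whose `T`-component is not small, the contraction is uniform
    obtain ⟨κ, hκ, hκ'⟩ : ∃ κ > 0, ∀ y, ‖y‖ ≤ R → η / 2 ≤ ‖T y‖ ^ 2 →
        inner ℝ (M y) (T y) - ‖T y‖ ^ 2 ≤ -κ := by
      have hcl : IsClosed {y : E | η / 2 ≤ ‖T y‖ ^ 2} :=
        isClosed_le continuous_const (T.continuous.norm.pow 2)
      have hcomp := (isCompact_closedBall (0 : E) R).inter_right hcl
      rcases (Metric.closedBall (0 : E) R ∩ {y : E | η / 2 ≤ ‖T y‖ ^ 2}).eq_empty_or_nonempty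
        with he | hne
      · refine ⟨1, one_pos, fun y h1 h2 => ?_⟩
        have : y ∈ Metric.closedBall (0 : E) R ∩ {y : E | η / 2 ≤ ‖T y‖ ^ 2} :=
          ⟨by simpa using h1, h2⟩
        rw [he] at this
        exact this.elim
      · obtain ⟨y₀, hy₀, hmax⟩ := hcomp.exists_isMaxOn hne
          (f := fun y => inner ℝ (M y) (T y) - ‖T y‖ ^ 2)
          ((hM.inner T.continuous).sub (T.continuous.norm.pow 2)).continuousOn
        have hne0 : T y₀ ≠ 0 := by
          intro h0
          have := hy₀.2
          rw [Set.mem_ofPred_eq, h0, norm_zero] at this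
          linarith
        refine ⟨-(inner ℝ (M y₀) (T y₀) - ‖T y₀‖ ^ 2), by linarith [hcontr y₀ hne0],
          fun y h1 h2 => ?_⟩
        rw [neg_neg]
        exact hmax ⟨by simpa using h1, h2⟩
    have hstep : ∀ᶠ n in atTop, η ≤ ‖T (z n)‖ ^ 2 →
        ‖T (z (n + 1))‖ ^ 2 ≤ ‖T (z n)‖ ^ 2 - κ * lam n := by
      filter_upwards [hsq.eventually (lt_mem_nhds (show -(η / 2) < 0 by linarith)),
        hδ.eventually (lt_mem_nhds (show -(κ / 4) < 0 by linarith)),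
        hl2.eventually (gt_mem_nhds (show 0 < κ / 2 by linarith))] with n h1 h2 h3 h4
      have h5 := hκ' (x n) (hx n) (by linarith)
      rw [hrec n, hinner n]
      nlinarith [hlam n]
    exact eventually_le_of_frequently_lt (by linarith) hinc
      (hstep.mono fun n hn h1 _ => (hn h1).trans (by nlinarith [hlam n]))
      (frequently_lt_of_drift hκ hsum hstep)
  rw [Metric.tendsto_nhds]
  intro r hr
  filter_upwards [hmain (r ^ 2 / 4) (by positivity)] with n hn
  rw [dist_zero_right]
  refine lt_of_pow_lt_pow_left₀ 2 hr.le (hn.trans_lt ?_)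
  nlinarith [sq_nonneg r, pow_pos hr 2]

/-- Convergence of the stochastic-approximation recursion along one trajectory: `S` collects the
noise, `M` is the mean map. If `M` contracts the component orthogonal to the unit vector `e` and
its restriction to the line `ℝ e` has finitely many fixed points, then the trajectory converges
to one of them. -/
theorem exists_tendsto_fixedPoint {M : E → E} (hM : Continuous M) {B : ℝ} (hB : ∀ x, ‖M x‖ ≤ B)
    {e : E} (he : ‖e‖ = 1)
    (hcontr : ∀ x, x - inner ℝ x e • e ≠ 0 →
      inner ℝ (M x) (x - inner ℝ x e • e) < ‖x - inner ℝ x e • e‖ ^ 2)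
    (hfix : {t : ℝ | inner ℝ (M (t • e)) e = t}.Finite)
    {x S : ℕ → E} {S' : E} {lam : ℕ → ℝ} (hlam : ∀ n, 0 < lam n)
    (hlam0 : Tendsto lam atTop (𝓝 0))
    (hsum : Tendsto (fun n => ∑ k ∈ Finset.range n, lam k) atTop atTop)
    (hS : Tendsto S atTop (𝓝 S'))
    (hx : ∀ n, x (n + 1) = x n + lam n • (M (x n) - x n) + (S (n + 1) - S n)) :
    ∃ t : ℝ, inner ℝ (M (t • e)) e = t ∧ Tendsto x atTop (𝓝 (t • e)) := by
  have hee : inner ℝ e e = (1 : ℝ) := by rw [real_inner_self_eq_norm_sq, he, one_pow]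
  -- removing the tail of the noise gives a noiseless recursion with the same limit points
  set z : ℕ → E := fun n => x n - S n + S' with hzdef
  have hz : ∀ n, z (n + 1) = z n + lam n • (M (x n) - x n) := by
    intro n
    simp only [hzdef, hx n]
    abel
  have hxz' : ∀ n, x n - z n = S n - S' := fun n => by simp only [hzdef]; abel
  have hxz : Tendsto (fun n => x n - z n) atTop (𝓝 0) := by
    simp_rw [hxz']
    simpa using hS.sub_const S'
  obtain ⟨D, hD⟩ : ∃ D, ∀ n, ‖x n - z n‖ ≤ D := by
    obtain ⟨D, hD⟩ := hxz.norm.bddAbove_range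
    exact ⟨D, fun n => hD ⟨n, rfl⟩⟩
  obtain ⟨R₀, hR₀⟩ : ∃ R, ∀ n, ‖z n‖ ≤ R := by
    refine exists_norm_bound_of_averaging (b := fun n => M (x n) - (x n - z n)) (B := B + D)
      hlam hlam0 (fun n => (norm_sub_le _ _).trans (add_le_add (hB _) (hD n))) fun n => ?_
    rw [hz n]
    module
  set R := R₀ + D
  have hD0 : 0 ≤ D := (norm_nonneg _).trans (hD 0)
  have hzR : ∀ n, ‖z n‖ ≤ R := fun n => (hR₀ n).trans (by linarith)
  have hxR : ∀ n, ‖x n‖ ≤ R := by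
    intro n
    have := norm_add_le (z n) (x n - z n)
    rw [add_sub_cancel] at this
    exact this.trans (add_le_add (hR₀ n) (hD n))
  set T : E →L[ℝ] E := ContinuousLinearMap.id ℝ E - (innerSL ℝ e).smulRight e with hTdef
  have hTx : ∀ x, T x = x - inner ℝ x e • e := by
    intro x
    simp [hTdef, real_inner_comm]
  have hT0 : Tendsto (fun n => T (z n)) atTop (𝓝 0) := by
    refine tendsto_projection_zero hM T (fun x y => ?_) (fun x hx => ?_) hlam hlam0 hsum hxR hzR
      hxz hz
    · rw [hTx x, hTx y, inner_sub_left, inner_smul_left, inner_sub_right e, inner_smul_right, hee,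
        real_inner_comm y e]
      simp
    · rw [hTx] at hx ⊢
      exact hcontr x hx
  set a : ℕ → ℝ := fun n => inner ℝ (z n) e with hadef
  have haR : ∀ n, |a n| ≤ R := by
    intro n
    have := norm_inner_le_norm (𝕜 := ℝ) (z n) e
    rw [he, mul_one] at this
    exact this.trans (hzR n)
  have hza : Tendsto (fun n => x n - a n • e) atTop (𝓝 0) := by
    have := hxz.add hT0
    rw [add_zero] at this
    refine this.congr fun n => ?_
    rw [hTx]
    simp only [hadef]
    abel
  have hcont : Continuous fun x : E => inner ℝ (M x) e - inner ℝ x e :=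
    (hM.inner continuous_const).sub (continuous_id.inner continuous_const)
  -- the coordinate `a` obeys the scalar recursion on the line `ℝ e`, up to the error `ε` of
  -- evaluating the drift at `x n` instead of `a n • e`
  obtain ⟨t, ht, hlim⟩ := exists_tendsto_zero_of_drift (a := a) (lam := lam) (R := R)
    (g := fun t => inner ℝ (M (t • e)) e - t)
    (ε := fun n => (inner ℝ (M (x n)) e - inner ℝ (x n) e)
      - (inner ℝ (M (a n • e)) e - inner ℝ (a n • e) e)) hlam hlam0 hsum
    (((hM.comp (continuous_id.smul continuous_const)).inner continuous_const).sub continuous_id)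
    (by simpa only [sub_eq_zero] using hfix)
    (tendsto_sub_of_continuous_of_bounded hcont hxR
      (fun n => by rw [norm_smul, he, mul_one]; exact haR n) hza) haR (fun n => by
        simp only [hadef, hz n, inner_add_left, inner_smul_left, inner_sub_left, hee]
        simp)
  refine ⟨t, sub_eq_zero.1 ht, ?_⟩
  have := hza.add (hlim.smul_const e)
  simpa using this

end VectorDynamics

/-! ### The mixture law -/

section

open scoped NNReal

variable {d : ℕ}

/-- The Gaussian with mean `m` and covariance `s² I`, by its characteristic function. -/
theorem charFun_isotropic (s : ℝ) (m t : EuclideanSpace ℝ (Fin d)) :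
    charFun (multivariateGaussian m (s ^ 2 • (1 : Matrix (Fin d) (Fin d) ℝ))) t =
      Complex.exp (inner ℝ t m * Complex.I - s ^ 2 * ‖t‖ ^ 2 / 2) := by
  rw [charFun_multivariateGaussian (Matrix.PosSemidef.one.smul (sq_nonneg s))]
  congr 2
  rw [Matrix.smul_mulVec, Matrix.one_mulVec, dotProduct_smul, smul_eq_mul]
  have : t.ofLp ⬝ᵥ t.ofLp = ‖t‖ ^ 2 := by
    rw [EuclideanSpace.real_norm_sq_eq]
    simp [dotProduct, sq]
  rw [this]
  push_cast
  rfl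

theorem isotropic_map_isometry (s : ℝ) (m : EuclideanSpace ℝ (Fin d))
    (R : EuclideanSpace ℝ (Fin d) ≃ₗᵢ[ℝ] EuclideanSpace ℝ (Fin d)) :
    (multivariateGaussian m (s ^ 2 • (1 : Matrix (Fin d) (Fin d) ℝ))).map R =
      multivariateGaussian (R m) (s ^ 2 • (1 : Matrix (Fin d) (Fin d) ℝ)) := by
  have hR : Measurable R := R.continuous.measurable
  have := Measure.isProbabilityMeasure_map (μ := multivariateGaussian m
    (s ^ 2 • (1 : Matrix (Fin d) (Fin d) ℝ))) hR.aemeasurable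
  refine Measure.ext_of_charFun ?_
  ext t
  have h1 : charFun ((multivariateGaussian m (s ^ 2 • (1 : Matrix (Fin d) (Fin d) ℝ))).map R) t
      = charFun (multivariateGaussian m (s ^ 2 • (1 : Matrix (Fin d) (Fin d) ℝ))) (R.symm t) := by
    rw [charFun_apply, charFun_apply, integral_map hR.aemeasurable
      (by fun_prop : Continuous _).aestronglyMeasurable]
    simp_rw [R.inner_map_eq_flip]
  rw [h1, charFun_isotropic, charFun_isotropic, R.symm.norm_map, ← R.symm.inner_map_map t (R m),
    R.symm_apply_apply]

theorem isotropic_map_inner (s : ℝ) (m v : EuclideanSpace ℝ (Fin d)) :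
    (multivariateGaussian m (s ^ 2 • (1 : Matrix (Fin d) (Fin d) ℝ))).map
      (fun y => inner ℝ y v) = gaussianReal (inner ℝ m v) (s ^ 2 * ‖v‖ ^ 2).toNNReal := by
  have hR : Measurable fun y : EuclideanSpace ℝ (Fin d) => (inner ℝ y v : ℝ) := by fun_prop
  have := Measure.isProbabilityMeasure_map (μ := multivariateGaussian m
    (s ^ 2 • (1 : Matrix (Fin d) (Fin d) ℝ))) hR.aemeasurable
  refine Measure.ext_of_charFun ?_
  ext t
  have h1 : charFun ((multivariateGaussian m (s ^ 2 • (1 : Matrix (Fin d) (Fin d) ℝ))).map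
      (fun y => (inner ℝ y v : ℝ))) t
      = charFun (multivariateGaussian m (s ^ 2 • (1 : Matrix (Fin d) (Fin d) ℝ))) (t • v) := by
    rw [charFun_apply, charFun_apply, integral_map hR.aemeasurable
      (by fun_prop : Continuous _).aestronglyMeasurable]
    simp [inner_smul_right]
  rw [h1, charFun_isotropic, charFun_gaussianReal, norm_smul, inner_smul_left, real_inner_comm]
  congr 1
  rw [Real.coe_toNNReal _ (by positivity)]
  have : ((‖t‖ : ℝ) : ℂ) ^ 2 = (t : ℂ) ^ 2 := by
    rw [← Complex.ofReal_pow, Real.norm_eq_abs, sq_abs, Complex.ofReal_pow]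
  push_cast
  rw [mul_pow, this]
  simp
  ring

theorem integral_inner_isotropic (s : ℝ) (m v : EuclideanSpace ℝ (Fin d)) :
    ∫ y, inner ℝ y v ∂multivariateGaussian m (s ^ 2 • (1 : Matrix (Fin d) (Fin d) ℝ))
      = inner ℝ m v := by
  have h := integral_id_gaussianReal (μ := inner ℝ m v) (v := (s ^ 2 * ‖v‖ ^ 2).toNNReal)
  rwa [← isotropic_map_inner, integral_map (by fun_prop) (by fun_prop)] at h

theorem integral_inner_sq_isotropic (s : ℝ) (m v : EuclideanSpace ℝ (Fin d)) :
    ∫ y, (inner ℝ y v : ℝ) ^ 2 ∂multivariateGaussian m (s ^ 2 • (1 : Matrix (Fin d) (Fin d) ℝ))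
      = s ^ 2 * ‖v‖ ^ 2 + (inner ℝ m v) ^ 2 := by
  have h := variance_fun_id_gaussianReal (μ := inner ℝ m v) (v := (s ^ 2 * ‖v‖ ^ 2).toNNReal)
  rw [variance_eq_sub
    (show MemLp (fun x : ℝ => x) 2 _ from memLp_id_gaussianReal 2),
    Real.coe_toNNReal _ (by positivity)] at h
  have h2 := integral_id_gaussianReal (μ := inner ℝ m v) (v := (s ^ 2 * ‖v‖ ^ 2).toNNReal)
  rw [h2, ← isotropic_map_inner, integral_map (by fun_prop) (by fun_prop)] at h
  simp only [Pi.pow_apply] at h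
  linarith

theorem ae_inner_ne_zero_isotropic {s : ℝ} (hs : 0 < s) (m : EuclideanSpace ℝ (Fin d))
    {v : EuclideanSpace ℝ (Fin d)} (hv : v ≠ 0) :
    ∀ᵐ y ∂multivariateGaussian m (s ^ 2 • (1 : Matrix (Fin d) (Fin d) ℝ)),
      (inner ℝ y v : ℝ) ≠ 0 := by
  have hpos : (s ^ 2 * ‖v‖ ^ 2).toNNReal ≠ 0 := by
    have := norm_pos_iff.2 hv
    exact (Real.toNNReal_pos.2 (by positivity)).ne'
  have := nullSingletonClass_gaussianReal (μ := inner ℝ m v) hpos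
  have h : ∀ᵐ t ∂gaussianReal (inner ℝ m v) (s ^ 2 * ‖v‖ ^ 2).toNNReal, t ≠ 0 := by
    rw [ae_iff]
    simp
  rw [← isotropic_map_inner] at h
  exact ae_of_ae_map (f := fun y => (inner ℝ y v : ℝ)) (by fun_prop) h

theorem integrable_norm_pow_isotropic (s : ℝ) (m : EuclideanSpace ℝ (Fin d)) (k : ℕ) :
    Integrable (fun y => ‖y‖ ^ k)
      (multivariateGaussian m (s ^ 2 • (1 : Matrix (Fin d) (Fin d) ℝ))) := by
  have := IsGaussian.memLp_id (multivariateGaussian m (s ^ 2 • (1 : Matrix (Fin d) (Fin d) ℝ)))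
    (k : ENNReal) (by simp)
  exact this.integrable_norm_pow'

section Mixture

variable (σ : ℝ) (θ : EuclideanSpace ℝ (Fin d))

instance isProbabilityMeasure_mixtureLaw : IsProbabilityMeasure (mixtureLaw σ θ) where
  measure_univ := by
    simp [mixtureLaw, ENNReal.inv_two_add_inv_two]

theorem integrable_mixtureLaw_iff {F : Type*} [NormedAddCommGroup F]
    {f : EuclideanSpace ℝ (Fin d) → F} : Integrable f (mixtureLaw σ θ) ↔
      Integrable f (multivariateGaussian θ (σ ^ 2 • (1 : Matrix (Fin d) (Fin d) ℝ))) ∧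
      Integrable f (multivariateGaussian (-θ) (σ ^ 2 • (1 : Matrix (Fin d) (Fin d) ℝ))) := by
  rw [mixtureLaw, integrable_add_measure, integrable_smul_measure (by simp) (by simp),
    integrable_smul_measure (by simp) (by simp)]

theorem integral_mixtureLaw {f : EuclideanSpace ℝ (Fin d) → ℝ}
    (hf : Integrable f (mixtureLaw σ θ)) : ∫ y, f y ∂mixtureLaw σ θ =
      2⁻¹ * ∫ y, f y ∂multivariateGaussian θ (σ ^ 2 • (1 : Matrix (Fin d) (Fin d) ℝ)) +
      2⁻¹ * ∫ y, f y ∂multivariateGaussian (-θ) (σ ^ 2 • (1 : Matrix (Fin d) (Fin d) ℝ)) := by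
  obtain ⟨h1, h2⟩ := (integrable_mixtureLaw_iff σ θ).1 hf
  rw [mixtureLaw, integral_add_measure (h1.smul_measure (by simp)) (h2.smul_measure (by simp)),
    integral_smul_measure, integral_smul_measure]
  simp

theorem integrable_norm_pow_mixtureLaw (k : ℕ) :
    Integrable (fun y => ‖y‖ ^ k) (mixtureLaw σ θ) :=
  (integrable_mixtureLaw_iff σ θ).2
    ⟨integrable_norm_pow_isotropic _ _ _, integrable_norm_pow_isotropic _ _ _⟩

/-- A measurable function of at most polynomial growth is integrable under the mixture. -/
theorem integrable_mixtureLaw_of_norm_le {F : Type*} [NormedAddCommGroup F]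
    {f : EuclideanSpace ℝ (Fin d) → F} (hf : AEStronglyMeasurable f (mixtureLaw σ θ)) (C : ℝ)
    (k : ℕ) (h : ∀ y, ‖f y‖ ≤ C * ‖y‖ ^ k) : Integrable f (mixtureLaw σ θ) :=
  ((integrable_norm_pow_mixtureLaw σ θ k).const_mul C).mono' hf (Eventually.of_forall h)

/-- The symmetries of the mixture are the isometries that preserve its set of two centres. -/
theorem mixtureLaw_map_isometry
    (R : EuclideanSpace ℝ (Fin d) ≃ₗᵢ[ℝ] EuclideanSpace ℝ (Fin d))
    (hR : R θ = θ ∨ R θ = -θ) : (mixtureLaw σ θ).map R = mixtureLaw σ θ := by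
  have hRm : Measurable R := R.continuous.measurable
  rw [mixtureLaw, Measure.map_add _ _ hRm, Measure.map_smul, Measure.map_smul,
    isotropic_map_isometry, isotropic_map_isometry, map_neg]
  rcases hR with h | h
  · rw [h]
  · rw [h, neg_neg, add_comm]

theorem integral_mixtureLaw_comp_isometry {F : Type*} [NormedAddCommGroup F] [NormedSpace ℝ F]
    (R : EuclideanSpace ℝ (Fin d) ≃ₗᵢ[ℝ] EuclideanSpace ℝ (Fin d))
    (hR : R θ = θ ∨ R θ = -θ) (f : EuclideanSpace ℝ (Fin d) → F) :
    ∫ y, f (R y) ∂mixtureLaw σ θ = ∫ y, f y ∂mixtureLaw σ θ := by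
  conv_rhs => rw [← mixtureLaw_map_isometry σ θ R hR]
  exact (MeasurableEmbedding.integral_map R.toHomeomorph.measurableEmbedding f).symm

theorem integral_inner_mixtureLaw (v : EuclideanSpace ℝ (Fin d)) :
    ∫ y, (inner ℝ y v : ℝ) ∂mixtureLaw σ θ = 0 := by
  rw [integral_mixtureLaw, integral_inner_isotropic, integral_inner_isotropic, inner_neg_left]
  · ring
  · refine integrable_mixtureLaw_of_norm_le σ θ (by fun_prop) ‖v‖ 1 fun y => ?_
    rw [pow_one, mul_comm]
    exact norm_inner_le_norm _ _

theorem integrable_inner_sq_mixtureLaw (v : EuclideanSpace ℝ (Fin d)) :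
    Integrable (fun y => (inner ℝ y v : ℝ) ^ 2) (mixtureLaw σ θ) := by
  refine integrable_mixtureLaw_of_norm_le σ θ
    (by fun_prop : Continuous _).aestronglyMeasurable (‖v‖ ^ 2) 2 fun y => ?_
  rw [norm_pow, ← mul_pow, mul_comm]
  exact pow_le_pow_left₀ (norm_nonneg _) (norm_inner_le_norm _ _) 2

theorem integral_inner_sq_mixtureLaw (v : EuclideanSpace ℝ (Fin d)) :
    ∫ y, (inner ℝ y v : ℝ) ^ 2 ∂mixtureLaw σ θ = σ ^ 2 * ‖v‖ ^ 2 + (inner ℝ θ v) ^ 2 := by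
  rw [integral_mixtureLaw _ _ (integrable_inner_sq_mixtureLaw σ θ v), integral_inner_sq_isotropic,
    integral_inner_sq_isotropic, inner_neg_left]
  ring

theorem ae_inner_ne_zero_mixtureLaw {σ : ℝ} (hσ : 0 < σ) {v : EuclideanSpace ℝ (Fin d)}
    (hv : v ≠ 0) : ∀ᵐ y ∂mixtureLaw σ θ, (inner ℝ y v : ℝ) ≠ 0 := by
  rw [mixtureLaw, ae_add_measure_iff]
  exact ⟨Measure.ae_smul_measure (ae_inner_ne_zero_isotropic hσ _ hv) _,
    Measure.ae_smul_measure (ae_inner_ne_zero_isotropic hσ _ hv) _⟩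

/-- The identity that makes the true parameter a fixed point: multiplying the density of
`N(m, v)` by `1 - tanh (m t / v)` gives an even function, so `t` has integral zero against it. -/
theorem integral_one_sub_tanh_mul_gaussianReal (m : ℝ) {v : ℝ≥0} (hv : v ≠ 0) :
    ∫ t, (1 - Real.tanh (m * t / v)) * t ∂gaussianReal m v = 0 := by
  rw [integral_gaussianReal_eq_integral_smul hv]
  have hv' : (v : ℝ) ≠ 0 := by exact_mod_cast hv
  have hw : ∀ t, gaussianPDFReal m v (-t) * (1 + Real.tanh (m * t / v))
      = gaussianPDFReal m v t * (1 - Real.tanh (m * t / v)) := by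
    intro t
    have hc := (Real.cosh_pos (m * t / v)).ne'
    have e1 : 1 + Real.tanh (m * t / v) = Real.exp (m * t / v) / Real.cosh (m * t / v) := by
      rw [Real.tanh_eq_sinh_div_cosh, ← Real.cosh_add_sinh, add_div, div_self hc]
    have e2 : 1 - Real.tanh (m * t / v) = Real.exp (-(m * t / v)) / Real.cosh (m * t / v) := by
      rw [Real.tanh_eq_sinh_div_cosh, ← Real.cosh_sub_sinh, sub_div, div_self hc]
    rw [e1, e2, gaussianPDFReal_def]
    simp only
    rw [mul_assoc, mul_assoc (√(2 * Real.pi * v))⁻¹]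
    congr 1
    rw [mul_div_assoc', mul_div_assoc', ← Real.exp_add, ← Real.exp_add]
    congr 2
    field_simp
    ring
  have h := integral_neg_eq_self
    (fun t => gaussianPDFReal m v t • ((1 - Real.tanh (m * t / v)) * t)) volume
  have h2 : (fun t : ℝ => gaussianPDFReal m v (-t) • ((1 - Real.tanh (m * -t / v)) * -t))
      = fun t => -(gaussianPDFReal m v t • ((1 - Real.tanh (m * t / v)) * t)) := by
    ext t
    rw [mul_neg m, neg_div, Real.tanh_neg, sub_neg_eq_add, smul_eq_mul, smul_eq_mul, ← mul_assoc,
      hw]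
    ring
  rw [h2, integral_neg] at h
  linarith

end Mixture

end

/-! ### The EM map -/

section

open scoped NNReal

variable {d : ℕ}

/-- The population EM map `θ ↦ E[tanh (⟨y, θ⟩ / σ²) y]` of the symmetric two-component mixture. -/
noncomputable def emMap (σ : ℝ) (θopt θ : EuclideanSpace ℝ (Fin d)) : EuclideanSpace ℝ (Fin d) :=
  ∫ y, Real.tanh (inner ℝ y θ / σ ^ 2) • y ∂mixtureLaw σ θopt

theorem norm_tanh_smul_le (t : ℝ) (y : EuclideanSpace ℝ (Fin d)) : ‖Real.tanh t • y‖ ≤ ‖y‖ := by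
  rw [norm_smul]
  exact mul_le_of_le_one_left (norm_nonneg _) (Real.abs_tanh_lt_one t).le

theorem continuous_tanh_smul_right (σ : ℝ) (θ : EuclideanSpace ℝ (Fin d)) : Continuous
    fun y : EuclideanSpace ℝ (Fin d) => Real.tanh (inner ℝ y θ / σ ^ 2) • y :=
  by fun_prop

section

variable (σ : ℝ) (θopt : EuclideanSpace ℝ (Fin d))

theorem integrable_tanh_smul (θ : EuclideanSpace ℝ (Fin d)) :
    Integrable (fun y => Real.tanh (inner ℝ y θ / σ ^ 2) • y) (mixtureLaw σ θopt) :=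
  integrable_mixtureLaw_of_norm_le σ θopt (continuous_tanh_smul_right σ θ).aestronglyMeasurable 1 1
    fun y => by simpa using norm_tanh_smul_le _ y

theorem continuous_emMap : Continuous (emMap σ θopt) := by
  refine continuous_of_dominated (bound := fun y => ‖y‖)
    (fun θ => (continuous_tanh_smul_right σ θ).aestronglyMeasurable)
    (fun θ => Eventually.of_forall fun y => norm_tanh_smul_le _ y) ?_
    (Eventually.of_forall fun y => by fun_prop)
  simpa using integrable_norm_pow_mixtureLaw σ θopt 1

theorem norm_emMap_le (θ : EuclideanSpace ℝ (Fin d)) :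
    ‖emMap σ θopt θ‖ ≤ ∫ y, ‖y‖ ∂mixtureLaw σ θopt :=
  norm_integral_le_of_norm_le (by simpa using integrable_norm_pow_mixtureLaw σ θopt 1)
    (Eventually.of_forall fun y => norm_tanh_smul_le _ y)

theorem inner_emMap (θ v : EuclideanSpace ℝ (Fin d)) : inner ℝ (emMap σ θopt θ) v =
    ∫ y, Real.tanh (inner ℝ y θ / σ ^ 2) * inner ℝ y v ∂mixtureLaw σ θopt := by
  rw [real_inner_comm, emMap, ← integral_inner (integrable_tanh_smul σ θopt θ)]
  simp_rw [inner_smul_right, real_inner_comm v]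

theorem integrable_tanh_mul_inner (t : EuclideanSpace ℝ (Fin d) → ℝ) (ht : Continuous t)
    (v : EuclideanSpace ℝ (Fin d)) :
    Integrable (fun y => Real.tanh (t y) * inner ℝ y v) (mixtureLaw σ θopt) := by
  refine integrable_mixtureLaw_of_norm_le σ θopt
    (by fun_prop : Continuous _).aestronglyMeasurable ‖v‖ 1 fun y => ?_
  rw [norm_mul, pow_one, mul_comm ‖v‖]
  exact (mul_le_of_le_one_left (norm_nonneg _) (Real.abs_tanh_lt_one _).le).trans
    (norm_inner_le_norm _ _)

theorem emMap_neg (θ : EuclideanSpace ℝ (Fin d)) : emMap σ θopt (-θ) = -emMap σ θopt θ := by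
  simp only [emMap, inner_neg_right, neg_div, Real.tanh_neg, neg_smul, integral_neg]

end

/-- Strict inequality between integrals of almost everywhere strictly ordered functions. -/
theorem integral_lt_integral_of_ae_lt {X : Type*} [MeasurableSpace X] {μ : Measure X} [NeZero μ]
    {f g : X → ℝ} (hf : Integrable f μ) (hg : Integrable g μ) (h : ∀ᵐ x ∂μ, f x < g x) :
    ∫ x, f x ∂μ < ∫ x, g x ∂μ := by
  refine lt_of_le_of_ne (integral_mono_ae hf hg (h.mono fun x hx => hx.le)) fun heq => ?_
  have h0 : ∫ x, (g x - f x) ∂μ = 0 := by rw [integral_sub hg hf, heq, sub_self]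
  rw [integral_eq_zero_iff_of_nonneg_ae (h.mono fun x hx => sub_nonneg.2 hx.le) (hg.sub hf)] at h0
  obtain ⟨x, hx1, hx2⟩ := (h.and h0).exists
  simp only [Pi.zero_apply] at hx2
  linarith

/-- The orthogonal reflection through the hyperplane `v⊥`. -/
noncomputable def hyperplaneReflection (v : EuclideanSpace ℝ (Fin d)) :
    EuclideanSpace ℝ (Fin d) ≃ₗᵢ[ℝ] EuclideanSpace ℝ (Fin d) :=
  (Submodule.span ℝ {v})ᗮ.reflection

theorem hyperplaneReflection_self (v : EuclideanSpace ℝ (Fin d)) :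
    hyperplaneReflection v v = -v := by
  exact Submodule.reflection_orthogonalComplement_singleton_eq_neg v

theorem hyperplaneReflection_of_inner_eq_zero {v x : EuclideanSpace ℝ (Fin d)}
    (h : inner ℝ x v = (0 : ℝ)) : hyperplaneReflection v x = x := by
  refine Submodule.reflection_mem_subspace_eq_self ?_
  rw [Submodule.mem_orthogonal_singleton_iff_inner_right, real_inner_comm]
  exact h

theorem inner_hyperplaneReflection (v x y : EuclideanSpace ℝ (Fin d)) :
    (inner ℝ (hyperplaneReflection v x) y : ℝ) = inner ℝ x (hyperplaneReflection v y) := by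
  have := (hyperplaneReflection v).inner_map_map x (hyperplaneReflection v y)
  rwa [hyperplaneReflection, Submodule.reflection_reflection] at this

section

variable {σ : ℝ} {θopt : EuclideanSpace ℝ (Fin d)}

/-- The EM map strictly shrinks every component orthogonal to the true parameter: averaging the
integrand with its image under the reflection in `v` leaves an increment of `tanh`. -/
theorem inner_emMap_lt_of_orthogonal (hσ : 0 < σ) {θ v : EuclideanSpace ℝ (Fin d)} (hv : v ≠ 0)
    (hθopt : inner ℝ θopt v = (0 : ℝ)) (hθ : inner ℝ θ v = ‖v‖ ^ 2) :
    inner ℝ (emMap σ θopt θ) v < ‖v‖ ^ 2 := by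
  set R := hyperplaneReflection v
  have hRθ : R θ = θ - (2 : ℝ) • v := by
    have h1 : inner ℝ (θ - v) v = (0 : ℝ) := by
      rw [inner_sub_left, hθ, real_inner_self_eq_norm_sq, sub_self]
    have h2 := hyperplaneReflection_of_inner_eq_zero h1
    rw [map_sub, hyperplaneReflection_self] at h2
    rw [show R θ = (θ - v) - v by rw [← h2]; abel]
    module
  -- the reflection in `v` preserves the mixture law and shifts `⟨y, θ⟩` by `-2 ⟨y, v⟩`
  have hrefl : inner ℝ (emMap σ θopt θ) v = ∫ y,
      -(Real.tanh ((inner ℝ y θ - 2 * inner ℝ y v) / σ ^ 2) * inner ℝ y v)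
        ∂mixtureLaw σ θopt := by
    rw [inner_emMap, ← integral_mixtureLaw_comp_isometry σ θopt R
      (Or.inl (hyperplaneReflection_of_inner_eq_zero hθopt))]
    refine integral_congr_ae (Eventually.of_forall fun y => ?_)
    have e1 : (inner ℝ (R y) θ : ℝ) = inner ℝ y θ - 2 * inner ℝ y v := by
      rw [inner_hyperplaneReflection, hRθ, inner_sub_right, inner_smul_right]
    have e2 : (inner ℝ (R y) v : ℝ) = -inner ℝ y v := by
      rw [inner_hyperplaneReflection, hyperplaneReflection_self, inner_neg_right]
    simp only [e1, e2, mul_neg]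
  have hi1 := integrable_tanh_mul_inner σ θopt (fun y => inner ℝ y θ / σ ^ 2) (by fun_prop) v
  have hi2 : Integrable (fun y =>
      -(Real.tanh ((inner ℝ y θ - 2 * inner ℝ y v) / σ ^ 2) * inner ℝ y v))
      (mixtureLaw σ θopt) := (integrable_tanh_mul_inner σ θopt
    (fun y => (inner ℝ y θ - 2 * inner ℝ y v) / σ ^ 2) (by fun_prop) v).neg
  have hsum : 2 * inner ℝ (emMap σ θopt θ) v = ∫ y,
      (Real.tanh (inner ℝ y θ / σ ^ 2) * inner ℝ y v
        + -(Real.tanh ((inner ℝ y θ - 2 * inner ℝ y v) / σ ^ 2) * inner ℝ y v))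
        ∂mixtureLaw σ θopt := by
    rw [two_mul, integral_add hi1 hi2, ← hrefl, ← inner_emMap]
  have hlt : 2 * inner ℝ (emMap σ θopt θ) v
      < ∫ y, 2 / σ ^ 2 * (inner ℝ y v : ℝ) ^ 2 ∂mixtureLaw σ θopt := by
    rw [hsum]
    refine integral_lt_integral_of_ae_lt (hi1.add hi2)
      ((integrable_inner_sq_mixtureLaw σ θopt v).const_mul _) ?_
    filter_upwards [ae_inner_ne_zero_mixtureLaw θopt hσ hv] with y hy
    have hne : (inner ℝ y θ : ℝ) / σ ^ 2 ≠ (inner ℝ y θ - 2 * inner ℝ y v) / σ ^ 2 := by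
      intro h
      rw [div_left_inj' (by positivity)] at h
      exact hy (by linarith)
    have h1 := tanh_sub_mul_sub_lt hne
    have h2 : (inner ℝ y θ : ℝ) / σ ^ 2 - (inner ℝ y θ - 2 * inner ℝ y v) / σ ^ 2
        = 2 / σ ^ 2 * inner ℝ y v := by ring
    rw [h2] at h1
    have h3 : 0 < 2 / σ ^ 2 := by positivity
    refine lt_of_mul_lt_mul_left ?_ h3.le
    calc _ = (Real.tanh (inner ℝ y θ / σ ^ 2)
          - Real.tanh ((inner ℝ y θ - 2 * inner ℝ y v) / σ ^ 2)) * (2 / σ ^ 2 * inner ℝ y v) := by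
          ring
      _ < _ := h1
      _ = _ := by ring
  rw [integral_const_mul, integral_inner_sq_mixtureLaw, hθopt] at hlt
  have : 2 / σ ^ 2 * (σ ^ 2 * ‖v‖ ^ 2 + 0 ^ 2) = 2 * ‖v‖ ^ 2 := by field_simp; ring
  linarith

/-- The true parameter is a fixed point of the EM map. Only the component along `θopt` is needed. -/
theorem inner_emMap_self (hσ : 0 < σ) (hθopt : θopt ≠ 0) :
    inner ℝ (emMap σ θopt θopt) θopt = ‖θopt‖ ^ 2 := by
  have hi := integrable_tanh_mul_inner σ θopt (fun y => inner ℝ y θopt / σ ^ 2) (by fun_prop) θopt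
  set N := multivariateGaussian θopt (σ ^ 2 • (1 : Matrix (Fin d) (Fin d) ℝ))
  have hiN := ((integrable_mixtureLaw_iff σ θopt).1 hi).1
  have hneg : ∫ y, Real.tanh (inner ℝ y θopt / σ ^ 2) * inner ℝ y θopt
      ∂multivariateGaussian (-θopt) (σ ^ 2 • (1 : Matrix (Fin d) (Fin d) ℝ))
      = ∫ y, Real.tanh (inner ℝ y θopt / σ ^ 2) * inner ℝ y θopt ∂N := by
    have h := isotropic_map_isometry σ θopt (LinearIsometryEquiv.neg ℝ)
    rw [show (LinearIsometryEquiv.neg ℝ) θopt = -θopt from rfl] at h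
    rw [← h, integral_map (LinearIsometryEquiv.neg ℝ).continuous.measurable.aemeasurable
      (by fun_prop : Continuous _).aestronglyMeasurable]
    simp [N, neg_div]
  have hmix : inner ℝ (emMap σ θopt θopt) θopt
      = ∫ y, Real.tanh (inner ℝ y θopt / σ ^ 2) * inner ℝ y θopt ∂N := by
    rw [inner_emMap, integral_mixtureLaw σ θopt hi, hneg]
    ring
  have hpos : 0 < ‖θopt‖ := norm_pos_iff.2 hθopt
  set v : ℝ≥0 := (σ ^ 2 * ‖θopt‖ ^ 2).toNNReal with hvdef
  have hv : v ≠ 0 := (Real.toNNReal_pos.2 (by positivity)).ne'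
  have hvc : (v : ℝ) = σ ^ 2 * ‖θopt‖ ^ 2 := Real.coe_toNNReal _ (by positivity)
  have h0 := integral_one_sub_tanh_mul_gaussianReal (‖θopt‖ ^ 2) hv
  have hmap := isotropic_map_inner σ θopt θopt
  rw [real_inner_self_eq_norm_sq] at hmap
  rw [← hmap, integral_map (by fun_prop) (by fun_prop : Continuous _).aestronglyMeasurable,
    hvc] at h0
  have harg : ∀ t : ℝ, ‖θopt‖ ^ 2 * t / (σ ^ 2 * ‖θopt‖ ^ 2) = t / σ ^ 2 := by
    intro t
    field_simp
  simp_rw [harg, sub_mul, one_mul] at h0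
  rw [integral_sub _ hiN, integral_inner_isotropic, real_inner_self_eq_norm_sq] at h0
  · rw [hmix]
    linarith
  · exact (IsGaussian.integrable_fun_id (μ := N)).inner_const θopt

theorem continuous_inner_div (σ : ℝ) (θ : EuclideanSpace ℝ (Fin d)) :
    Continuous fun y : EuclideanSpace ℝ (Fin d) => (inner ℝ y θ : ℝ) / σ ^ 2 := by fun_prop

/-- Along a ray from the origin the EM map is strictly concave. -/
theorem mul_inner_emMap_lt (hσ : 0 < σ) {θ : EuclideanSpace ℝ (Fin d)} (hθ : θ ≠ 0) {l : ℝ}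
    (hl : 0 < l) (hl1 : l < 1) :
    l * inner ℝ (emMap σ θopt θ) θ < inner ℝ (emMap σ θopt (l • θ)) θ := by
  rw [inner_emMap, inner_emMap, ← integral_const_mul]
  refine integral_lt_integral_of_ae_lt
    ((integrable_tanh_mul_inner σ θopt _ (continuous_inner_div σ θ) θ).const_mul l)
    (integrable_tanh_mul_inner σ θopt _ (continuous_inner_div σ _) θ) ?_
  filter_upwards [ae_inner_ne_zero_mixtureLaw θopt hσ hθ] with y hy
  have h := tanh_mul_mul_lt hl hl1 (div_ne_zero hy (pow_ne_zero 2 hσ.ne'))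
  rw [inner_smul_right, mul_div_assoc]
  have h3 : 0 < 1 / σ ^ 2 := by positivity
  refine lt_of_mul_lt_mul_left ?_ h3.le
  calc _ = l * (Real.tanh (inner ℝ y θ / σ ^ 2) * (inner ℝ y θ / σ ^ 2)) := by ring
    _ < _ := h
    _ = _ := by ring

/-- A second fixed point on the ray of `θopt` would contradict the strict concavity, since `0` and
`θopt` are fixed points already. -/
theorem inner_emMap_smul_ne (hσ : 0 < σ) (hθopt : θopt ≠ 0) {t : ℝ} (ht : 0 < t) (ht1 : t ≠ 1) :
    inner ℝ (emMap σ θopt (t • θopt)) θopt ≠ t * ‖θopt‖ ^ 2 := by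
  rcases lt_or_gt_of_ne ht1 with h | h
  · have := mul_inner_emMap_lt hσ (θopt := θopt) hθopt ht h
    rw [inner_emMap_self hσ hθopt] at this
    exact this.ne'
  · have := mul_inner_emMap_lt hσ (θopt := θopt) (smul_ne_zero ht.ne' hθopt) (inv_pos.2 ht)
      (inv_lt_one_of_one_lt₀ h)
    rw [smul_smul, inv_mul_cancel₀ ht.ne', one_smul, inner_smul_right, inner_smul_right,
      inner_emMap_self hσ hθopt, ← mul_assoc, inv_mul_cancel₀ ht.ne', one_mul] at this
    exact this.ne

/-- On the line through the true parameter the EM map has no fixed points besides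
`0` and `± θopt`. -/
theorem eq_zero_or_of_inner_emMap_smul_eq (hσ : 0 < σ) (hθopt : θopt ≠ 0) {t : ℝ}
    (h : inner ℝ (emMap σ θopt (t • θopt)) θopt = t * ‖θopt‖ ^ 2) : t = 0 ∨ t = 1 ∨ t = -1 := by
  rcases lt_trichotomy t 0 with ht | ht | ht
  · right; right
    by_contra hne
    refine inner_emMap_smul_ne hσ hθopt (t := -t) (by linarith) (fun h1 => hne (by linarith)) ?_
    rw [neg_smul, emMap_neg, inner_neg_left, h]
    ring
  · exact Or.inl ht
  · right; left
    by_contra hne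
    exact inner_emMap_smul_ne hσ hθopt ht hne h

/-- Expansion of the EM map at the origin in the direction of the true parameter. Its error is
proportional to the component of the state in that direction, because the hyperplane orthogonal
to the true parameter is invariant. -/
theorem abs_inner_emMap_sub_le (hσ : 0 < σ) {e : EuclideanSpace ℝ (Fin d)} (he : ‖e‖ = 1) {ρ : ℝ}
    (hθopt : θopt = ρ • e) (θ : EuclideanSpace ℝ (Fin d)) :
    |inner ℝ (emMap σ θopt θ) e - inner ℝ θ e * (1 + ρ ^ 2 / σ ^ 2)|
      ≤ |inner ℝ θ e| * (‖θ‖ ^ 2 * (9 / σ ^ 6 * ∫ y, ‖y‖ ^ 4 ∂mixtureLaw σ θopt)) := by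
  have hee : inner ℝ e e = (1 : ℝ) := by rw [real_inner_self_eq_norm_sq, he, one_pow]
  set u : ℝ := inner ℝ θ e with hu
  set v := θ - u • e with hv
  have hve : inner ℝ v e = (0 : ℝ) := by
    rw [hv, inner_sub_left, inner_smul_left, hee]
    simp [hu]
  have hu_le : |u| ≤ ‖θ‖ := by
    have := norm_inner_le_norm (𝕜 := ℝ) θ e
    rwa [he, mul_one] at this
  have hv_le : ‖v‖ ≤ 2 * ‖θ‖ := by
    refine (norm_sub_le _ _).trans ?_
    rw [norm_smul, he, Real.norm_eq_abs]
    linarith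
  have hiv := integrable_tanh_mul_inner σ θopt _ (continuous_inner_div σ v) e
  have hiθ := integrable_tanh_mul_inner σ θopt _ (continuous_inner_div σ θ) e
  -- the hyperplane orthogonal to `e` is invariant: the integrand is odd under reflection in `e`
  have hv0 : ∫ y, Real.tanh (inner ℝ y v / σ ^ 2) * inner ℝ y e ∂mixtureLaw σ θopt = 0 := by
    have h := integral_mixtureLaw_comp_isometry σ θopt (hyperplaneReflection e)
      (Or.inr (by rw [hθopt, map_smul, hyperplaneReflection_self, smul_neg]))
      (fun y => Real.tanh (inner ℝ y v / σ ^ 2) * inner ℝ y e)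
    simp_rw [inner_hyperplaneReflection, hyperplaneReflection_self, inner_neg_right,
      hyperplaneReflection_of_inner_eq_zero hve, mul_neg, integral_neg] at h
    linarith
  have hisq := (integrable_inner_sq_mixtureLaw σ θopt e).const_mul (u / σ ^ 2)
  have hsq : ∫ y, u / σ ^ 2 * (inner ℝ y e : ℝ) ^ 2 ∂mixtureLaw σ θopt
      = u * (1 + ρ ^ 2 / σ ^ 2) := by
    rw [integral_const_mul, integral_inner_sq_mixtureLaw, he, hθopt, inner_smul_left, hee]
    simp only [conj_trivial]
    field_simp
  have hmain : inner ℝ (emMap σ θopt θ) e - u * (1 + ρ ^ 2 / σ ^ 2) = ∫ y,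
      (Real.tanh (inner ℝ y θ / σ ^ 2) * inner ℝ y e
        - Real.tanh (inner ℝ y v / σ ^ 2) * inner ℝ y e
        - u / σ ^ 2 * (inner ℝ y e : ℝ) ^ 2) ∂mixtureLaw σ θopt := by
    have hidiff : Integrable (fun y => Real.tanh (inner ℝ y θ / σ ^ 2) * inner ℝ y e
        - Real.tanh (inner ℝ y v / σ ^ 2) * inner ℝ y e) (mixtureLaw σ θopt) := hiθ.sub hiv
    rw [integral_sub hidiff hisq, integral_sub hiθ hiv, hsq, hv0, inner_emMap, sub_zero]
  rw [hmain, ← Real.norm_eq_abs]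
  have hbound : ∀ y : EuclideanSpace ℝ (Fin d), ‖Real.tanh (inner ℝ y θ / σ ^ 2) * inner ℝ y e
        - Real.tanh (inner ℝ y v / σ ^ 2) * inner ℝ y e
        - u / σ ^ 2 * (inner ℝ y e : ℝ) ^ 2‖
        ≤ |u| * (‖θ‖ ^ 2 * (9 / σ ^ 6 * ‖y‖ ^ 4)) := by
    intro y
    have hye : |(inner ℝ y e : ℝ)| ≤ ‖y‖ := by
      have := norm_inner_le_norm (𝕜 := ℝ) y e
      rwa [he, mul_one] at this
    have hyv : |(inner ℝ y v : ℝ)| ≤ ‖y‖ * (2 * ‖θ‖) :=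
      (norm_inner_le_norm (𝕜 := ℝ) y v).trans (mul_le_mul_of_nonneg_left hv_le (norm_nonneg _))
    have hsplit : (inner ℝ y θ : ℝ) / σ ^ 2
        = u * inner ℝ y e / σ ^ 2 + inner ℝ y v / σ ^ 2 := by
      rw [hv, inner_sub_right, inner_smul_right]
      ring
    have h1 := abs_tanh_add_sub_le (u * inner ℝ y e / σ ^ 2) (inner ℝ y v / σ ^ 2)
    rw [← hsplit] at h1
    have hσ2 : |σ ^ 2| = σ ^ 2 := abs_of_pos (by positivity)
    have h2 : |u * inner ℝ y e / σ ^ 2| ≤ |u| * ‖y‖ / σ ^ 2 := by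
      rw [abs_div, abs_mul, hσ2]
      gcongr
    have h3 : |u * inner ℝ y e / σ ^ 2| + |inner ℝ y v / σ ^ 2| ≤ 3 * (‖θ‖ * ‖y‖) / σ ^ 2 := by
      rw [abs_div, abs_div, abs_mul, hσ2, ← add_div]
      gcongr
      have := mul_le_mul hu_le hye (abs_nonneg _) (norm_nonneg _)
      linarith
    calc _ = |Real.tanh (inner ℝ y θ / σ ^ 2) - Real.tanh (inner ℝ y v / σ ^ 2)
          - u * inner ℝ y e / σ ^ 2| * |(inner ℝ y e : ℝ)| := by
          rw [Real.norm_eq_abs, ← abs_mul]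
          congr 1
          ring
      _ ≤ (|u| * ‖y‖ / σ ^ 2 * (3 * (‖θ‖ * ‖y‖) / σ ^ 2) ^ 2) * ‖y‖ := by
          refine mul_le_mul (h1.trans ?_) hye (abs_nonneg _) (by positivity)
          gcongr
      _ = _ := by ring
  refine (norm_integral_le_of_norm_le ?_ (Eventually.of_forall hbound)).trans_eq ?_
  · exact (((integrable_norm_pow_mixtureLaw σ θopt 4).const_mul _).const_mul _).const_mul _
  · rw [integral_const_mul, integral_const_mul, integral_const_mul]

/-- The origin is unstable in the direction `e` of the true parameter, uniformly on a ball. -/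
theorem exists_le_inner_emMap_sub_mul (hσ : 0 < σ) {e : EuclideanSpace ℝ (Fin d)}
    (he : ‖e‖ = 1) {ρ : ℝ} (hρ : 0 < ρ) (hθopt : θopt = ρ • e) :
    ∃ r > 0, ∀ θ : EuclideanSpace ℝ (Fin d), ‖θ‖ ≤ r →
      ρ ^ 2 / (2 * σ ^ 2) * inner ℝ θ e ^ 2
        ≤ (inner ℝ (emMap σ θopt θ) e - inner ℝ θ e) * inner ℝ θ e := by
  set K := 9 / σ ^ 6 * ∫ y, ‖y‖ ^ 4 ∂mixtureLaw σ θopt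
  have hlim : Tendsto (fun r : ℝ => r ^ 2 * K) (𝓝 0) (𝓝 0) := by
    have : Continuous fun r : ℝ => r ^ 2 * K := by fun_prop
    simpa using this.tendsto 0
  obtain ⟨δ, hδ, hb⟩ := Metric.eventually_nhds_iff_ball.1
    (hlim.eventually (gt_mem_nhds (show 0 < ρ ^ 2 / (2 * σ ^ 2) by positivity)))
  refine ⟨δ / 2, by positivity, fun θ hθ => ?_⟩
  have h1 := (abs_inner_emMap_sub_le hσ he hθopt θ).trans
    (mul_le_mul_of_nonneg_left (hb ‖θ‖ (by simp; linarith)).le (abs_nonneg _))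
  set u : ℝ := inner ℝ θ e
  have h2 := mul_le_mul_of_nonneg_right h1 (abs_nonneg u)
  rw [← abs_mul] at h2
  have h3 := (abs_le.1 h2).1
  have h4 : |u| * (ρ ^ 2 / (2 * σ ^ 2)) * |u| = ρ ^ 2 / (2 * σ ^ 2) * u ^ 2 := by
    rw [← sq_abs u]; ring
  rw [h4] at h3
  have h5 : ρ ^ 2 / σ ^ 2 * u ^ 2 = 2 * (ρ ^ 2 / (2 * σ ^ 2) * u ^ 2) := by field_simp
  nlinarith

end

end

/-! ### Independence along an adapted recursion, and convergence of its accumulated noise -/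

section History

variable {Ω X Z : Type*} [MeasurableSpace Ω] [MeasurableSpace X] [MeasurableSpace Z]

/-- The initial state together with the first `n` innovations. -/
def history (x₀ : Ω → X) (z : ℕ → Ω → Z) (n : ℕ) (ω : Ω) : X × (Finset.range n → Z) :=
  (x₀ ω, fun k => z k ω)

theorem measurable_history {x₀ : Ω → X} {z : ℕ → Ω → Z} (hx₀ : Measurable x₀)
    (hz : ∀ n, Measurable (z n)) (n : ℕ) : Measurable (history x₀ z n) :=
  hx₀.prodMk (measurable_pi_lambda _ fun k => hz k)

/-- The filtration generated by the initial state and the innovations: at time `n` the innovations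
`z 0, …, z (n - 1)` are known. -/
def historyFiltration {x₀ : Ω → X} {z : ℕ → Ω → Z} (hx₀ : Measurable x₀)
    (hz : ∀ n, Measurable (z n)) : Filtration ℕ ‹MeasurableSpace Ω› where
  seq n := MeasurableSpace.comap (history x₀ z n) inferInstance
  mono' := by
    intro m n hmn
    have hsub : ∀ k : Finset.range m, (k : ℕ) ∈ Finset.range n := fun k =>
      Finset.mem_range.2 ((Finset.mem_range.1 k.2).trans_le hmn)
    have hr : Measurable fun p : X × (Finset.range n → Z) =>
        (p.1, fun k : Finset.range m => p.2 ⟨k, hsub k⟩) :=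
      measurable_fst.prodMk (measurable_pi_lambda _ fun k =>
        (measurable_pi_apply _).comp measurable_snd)
    have hcomp : history x₀ z m = (fun p : X × (Finset.range n → Z) =>
        (p.1, fun k : Finset.range m => p.2 ⟨k, hsub k⟩)) ∘ history x₀ z n := rfl
    change MeasurableSpace.comap (history x₀ z m) inferInstance ≤ _
    rw [hcomp, ← MeasurableSpace.comap_comp]
    exact MeasurableSpace.comap_mono hr.comap_le
  le' n := (measurable_history hx₀ hz n).comap_le

theorem measurable_innovation_history {x₀ : Ω → X} {z : ℕ → Ω → Z} (hx₀ : Measurable x₀)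
    (hz : ∀ n, Measurable (z n)) (n : ℕ) :
    Measurable[historyFiltration hx₀ hz (n + 1)] (z n) := by
  have h : Measurable[historyFiltration hx₀ hz (n + 1)] (history x₀ z (n + 1)) :=
    comap_measurable _
  exact (measurable_pi_apply (⟨n, Finset.self_mem_range_succ n⟩ : Finset.range (n + 1))).comp
    (measurable_snd.comp h)

/-- The states of a recursion driven by the innovations are adapted. -/
theorem measurable_state_history {x : ℕ → Ω → X} {z : ℕ → Ω → Z} (hx₀ : Measurable (x 0))
    (hz : ∀ n, Measurable (z n)) {f : ℕ → X → Z → X}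
    (hf : ∀ n, Measurable (Function.uncurry (f n)))
    (hx : ∀ n ω, x (n + 1) ω = f n (x n ω) (z n ω)) (n : ℕ) :
    Measurable[historyFiltration hx₀ hz n] (x n) := by
  induction n with
  | zero =>
    have h : Measurable[historyFiltration hx₀ hz 0] (history (x 0) z 0) := comap_measurable _
    exact measurable_fst.comp h
  | succ n ih =>
    have h1 : Measurable[historyFiltration hx₀ hz (n + 1)] (x n) :=
      ih.mono ((historyFiltration hx₀ hz).mono n.le_succ) le_rfl
    have h2 := (hf n).comp (h1.prodMk (measurable_innovation_history hx₀ hz n))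
    have h3 : x (n + 1) = Function.uncurry (f n) ∘ fun ω => (x n ω, z n ω) := funext (hx n)
    rw [h3]
    exact h2

variable {P : Measure Ω} [IsProbabilityMeasure P]

theorem indepFun_prodMk_of_indepFun {A B C : Type*} [MeasurableSpace A] [MeasurableSpace B]
    [MeasurableSpace C] {a : Ω → A} {b : Ω → B} {c : Ω → C} (ha : Measurable a)
    (hb : Measurable b) (hc : Measurable c) (h1 : IndepFun a (fun ω => (b ω, c ω)) P)
    (h2 : IndepFun b c P) : IndepFun (fun ω => (a ω, b ω)) c P := by
  have hab : IndepFun a b P := h1.comp measurable_id measurable_fst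
  have := Measure.isProbabilityMeasure_map (μ := P) ha.aemeasurable
  have := Measure.isProbabilityMeasure_map (μ := P) hb.aemeasurable
  have := Measure.isProbabilityMeasure_map (μ := P) hc.aemeasurable
  rw [indepFun_iff_map_prod_eq_prod_map_map (ha.prodMk hb).aemeasurable hc.aemeasurable,
    (indepFun_iff_map_prod_eq_prod_map_map ha.aemeasurable hb.aemeasurable).1 hab]
  rw [indepFun_iff_map_prod_eq_prod_map_map ha.aemeasurable (hb.prodMk hc).aemeasurable,
    (indepFun_iff_map_prod_eq_prod_map_map hb.aemeasurable hc.aemeasurable).1 h2] at h1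
  have h3 := (measurePreserving_prodAssoc (P.map a) (P.map b) (P.map c)).symm
    MeasurableEquiv.prodAssoc |>.map_eq
  rw [← h3, ← h1, Measure.map_map MeasurableEquiv.prodAssoc.symm.measurable
    (ha.prodMk (hb.prodMk hc))]
  rfl

/-- The innovation at time `n` is independent of the past. -/
theorem indepFun_history {x₀ : Ω → X} {z : ℕ → Ω → Z} (hx₀ : Measurable x₀)
    (hz : ∀ n, Measurable (z n)) (hind : iIndepFun z P)
    (hind₀ : IndepFun x₀ (fun ω n => z n ω) P) (n : ℕ) :
    IndepFun (history x₀ z n) (z n) P := by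
  have hm : Measurable fun ω => (fun k : Finset.range n => z k ω) :=
    measurable_pi_lambda _ fun k => hz k
  refine indepFun_prodMk_of_indepFun hx₀ hm (hz n) ?_ ?_
  · have hφ : Measurable fun s : ℕ → Z => ((fun k : Finset.range n => s k), s n) :=
      (measurable_pi_lambda _ fun k => measurable_pi_apply _).prodMk (measurable_pi_apply _)
    exact hind₀.comp measurable_id hφ
  · have h := hind.indepFun_finset (Finset.range n) {n} (by simp) hz
    exact h.comp measurable_id
      (measurable_pi_apply (⟨n, Finset.mem_singleton_self n⟩ : ({n} : Finset ℕ)))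

theorem indepFun_of_measurable_history {x₀ : Ω → X} {z : ℕ → Ω → Z} (hx₀ : Measurable x₀)
    (hz : ∀ n, Measurable (z n)) (hind : iIndepFun z P)
    (hind₀ : IndepFun x₀ (fun ω n => z n ω) P) {n : ℕ} {Y : Type*} [MeasurableSpace Y]
    {g : Ω → Y} (hg : Measurable[historyFiltration hx₀ hz n] g) : IndepFun g (z n) P :=
  (IndepFun_iff_Indep _ _ _).2 (indep_of_indep_of_le_left
    ((IndepFun_iff_Indep _ _ _).1 (indepFun_history hx₀ hz hind hind₀ n)) hg.comap_le)

/-- Integrating out the second of two independent variables. -/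
theorem integral_eq_integral_integral_of_indepFun {Y : Type*} [MeasurableSpace Y] {g : Ω → Y}
    {ζ : Ω → Z} {ν : Measure Z} (hg : Measurable g) (hζ : Measurable ζ) (hν : P.map ζ = ν)
    (hind : IndepFun g ζ P) {G : Y → Z → ℝ} (hG : Measurable (Function.uncurry G))
    (hint : Integrable (fun ω => G (g ω) (ζ ω)) P) :
    Integrable (fun ω => ∫ s, G (g ω) s ∂ν) P ∧
      ∫ ω, G (g ω) (ζ ω) ∂P = ∫ ω, ∫ s, G (g ω) s ∂ν ∂P := by
  subst hν
  have := Measure.isProbabilityMeasure_map (μ := P) hg.aemeasurable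
  have := Measure.isProbabilityMeasure_map (μ := P) hζ.aemeasurable
  have hmap := (indepFun_iff_map_prod_eq_prod_map_map hg.aemeasurable hζ.aemeasurable).1 hind
  have hint' : Integrable (Function.uncurry G) ((P.map g).prod (P.map ζ)) := by
    rw [← hmap, integrable_map_measure hG.aestronglyMeasurable (hg.prodMk hζ).aemeasurable]
    exact hint
  have h1 : Integrable (fun y => ∫ s, G y s ∂P.map ζ) (P.map g) := hint'.integral_prod_left
  refine ⟨h1.comp_measurable hg, ?_⟩
  calc ∫ ω, G (g ω) (ζ ω) ∂P
      = ∫ p, Function.uncurry G p ∂P.map (fun ω => (g ω, ζ ω)) :=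
        (integral_map (hg.prodMk hζ).aemeasurable hG.aestronglyMeasurable).symm
    _ = ∫ y, ∫ s, G y s ∂P.map ζ ∂P.map g := by rw [hmap, integral_prod _ hint']; rfl
    _ = _ := integral_map hg.aemeasurable h1.aestronglyMeasurable

end History

section Martingale

variable {Ω X Z : Type*} [MeasurableSpace Ω] [MeasurableSpace X] [MeasurableSpace Z]
  {P : Measure Ω} [IsProbabilityMeasure P]

/-- Weighted sums of centred, square-integrably dominated innovations along an adapted state
process converge almost surely when the squared weights are summable. -/
theorem ae_exists_tendsto_sum_innovations {x : ℕ → Ω → X} {z : ℕ → Ω → Z}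
    (hx₀ : Measurable (x 0)) (hz : ∀ n, Measurable (z n)) (hind : iIndepFun z P)
    (hind₀ : IndepFun (x 0) (fun ω n => z n ω) P) {ν : Measure Z} (hν : ∀ n, P.map (z n) = ν)
    (hx : ∀ n, Measurable[historyFiltration hx₀ hz n] (x n))
    {g : X → Z → ℝ} (hg : Measurable (Function.uncurry g)) (hg0 : ∀ a, ∫ s, g a s ∂ν = 0)
    {b : Z → ℝ} (hb : MemLp b 2 ν) (hgb : ∀ a s, |g a s| ≤ b s)
    {γ : ℕ → ℝ} (hγ : Summable fun n => γ n ^ 2) :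
    ∀ᵐ ω ∂P, ∃ c, Tendsto
      (fun n => ∑ k ∈ Finset.range n, γ k * g (x k ω) (z k ω)) atTop (𝓝 c) := by
  set ℱ := historyFiltration hx₀ hz
  have hxm : ∀ n, Measurable (x n) := fun n => (hx n).mono (ℱ.le n) le_rfl
  have hbz : ∀ n, MemLp (fun ω => b (z n ω)) 2 P := by
    intro n
    have h := hb
    rw [← hν n] at h
    exact h.comp_of_map (hz n).aemeasurable
  have hbz2 : ∀ n, ∫ ω, b (z n ω) ^ 2 ∂P = ∫ s, b s ^ 2 ∂ν := by
    intro n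
    rw [← hν n, integral_map (hz n).aemeasurable]
    rw [hν n]
    exact hb.1.pow 2
  have hgm : ∀ n, Measurable fun ω => g (x n ω) (z n ω) := fun n =>
    hg.comp ((hxm n).prodMk (hz n))
  have hgL2 : ∀ n, MemLp (fun ω => γ n * g (x n ω) (z n ω)) 2 P := fun n =>
    ((hbz n).mono' (hgm n).aestronglyMeasurable
      (Eventually.of_forall fun ω => hgb _ _)).const_mul (γ n)
  set S : ℕ → Ω → ℝ := fun n ω => ∑ k ∈ Finset.range n, γ k * g (x k ω) (z k ω) with hS
  have hSsucc : ∀ n ω, S (n + 1) ω = S n ω + γ n * g (x n ω) (z n ω) := fun n ω =>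
    Finset.sum_range_succ _ _
  have hSL2 : ∀ n, MemLp (S n) 2 P := fun n => memLp_finsetSum _ fun k _ => hgL2 k
  have hSad : ∀ n, Measurable[ℱ n] (S n) := by
    intro n
    refine Finset.measurable_fun_sum _ fun k hk => ?_
    have hkn : k + 1 ≤ n := Finset.mem_range.1 hk
    have h1 : Measurable[ℱ n] (x k) := (hx k).mono (ℱ.mono (by omega)) le_rfl
    have h2 : Measurable[ℱ n] (z k) :=
      (measurable_innovation_history hx₀ hz k).mono (ℱ.mono hkn) le_rfl
    exact (hg.comp (h1.prodMk h2)).const_mul _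
  -- the increment is orthogonal to every square-integrable function of the past
  have horth : ∀ n (a : Ω → ℝ), Measurable[ℱ n] a → MemLp a 2 P →
      ∫ ω, a ω * (γ n * g (x n ω) (z n ω)) ∂P = 0 := by
    intro n a ha haL
    have hm : Measurable[ℱ n] fun ω => (a ω, x n ω) := ha.prodMk (hx n)
    have h := (integral_eq_integral_integral_of_indepFun (hm.mono (ℱ.le n) le_rfl) (hz n) (hν n)
      (indepFun_of_measurable_history hx₀ hz hind hind₀ hm)
      (G := fun p s => p.1 * (γ n * g p.2 s)) (by
        have : Measurable fun q : (ℝ × X) × Z => g q.1.2 q.2 :=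
          hg.comp ((measurable_snd.comp measurable_fst).prodMk measurable_snd)
        exact (measurable_fst.comp measurable_fst).mul (this.const_mul _))
      (haL.integrable_mul (hgL2 n))).2
    rw [h]
    simp [integral_const_mul, hg0]
  have hmart : Martingale S ℱ P := by
    refine martingale_of_setIntegral_eq_succ (fun n => (hSad n).stronglyMeasurable)
      (fun n => (hSL2 n).integrable one_le_two) fun n s hs => ?_
    have hs' := ℱ.le n s hs
    have h0 := horth n (s.indicator fun _ => 1) (measurable_const.indicator hs)
      (memLp_indicator_const 2 hs' 1 (Or.inr (measure_ne_top _ _)))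
    have h1 : ∫ ω in s, γ n * g (x n ω) (z n ω) ∂P = 0 := by
      rw [← integral_indicator hs', ← h0]
      refine integral_congr_ae (Eventually.of_forall fun ω => ?_)
      by_cases hω : ω ∈ s <;> simp [hω]
    simp_rw [hSsucc]
    rw [integral_add ((hSL2 n).integrable one_le_two).integrableOn
      ((hgL2 n).integrable one_le_two).integrableOn, h1, add_zero]
  have hsq : ∀ n, ∫ ω, S n ω ^ 2 ∂P ≤ (∑ k ∈ Finset.range n, γ k ^ 2) * ∫ s, b s ^ 2 ∂ν := by
    intro n
    induction n with
    | zero => simp [hS]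
    | succ n ih =>
      have h0 := horth n (S n) (hSad n) (hSL2 n)
      have hi1 := (hSL2 n).integrable_sq
      have hi2 : Integrable (fun ω => 2 * (S n ω * (γ n * g (x n ω) (z n ω)))) P :=
        ((hSL2 n).integrable_mul (hgL2 n)).const_mul 2
      have hi3 := (hgL2 n).integrable_sq
      have h1 : ∫ ω, (γ n * g (x n ω) (z n ω)) ^ 2 ∂P ≤ γ n ^ 2 * ∫ s, b s ^ 2 ∂ν := by
        rw [← hbz2 n, ← integral_const_mul]
        refine integral_mono hi3 ((hbz n).integrable_sq.const_mul _) fun ω => ?_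
        rw [mul_pow]
        refine mul_le_mul_of_nonneg_left ?_ (sq_nonneg _)
        rw [← sq_abs]
        exact pow_le_pow_left₀ (abs_nonneg _) (hgb _ _) 2
      have h2 : ∫ ω, S (n + 1) ω ^ 2 ∂P = ∫ ω, S n ω ^ 2 ∂P
          + ∫ ω, 2 * (S n ω * (γ n * g (x n ω) (z n ω))) ∂P
          + ∫ ω, (γ n * g (x n ω) (z n ω)) ^ 2 ∂P := by
        have hi12 : Integrable (fun ω => S n ω ^ 2 + 2 * (S n ω * (γ n * g (x n ω) (z n ω)))) P :=
          hi1.add hi2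
        rw [← integral_add hi1 hi2, ← integral_add hi12 hi3]
        refine integral_congr_ae (Eventually.of_forall fun ω => ?_)
        simp only [hSsucc]
        ring
      rw [h2, integral_const_mul, h0, Finset.sum_range_succ, add_mul]
      linarith
  set B : ℝ := 1 + (∑' k, γ k ^ 2) * ∫ s, b s ^ 2 ∂ν with hB
  refine hmart.submartingale.exists_ae_tendsto_of_bdd (R := B.toNNReal) fun n => ?_
  have hSi := (hSL2 n).integrable one_le_two
  rw [eLpNorm_one_eq_lintegral_enorm, ← ofReal_integral_norm_eq_lintegral_enorm hSi]
  refine ENNReal.ofReal_le_ofReal ?_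
  have h1 : ∫ ω, ‖S n ω‖ ∂P ≤ ∫ ω, (1 + S n ω ^ 2) ∂P := by
    refine integral_mono hSi.norm ((integrable_const _).add (hSL2 n).integrable_sq) fun ω => ?_
    simp only [Real.norm_eq_abs]
    rw [← sq_abs]
    nlinarith [sq_nonneg (|S n ω| - 1)]
  rw [integral_add (integrable_const _) (hSL2 n).integrable_sq] at h1
  refine h1.trans ?_
  have h2 : (∑ k ∈ Finset.range n, γ k ^ 2) * ∫ s, b s ^ 2 ∂ν
      ≤ (∑' k, γ k ^ 2) * ∫ s, b s ^ 2 ∂ν :=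
    mul_le_mul_of_nonneg_right (hγ.sum_le_tsum _ fun _ _ => sq_nonneg _)
      (integral_nonneg fun _ => sq_nonneg _)
  have h3 := hsq n
  simp only [integral_const, probReal_univ, smul_eq_mul, mul_one]
  rw [hB]
  linarith

end Martingale

/-! ### Expected logarithmic growth in one step -/

/-- Expansion of `U²` to `W²` by the factor `1 + 2 t` raises the logarithm by `t` times the weight
`W² / (1 + W²)`, which is small near the origin. -/
theorem log_one_add_sq_gain {U W t : ℝ} (ht : 0 ≤ t) (ht1 : 2 * t ≤ 1)
    (h : (1 + 2 * t) * U ^ 2 ≤ W ^ 2) :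
    Real.log (1 + U ^ 2) + t * (W ^ 2 / (1 + W ^ 2)) ≤ Real.log (1 + W ^ 2) := by
  have hU : 0 < 1 + U ^ 2 := by positivity
  have hW : 0 < 1 + W ^ 2 := by positivity
  have h1 := Real.one_sub_inv_le_log_of_pos (div_pos hW hU)
  rw [Real.log_div hW.ne' hU.ne', inv_div] at h1
  have h2 : t * (W ^ 2 / (1 + W ^ 2)) ≤ 1 - (1 + U ^ 2) / (1 + W ^ 2) := by
    rw [mul_div_assoc', one_sub_div hW.ne']
    refine div_le_div_of_nonneg_right ?_ hW.le
    have h3 : U ^ 2 * (1 + 2 * t) ≤ (W ^ 2 * (1 - t)) * (1 + 2 * t) := by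
      nlinarith [mul_nonneg (mul_nonneg ht (sq_nonneg W)) (sub_nonneg.2 ht1)]
    have h4 := le_of_mul_le_mul_right h3 (by linarith)
    linarith
  linarith

/-- One step of the instability argument. With the noise at scale `τ` and an expansion factor
`1 + 2 t` for the squared mean, where `t` dominates the concavity loss `3 τ² E[ζ²]` of the
logarithm, the expected value of `log (1 + ·²)` increases by at least `τ² s / 2`. -/
theorem integral_log_one_add_sq_ge {Z : Type*} [MeasurableSpace Z] {ν : Measure Z}
    [IsProbabilityMeasure ν] {ζ b : Z → ℝ} (hζ : AEStronglyMeasurable ζ ν) (hb : MemLp b 3 ν)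
    (hζb : ∀ a, |ζ a| ≤ b a) (hζ0 : ∫ a, ζ a ∂ν = 0) {s B₂ B₃ : ℝ}
    (hs : s ≤ ∫ a, ζ a ^ 2 ∂ν) (hB₂ : ∫ a, ζ a ^ 2 ∂ν ≤ B₂) (hB₃ : ∫ a, b a ^ 3 ∂ν ≤ B₃)
    {U W t τ : ℝ} (ht1 : 2 * t ≤ 1) (hτ : 0 ≤ τ) (htτ : 3 * τ ^ 2 * B₂ ≤ t)
    (hτB : 4 * τ * B₃ ≤ s) (h : (1 + 2 * t) * U ^ 2 ≤ W ^ 2)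
    (hint : Integrable (fun a => Real.log (1 + (W + τ * ζ a) ^ 2)) ν) :
    Real.log (1 + U ^ 2) + τ ^ 2 * s / 2 ≤ ∫ a, Real.log (1 + (W + τ * ζ a) ^ 2) ∂ν := by
  have hζ3 : MemLp ζ 3 ν := hb.mono' hζ (Eventually.of_forall hζb)
  have hζi : Integrable ζ ν := hζ3.integrable (by norm_num)
  have hζ2 : Integrable (fun a => ζ a ^ 2) ν := (hζ3.mono_exponent (by norm_num)).integrable_sq
  have hb3 : Integrable (fun a => b a ^ 3) ν := by
    have := hb.integrable_norm_pow (p := 3) (by norm_num)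
    refine this.congr (Eventually.of_forall fun a => ?_)
    simp only [Real.norm_of_nonneg ((abs_nonneg _).trans (hζb a))]
  have h20 : 0 ≤ ∫ a, ζ a ^ 2 ∂ν := integral_nonneg fun _ => sq_nonneg _
  have ht : 0 ≤ t := le_trans (by have := h20.trans hB₂; positivity) htτ
  set p := W ^ 2 / (1 + W ^ 2) with hp
  have hW : 0 < 1 + W ^ 2 := by positivity
  have hp0 : 0 ≤ p := by positivity
  set A := 2 * W / (1 + W ^ 2)
  set D := (1 - W ^ 2) / (1 + W ^ 2) ^ 2 with hD
  -- `D` differs from `1` by at most `3 p`, a loss that the gain `t p` of the expansion covers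
  have hDp : D = (1 - p) * (1 - 2 * p) := by
    rw [hD, hp]
    field_simp
    ring
  have hpt : ∀ a, Real.log (1 + W ^ 2) + (A * τ * ζ a + D * τ ^ 2 * ζ a ^ 2 - 2 * τ ^ 3 * b a ^ 3)
      ≤ Real.log (1 + (W + τ * ζ a) ^ 2) := by
    intro a
    have h1 := log_one_add_sq_add_ge W (τ * ζ a)
    have h2 : |τ * ζ a| ^ 3 ≤ τ ^ 3 * b a ^ 3 := by
      rw [abs_mul, abs_of_nonneg hτ, mul_pow]
      exact mul_le_mul_of_nonneg_left (pow_le_pow_left₀ (abs_nonneg _) (hζb a) 3) (by positivity)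
    calc _ = Real.log (1 + W ^ 2) + A * (τ * ζ a) + D * (τ * ζ a) ^ 2 - 2 * (τ ^ 3 * b a ^ 3) := by
          ring
      _ ≤ _ := by linarith
  have hi1 : Integrable (fun a => A * τ * ζ a) ν := hζi.const_mul _
  have hi2 : Integrable (fun a => D * τ ^ 2 * ζ a ^ 2) ν := hζ2.const_mul _
  have hi3 : Integrable (fun a => 2 * τ ^ 3 * b a ^ 3) ν := hb3.const_mul _
  have hi12 : Integrable (fun a => A * τ * ζ a + D * τ ^ 2 * ζ a ^ 2) ν := hi1.add hi2
  have hi123 : Integrable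
      (fun a => A * τ * ζ a + D * τ ^ 2 * ζ a ^ 2 - 2 * τ ^ 3 * b a ^ 3) ν := hi12.sub hi3
  have hmono := integral_mono ((integrable_const (Real.log (1 + W ^ 2))).add hi123) hint hpt
  simp only [Pi.add_apply] at hmono
  rw [integral_add (integrable_const _) hi123, integral_sub hi12 hi3, integral_add hi1 hi2,
    integral_const_mul, integral_const_mul, integral_const_mul, hζ0] at hmono
  simp only [integral_const, probReal_univ, smul_eq_mul, one_mul, mul_zero, zero_add] at hmono
  have hgain := log_one_add_sq_gain ht ht1 h
  set m := ∫ a, ζ a ^ 2 ∂ν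
  have hDm : τ ^ 2 * m ≤ t * p + D * τ ^ 2 * m := by
    rw [hDp]
    have h1 : 3 * τ ^ 2 * m * p ≤ t * p :=
      mul_le_mul_of_nonneg_right
        ((mul_le_mul_of_nonneg_left hB₂ (by positivity)).trans htτ) hp0
    nlinarith [mul_nonneg (mul_nonneg (sq_nonneg τ) h20) (sq_nonneg p)]
  have h3 : 2 * τ ^ 3 * ∫ a, b a ^ 3 ∂ν ≤ τ ^ 2 * s / 2 := by
    have : 2 * τ ^ 3 * ∫ a, b a ^ 3 ∂ν ≤ 2 * τ ^ 3 * B₃ :=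
      mul_le_mul_of_nonneg_left hB₃ (by positivity)
    nlinarith [mul_le_mul_of_nonneg_left hτB (sq_nonneg τ)]
  have h4 : τ ^ 2 * s ≤ τ ^ 2 * m := mul_le_mul_of_nonneg_left hs (sq_nonneg τ)
  change _ + τ ^ 2 * s / 2 ≤ _
  linarith

/-- A gain `p γ k` per step, with `p ≥ 0`, that never totals more than a multiple of `-log γ` has to
vanish when the sums of `γ` outgrow every multiple of `-log γ`. -/
theorem eq_zero_of_weighted_sum_le {γ : ℕ → ℝ} (hγlog : ∀ A : ℝ,
    Tendsto (fun m => ∑ k ∈ Finset.range m, γ k + A * Real.log (γ m)) atTop atTop)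
    {p A B : ℝ} {N : ℕ} (hp : 0 ≤ p)
    (h : ∀ m, N ≤ m → p * ∑ k ∈ Finset.Ico N m, γ k ≤ B - A * Real.log (γ m)) : p = 0 := by
  by_contra hne
  have hp' : 0 < p := lt_of_le_of_ne hp (Ne.symm hne)
  obtain ⟨m, hm, hNm⟩ := (((hγlog (A / p)).eventually_gt_atTop
    (B / p + ∑ k ∈ Finset.range N, γ k)).and (eventually_ge_atTop N)).exists
  have h1 := h m hNm
  rw [Finset.sum_Ico_eq_sub _ hNm] at h1
  have h2 := mul_lt_mul_of_pos_left hm hp'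
  have h3 : p * (B / p + ∑ k ∈ Finset.range N, γ k) = B + p * ∑ k ∈ Finset.range N, γ k := by
    field_simp
  have h4 : p * (∑ k ∈ Finset.range m, γ k + A / p * Real.log (γ m))
      = p * ∑ k ∈ Finset.range m, γ k + A * Real.log (γ m) := by
    field_simp
  rw [h3, h4] at h2
  linarith

/-! ### The logarithmic potential along the recursion -/

section Potential

theorem log_one_add_sq_div_nonneg {β : ℝ} (hβ : 0 < β) (v : ℝ) :
    0 ≤ Real.log (1 + v ^ 2 / β) :=
  Real.log_nonneg (le_add_of_nonneg_right (by positivity))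

theorem log_one_add_sq_div_le_sub {β v : ℝ} (hβ : 0 < β) :
    Real.log (1 + v ^ 2 / β) ≤ β + v ^ 2 - Real.log β := by
  have h1 : 1 + v ^ 2 / β = (β + v ^ 2) / β := by field_simp
  rw [h1, Real.log_div (by positivity) hβ.ne']
  have := Real.log_le_sub_one_of_pos (show 0 < β + v ^ 2 by positivity)
  linarith

theorem log_one_add_sq_div_le {β v : ℝ} (hβ : 0 < β) : Real.log (1 + v ^ 2 / β) ≤ v ^ 2 / β := by
  have := Real.log_le_sub_one_of_pos (show 0 < 1 + v ^ 2 / β by positivity)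
  linarith

theorem log_one_add_sq_div_anti {β β' : ℝ} (hβ' : 0 < β') (h : β' ≤ β) (v : ℝ) :
    Real.log (1 + v ^ 2 / β) ≤ Real.log (1 + v ^ 2 / β') := by
  have hβ := hβ'.trans_le h
  exact Real.log_le_log (by positivity) (by gcongr)

theorem measurable_log_one_add_sq_div {Y : Type*} [MeasurableSpace Y] {g : Y → ℝ} (β : ℝ)
    (hg : Measurable g) : Measurable fun a => Real.log (1 + g a ^ 2 / β) :=
  Real.measurable_log.comp (((hg.pow_const 2).div_const β).const_add 1)

/-- The one-step gain of the potential `log (1 + u² / (K γ))` for a step of size `γ`: in the units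
`√(K γ)` the noise has scale `τ = √(γ / K)`, so `τ²` is proportional to `γ`. -/
theorem integral_log_potential_ge {Z : Type*} [MeasurableSpace Z] {ν : Measure Z}
    [IsProbabilityMeasure ν] {ζ b : Z → ℝ} (hζ : AEStronglyMeasurable ζ ν) (hb : MemLp b 3 ν)
    (hζb : ∀ a, |ζ a| ≤ b a) (hζ0 : ∫ a, ζ a ∂ν = 0) {s : ℝ}
    (hs : s ≤ ∫ a, ζ a ^ 2 ∂ν) {u w γ c K : ℝ} (hγ : 0 < γ) (hc : 0 < c) (hK : 0 < K)
    (hcK : 3 * ∫ a, b a ^ 2 ∂ν ≤ c * K) (hcγ : 2 * (c * γ) ≤ 1)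
    (hγs : 4 * √(γ / K) * ∫ a, b a ^ 3 ∂ν ≤ s) (h : (1 + 2 * (c * γ)) * u ^ 2 ≤ w ^ 2) :
    Real.log (1 + u ^ 2 / (K * γ)) + γ * (s / (2 * K))
      ≤ ∫ a, Real.log (1 + (w + γ * ζ a) ^ 2 / (K * γ)) ∂ν := by
  have hβ : 0 < K * γ := mul_pos hK hγ
  have hsq : ∀ v : ℝ, v ^ 2 / (K * γ) = (v / √(K * γ)) ^ 2 := fun v => by
    rw [div_pow, Real.sq_sqrt hβ.le]
  have hτ2 : √(γ / K) ^ 2 = γ / K := Real.sq_sqrt (by positivity)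
  have hτ : γ / √(K * γ) = √(γ / K) := by
    rw [← Real.sqrt_sq (by positivity : 0 ≤ γ / √(K * γ)), ← hsq]
    congr 1
    field_simp
  have hsplit : ∀ a, (w + γ * ζ a) / √(K * γ) = w / √(K * γ) + √(γ / K) * ζ a := fun a => by
    rw [← hτ]; ring
  have hb2 : MemLp b 2 ν := hb.mono_exponent (by norm_num)
  have hζ2 : MemLp ζ 2 ν := hb2.mono' hζ (Eventually.of_forall hζb)
  have hB₂ : ∫ a, ζ a ^ 2 ∂ν ≤ ∫ a, b a ^ 2 ∂ν := by
    refine integral_mono hζ2.integrable_sq hb2.integrable_sq fun a => ?_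
    simp only
    rw [← sq_abs]
    exact pow_le_pow_left₀ (abs_nonneg _) (hζb a) 2
  have hint : Integrable (fun a => Real.log (1 + (w / √(K * γ) + √(γ / K) * ζ a) ^ 2)) ν := by
    have hm : MemLp (fun a => w / √(K * γ) + √(γ / K) * ζ a) 2 ν :=
      MemLp.add (memLp_const (w / √(K * γ))) (MemLp.const_mul hζ2 (√(γ / K)))
    refine hm.integrable_sq.mono' ?_ (Eventually.of_forall fun a => ?_)
    · have h0 : Measurable fun v : ℝ => Real.log (1 + v ^ 2) := by
        simpa using measurable_log_one_add_sq_div 1 measurable_id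
      exact (h0.comp_aemeasurable hm.1.aemeasurable).aestronglyMeasurable
    · have h1 := log_one_add_sq_div_nonneg one_pos (w / √(K * γ) + √(γ / K) * ζ a)
      have h2 := log_one_add_sq_div_le (v := w / √(K * γ) + √(γ / K) * ζ a) one_pos
      rw [div_one] at h1 h2
      rw [Real.norm_of_nonneg h1]
      exact h2
  have key := integral_log_one_add_sq_ge hζ hb hζb hζ0 hs hB₂ le_rfl (U := u / √(K * γ))
    (W := w / √(K * γ)) (t := c * γ) (τ := √(γ / K)) hcγ (Real.sqrt_nonneg _) (by
      rw [hτ2]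
      calc 3 * (γ / K) * ∫ a, b a ^ 2 ∂ν = (3 * ∫ a, b a ^ 2 ∂ν) * (γ / K) := by ring
        _ ≤ c * K * (γ / K) := mul_le_mul_of_nonneg_right hcK (by positivity)
        _ = c * γ := by field_simp) hγs (by
      rw [← hsq, ← hsq, mul_div_assoc']
      gcongr) hint
  rw [hτ2, ← hsq] at key
  simp_rw [← hsplit, ← hsq] at key
  refine le_trans (le_of_eq ?_) key
  congr 1
  field_simp

end Potential

section Escape

variable {Ω X Z : Type*} [MeasurableSpace Ω] [MeasurableSpace X] [MeasurableSpace Z]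
  {P : Measure Ω} [IsProbabilityMeasure P] {x : ℕ → Ω → X} {z : ℕ → Ω → Z} {ν : Measure Z}
  {u : X → ℝ} {ζ : X → Z → ℝ} {b : Z → ℝ}

/-- Balance of the potential over one step on an event `B` of the past on which the state lies in
the unstable region, when only the part `B'` of `B` is retained: what the discarded part carries is
at most `H` times its probability, up to a summable error. -/
theorem setIntegral_potential_step (hx₀ : Measurable (x 0)) (hz : ∀ n, Measurable (z n))
    (hind : iIndepFun z P) (hind₀ : IndepFun (x 0) (fun ω n => z n ω) P)
    (hν : ∀ n, P.map (z n) = ν)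
    (hx : ∀ n, Measurable[historyFiltration hx₀ hz n] (x n))
    (hu : Measurable u) (hζ : Measurable (Function.uncurry ζ)) (hb : MemLp b 3 ν)
    (hζb : ∀ a y, |ζ a y| ≤ b y) (hζ0 : ∀ a, ∫ y, ζ a y ∂ν = 0) {s : ℝ}
    (hs : ∀ a, s ≤ ∫ y, ζ a y ^ 2 ∂ν) {n : ℕ} {w : X → ℝ} (hw : Measurable w)
    {D : Set X} {R γ c K : ℝ} (hγ : 0 < γ) (hc : 0 < c) (hK : 0 < K)
    (hstep : ∀ ω, x n ω ∈ D → u (x (n + 1) ω) = w (x n ω) + γ * ζ (x n ω) (z n ω))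
    (huR : ∀ a ∈ D, u a ^ 2 ≤ R) (hwR : ∀ a ∈ D, w a ^ 2 ≤ R)
    (hexp : ∀ a ∈ D, (1 + 2 * (c * γ)) * u a ^ 2 ≤ w a ^ 2)
    (hcK : 3 * ∫ a, b a ^ 2 ∂ν ≤ c * K) (hcγ : 2 * (c * γ) ≤ 1)
    (hγs : 4 * √(γ / K) * ∫ a, b a ^ 3 ∂ν ≤ s)
    {γ' H : ℝ} (hγ' : 0 < γ') (hγγ' : γ' ≤ γ) (hH : K * γ + 2 * R - Real.log (K * γ') ≤ H)
    {B B' : Set Ω} (hB : MeasurableSet[historyFiltration hx₀ hz n] B) (hB' : MeasurableSet B')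
    (hBB : B' ⊆ B) (hBD : ∀ ω ∈ B, x n ω ∈ D) :
    ∫ ω in B, Real.log (1 + u (x n ω) ^ 2 / (K * γ)) ∂P + γ * (s / (2 * K)) * P.real B
      ≤ ∫ ω in B', Real.log (1 + u (x (n + 1) ω) ^ 2 / (K * γ')) ∂P
        + H * (P.real B - P.real B') + 2 * γ ^ 2 * ∫ y, b y ^ 2 ∂ν := by
  set ℱ := historyFiltration hx₀ hz
  have hxm : ∀ n, Measurable (x n) := fun n => (hx n).mono (ℱ.le n) le_rfl
  have hBm : MeasurableSet B := ℱ.le n B hB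
  have hνp : IsProbabilityMeasure ν := by
    rw [← hν n]; exact Measure.isProbabilityMeasure_map (hz n).aemeasurable
  have hβ : 0 < K * γ := mul_pos hK hγ
  have hβ' : 0 < K * γ' := mul_pos hK hγ'
  have hββ : K * γ' ≤ K * γ := mul_le_mul_of_nonneg_left hγγ' hK.le
  have hb2 : MemLp b 2 ν := hb.mono_exponent (by norm_num)
  have hbz : MemLp (fun ω => b (z n ω)) 2 P := by
    rw [← hν n] at hb2
    exact hb2.comp_of_map (hz n).aemeasurable
  have hbz2 : ∫ ω, b (z n ω) ^ 2 ∂P = ∫ y, b y ^ 2 ∂ν := by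
    rw [← hν n, integral_map (hz n).aemeasurable]
    rw [hν n]
    exact hb.1.pow 2
  have hbi : Integrable (fun ω => 2 * γ ^ 2 * b (z n ω) ^ 2) P := hbz.integrable_sq.const_mul _
  -- the potential after the step is dominated on `B`
  have hdom : ∀ ω ∈ B, Real.log (1 + u (x (n + 1) ω) ^ 2 / (K * γ'))
      ≤ H + 2 * γ ^ 2 * b (z n ω) ^ 2 := by
    intro ω hω
    have h1 := log_one_add_sq_div_le_sub (v := u (x (n + 1) ω)) hβ'
    have h2 : u (x (n + 1) ω) ^ 2 ≤ 2 * R + 2 * γ ^ 2 * b (z n ω) ^ 2 := by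
      rw [hstep ω (hBD ω hω)]
      have h3 := hwR _ (hBD ω hω)
      have h4 : ζ (x n ω) (z n ω) ^ 2 ≤ b (z n ω) ^ 2 := by
        rw [← sq_abs]
        exact pow_le_pow_left₀ (abs_nonneg _) (hζb _ _) 2
      nlinarith [sq_nonneg (w (x n ω) - γ * ζ (x n ω) (z n ω)),
        mul_le_mul_of_nonneg_left h4 (sq_nonneg γ)]
    linarith
  have hV'i : IntegrableOn (fun ω => Real.log (1 + u (x (n + 1) ω) ^ 2 / (K * γ'))) B P := by
    refine Integrable.mono' (((integrable_const H).add hbi).integrableOn (s := B))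
      (measurable_log_one_add_sq_div _ (hu.comp (hxm (n + 1)))).aestronglyMeasurable ?_
    filter_upwards [ae_restrict_mem hBm] with ω hω
    rw [Real.norm_of_nonneg (log_one_add_sq_div_nonneg hβ' _)]
    exact hdom ω hω
  have hV'i2 : IntegrableOn (fun ω => Real.log (1 + u (x (n + 1) ω) ^ 2 / (K * γ))) B P := by
    refine Integrable.mono' hV'i
      (measurable_log_one_add_sq_div _ (hu.comp (hxm (n + 1)))).aestronglyMeasurable ?_
    refine Eventually.of_forall fun ω => ?_
    rw [Real.norm_of_nonneg (log_one_add_sq_div_nonneg hβ _)]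
    exact log_one_add_sq_div_anti hβ' hββ _
  have hVi : IntegrableOn (fun ω => Real.log (1 + u (x n ω) ^ 2 / (K * γ))) B P := by
    refine Integrable.mono' (integrable_const (R / (K * γ)))
      (measurable_log_one_add_sq_div _ (hu.comp (hxm n))).aestronglyMeasurable ?_
    filter_upwards [ae_restrict_mem hBm] with ω hω
    rw [Real.norm_of_nonneg (log_one_add_sq_div_nonneg hβ _)]
    refine (log_one_add_sq_div_le hβ).trans ?_
    exact div_le_div_of_nonneg_right (huR _ (hBD ω hω)) hβ.le
  -- upper estimate: discard `B \ B'`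
  have hupper : ∫ ω in B, Real.log (1 + u (x (n + 1) ω) ^ 2 / (K * γ')) ∂P
      ≤ ∫ ω in B', Real.log (1 + u (x (n + 1) ω) ^ 2 / (K * γ')) ∂P
        + H * (P.real B - P.real B') + 2 * γ ^ 2 * ∫ y, b y ^ 2 ∂ν := by
    have h1 := setIntegral_union (μ := P)
      (f := fun ω => Real.log (1 + u (x (n + 1) ω) ^ 2 / (K * γ')))
      (Set.disjoint_sdiff_right (s := B') (t := B)) (hBm.diff hB') (hV'i.mono_set hBB)
      (hV'i.mono_set Set.sdiff_subset)
    rw [Set.union_sdiff_cancel hBB] at h1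
    have h2 : ∫ ω in B \ B', Real.log (1 + u (x (n + 1) ω) ^ 2 / (K * γ')) ∂P
        ≤ ∫ ω in B \ B', (H + 2 * γ ^ 2 * b (z n ω) ^ 2) ∂P :=
      setIntegral_mono_on (hV'i.mono_set Set.sdiff_subset)
        ((integrable_const H).add hbi).integrableOn (hBm.diff hB') fun ω hω => hdom ω hω.1
    have h3 : ∫ ω in B \ B', (H + 2 * γ ^ 2 * b (z n ω) ^ 2) ∂P
        = H * (P.real B - P.real B') + ∫ ω in B \ B', 2 * γ ^ 2 * b (z n ω) ^ 2 ∂P := by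
      rw [integral_add (integrable_const _) hbi.integrableOn, setIntegral_const,
        measureReal_sdiff hBB hB', smul_eq_mul, mul_comm H]
    have h4 : ∫ ω in B \ B', 2 * γ ^ 2 * b (z n ω) ^ 2 ∂P ≤ 2 * γ ^ 2 * ∫ y, b y ^ 2 ∂ν := by
      rw [← hbz2, ← integral_const_mul]
      exact setIntegral_le_integral hbi (Eventually.of_forall fun ω => by positivity)
    linarith
  -- lower estimate: integrate out the innovation
  have hlower : ∫ ω in B, Real.log (1 + u (x n ω) ^ 2 / (K * γ)) ∂P
      + γ * (s / (2 * K)) * P.real B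
      ≤ ∫ ω in B, Real.log (1 + u (x (n + 1) ω) ^ 2 / (K * γ)) ∂P := by
    set i : Ω → ℝ := B.indicator fun _ => 1 with hi
    have him : Measurable[ℱ n] i := measurable_const.indicator hB
    have hm : Measurable[ℱ n] fun ω => (i ω, x n ω) := him.prodMk (hx n)
    set G : ℝ × X → Z → ℝ := fun p y =>
      p.1 * Real.log (1 + (w p.2 + γ * ζ p.2 y) ^ 2 / (K * γ)) with hG
    have hGm : Measurable (Function.uncurry G) := by
      have h1 : Measurable fun q : (ℝ × X) × Z => ζ q.1.2 q.2 :=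
        hζ.comp ((measurable_snd.comp measurable_fst).prodMk measurable_snd)
      have h2 : Measurable fun q : (ℝ × X) × Z => w q.1.2 + γ * ζ q.1.2 q.2 :=
        (hw.comp (measurable_snd.comp measurable_fst)).add (h1.const_mul _)
      exact (measurable_fst.comp measurable_fst).mul (measurable_log_one_add_sq_div _ h2)
    have hGeq : (fun ω => G (i ω, x n ω) (z n ω))
        = B.indicator fun ω => Real.log (1 + u (x (n + 1) ω) ^ 2 / (K * γ)) := by
      ext ω
      by_cases hω : ω ∈ B
      · simp [hG, hi, hω, hstep ω (hBD ω hω)]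
      · simp [hG, hi, hω]
    have hGi : Integrable (fun ω => G (i ω, x n ω) (z n ω)) P := by
      rw [hGeq]
      exact hV'i2.integrable_indicator hBm
    obtain ⟨hI, hE⟩ := integral_eq_integral_integral_of_indepFun (hm.mono (ℱ.le n) le_rfl) (hz n)
      (hν n) (indepFun_of_measurable_history hx₀ hz hind hind₀ hm) hGm hGi
    rw [hGeq, integral_indicator hBm] at hE
    rw [hE]
    have hc1 : ∫ ω in B, Real.log (1 + u (x n ω) ^ 2 / (K * γ)) ∂P
        + γ * (s / (2 * K)) * P.real B
        = ∫ ω, B.indicator (fun ω => Real.log (1 + u (x n ω) ^ 2 / (K * γ))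
          + γ * (s / (2 * K))) ω ∂P := by
      rw [integral_indicator hBm, integral_add hVi (integrable_const _), setIntegral_const,
        smul_eq_mul, mul_comm (P.real B)]
    rw [hc1]
    refine integral_mono ((hVi.add (integrable_const _)).integrable_indicator hBm) hI fun ω => ?_
    by_cases hω : ω ∈ B
    · simp only [hG, hi, Set.indicator_of_mem hω, one_mul]
      have hζa : Measurable (ζ (x n ω)) := hζ.comp (measurable_const.prodMk measurable_id)
      exact integral_log_potential_ge hζa.aestronglyMeasurable hb (hζb _) (hζ0 _) (hs _) hγ hc hK
        hcK hcγ hγs (hexp _ (hBD ω hω))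
    · simp [hG, hi, hω]
  have hmid : ∫ ω in B, Real.log (1 + u (x (n + 1) ω) ^ 2 / (K * γ)) ∂P
      ≤ ∫ ω in B, Real.log (1 + u (x (n + 1) ω) ^ 2 / (K * γ')) ∂P :=
    setIntegral_mono hV'i2 hV'i fun ω => log_one_add_sq_div_anti hβ' hββ _
  linarith

end Escape

/-! ### Escape from a region of expansion -/

section Escape

variable {Ω X Z : Type*} [MeasurableSpace Ω] [MeasurableSpace X] [MeasurableSpace Z]
  {P : Measure Ω} [IsProbabilityMeasure P] {x : ℕ → Ω → X} {z : ℕ → Ω → Z} {ν : Measure Z}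
  {u : X → ℝ} {ζ : X → Z → ℝ} {b : Z → ℝ}

/-- An adapted recursion almost surely does not remain in a region in which one of its coordinates
is expanded by the drift and excited by nondegenerate noise. -/
theorem measure_forall_mem_eq_zero (hx₀ : Measurable (x 0)) (hz : ∀ n, Measurable (z n))
    (hind : iIndepFun z P) (hind₀ : IndepFun (x 0) (fun ω n => z n ω) P)
    (hν : ∀ n, P.map (z n) = ν)
    (hx : ∀ n, Measurable[historyFiltration hx₀ hz n] (x n))
    (hu : Measurable u) (hζ : Measurable (Function.uncurry ζ)) (hb : MemLp b 3 ν)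
    (hζb : ∀ a y, |ζ a y| ≤ b y) (hζ0 : ∀ a, ∫ y, ζ a y ∂ν = 0) {s : ℝ} (hs0 : 0 < s)
    (hs : ∀ a, s ≤ ∫ y, ζ a y ^ 2 ∂ν) {w : ℕ → X → ℝ} (hw : ∀ n, Measurable (w n))
    {D : Set X} (hD : MeasurableSet D) {R c : ℝ} {γ : ℕ → ℝ} (hγ : ∀ n, 0 < γ n)
    (hγanti : Antitone γ) (hγ0 : Tendsto γ atTop (𝓝 0)) (hγ2 : Summable fun n => γ n ^ 2)
    (hγlog : ∀ A : ℝ,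
      Tendsto (fun m => ∑ k ∈ Finset.range m, γ k + A * Real.log (γ m)) atTop atTop)
    (hc : 0 < c)
    (hstep : ∀ n ω, x n ω ∈ D → u (x (n + 1) ω) = w n (x n ω) + γ n * ζ (x n ω) (z n ω))
    (huR : ∀ a ∈ D, u a ^ 2 ≤ R) (hwR : ∀ n, ∀ a ∈ D, w n a ^ 2 ≤ R)
    (hexp : ∀ n, ∀ a ∈ D, (1 + 2 * (c * γ n)) * u a ^ 2 ≤ w n a ^ 2) (N : ℕ) :
    P {ω | ∀ n, N ≤ n → x n ω ∈ D} = 0 := by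
  set ℱ := historyFiltration hx₀ hz
  have hxm : ∀ n, Measurable (x n) := fun n => (hx n).mono (ℱ.le n) le_rfl
  have hνp : IsProbabilityMeasure ν := by
    rw [← hν 0]; exact Measure.isProbabilityMeasure_map (hz 0).aemeasurable
  obtain ⟨ω₀⟩ : Nonempty Ω := nonempty_of_isProbabilityMeasure P
  set B₂ := ∫ y, b y ^ 2 ∂ν
  set B₃ := ∫ y, b y ^ 3 ∂ν
  have hB₂ : 0 < B₂ := by
    have hb2 : MemLp b 2 ν := hb.mono_exponent (by norm_num)
    have hm : Measurable (ζ (x 0 ω₀)) := hζ.comp (measurable_const.prodMk measurable_id)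
    have hζ2 : MemLp (ζ (x 0 ω₀)) 2 ν :=
      hb2.mono' hm.aestronglyMeasurable (Eventually.of_forall (hζb _))
    refine hs0.trans_le ((hs (x 0 ω₀)).trans
      (integral_mono hζ2.integrable_sq hb2.integrable_sq fun y => ?_))
    simp only
    rw [← sq_abs]
    exact pow_le_pow_left₀ (abs_nonneg _) (hζb _ y) 2
  -- the scale at which the expansion `c γ` outweighs the concavity loss caused by the noise
  set K := 3 * B₂ / c with hKdef
  have hK : 0 < K := by positivity
  have hcK : 3 * B₂ ≤ c * K := by rw [hKdef]; field_simp; rfl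
  have h1 : ∀ᶠ n in atTop, 2 * (c * γ n) ≤ 1 := by
    have : Tendsto (fun n => 2 * (c * γ n)) atTop (𝓝 0) := by
      simpa using (hγ0.const_mul c).const_mul 2
    exact this.eventually (ge_mem_nhds one_pos)
  have h2 : ∀ᶠ n in atTop, 4 * √(γ n / K) * B₃ ≤ s := by
    have : Tendsto (fun n => 4 * √(γ n / K) * B₃) atTop (𝓝 0) := by
      simpa using ((((Real.continuous_sqrt.tendsto _).comp
        (hγ0.div_const K))).const_mul 4).mul_const B₃
    exact this.eventually (ge_mem_nhds hs0)
  have h3 : ∀ᶠ n in atTop, γ n ≤ 1 := hγ0.eventually (ge_mem_nhds one_pos)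
  obtain ⟨N₁, hN₁⟩ := eventually_atTop.1 (h1.and (h2.and h3))
  -- only times beyond which the steps are small matter
  wlog hNN : N₁ ≤ N generalizing N
  · have hsub : {ω | ∀ n, N ≤ n → x n ω ∈ D} ⊆ {ω | ∀ n, N₁ ≤ n → x n ω ∈ D} :=
      fun ω hω n hn => hω n (by omega)
    exact measure_mono_null hsub (this N₁ le_rfl)
  set B : ℕ → Set Ω := fun n => {ω | ∀ k, N ≤ k → k ≤ n → x k ω ∈ D} with hBdef
  have hBm : ∀ n, MeasurableSet[ℱ n] (B n) := by
    intro n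
    simp only [hBdef, Set.ofPred_forall]
    exact MeasurableSet.iInter fun k => MeasurableSet.iInter fun _ => MeasurableSet.iInter
      fun hk => (hx k).mono (ℱ.mono hk) le_rfl hD
  have hBmono : ∀ n, B (n + 1) ⊆ B n := fun n ω hω k hk hkn => hω k hk (hkn.trans n.le_succ)
  set p := P.real {ω | ∀ n, N ≤ n → x n ω ∈ D} with hp
  have hpB : ∀ n, p ≤ P.real (B n) := fun n => measureReal_mono fun ω hω k hk _ => hω k hk
  set F : ℕ → ℝ := fun n => ∫ ω in B n, Real.log (1 + u (x n ω) ^ 2 / (K * γ n)) ∂P with hF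
  set κ := s / (2 * K)
  have hκ : 0 < κ := by positivity
  set C₀ := K * γ 0 + 2 * R - Real.log K with hC₀
  set S₂ := ∑' k, γ k ^ 2
  have hmain : ∀ m, N ≤ m → κ * p * ∑ k ∈ Finset.Ico N m, γ k
      ≤ (|C₀| + 2 * B₂ * S₂) - 1 * Real.log (γ m) := by
    intro m hm
    have hlogm : Real.log (γ m) ≤ 0 :=
      Real.log_nonpos (hγ m).le (hN₁ m (hNN.trans hm)).2.2
    -- `H` bounds the potential on `D` at all times up to `m`
    set H := C₀ - Real.log (γ m) with hH
    have hind : ∀ n, N ≤ n → n ≤ m →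
        F N - H * P.real (B N) + κ * p * ∑ k ∈ Finset.Ico N n, γ k
          ≤ F n - H * P.real (B n) + 2 * B₂ * ∑ k ∈ Finset.Ico N n, γ k ^ 2 := by
      intro n hn
      induction n, hn using Nat.le_induction with
      | base => simp
      | succ n hn ih =>
        intro hnm
        obtain ⟨e1, e2, -⟩ := hN₁ n (hNN.trans hn)
        have hHn : K * γ n + 2 * R - Real.log (K * γ (n + 1)) ≤ H := by
          have g1 := Real.log_le_log (hγ m) (hγanti hnm)
          have g2 := mul_le_mul_of_nonneg_left (hγanti (Nat.zero_le n)) hK.le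
          rw [Real.log_mul hK.ne' (hγ _).ne', hH, hC₀]
          linarith
        have hone := setIntegral_potential_step hx₀ hz hind hind₀ hν hx hu hζ hb hζb hζ0 hs (hw n)
          (hγ n) hc hK (hstep n) huR (hwR n) (hexp n) hcK e1 e2 (hγ (n + 1))
          (hγanti n.le_succ) hHn (hBm n) (ℱ.le _ _ (hBm (n + 1))) (hBmono n)
          (fun ω hω => hω n hn le_rfl)
        have g3 := mul_le_mul_of_nonneg_left (hpB n) (mul_nonneg (hγ n).le hκ.le)
        have g4 := ih (by omega)
        rw [Finset.sum_Ico_succ_top hn, Finset.sum_Ico_succ_top hn]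
        simp only [hF] at g4 ⊢
        nlinarith
    have g1 := hind m hm le_rfl
    have g2 : 0 ≤ F N := integral_nonneg fun ω =>
      log_one_add_sq_div_nonneg (mul_pos hK (hγ N)) _
    have g3 : F m ≤ H * P.real (B m) := by
      have hle : ∀ ω ∈ B m, ‖Real.log (1 + u (x m ω) ^ 2 / (K * γ m))‖ ≤ H := by
        intro ω hω
        rw [Real.norm_of_nonneg (log_one_add_sq_div_nonneg (mul_pos hK (hγ m)) _)]
        have q1 := log_one_add_sq_div_le_sub (v := u (x m ω)) (mul_pos hK (hγ m))
        have q2 := huR _ (hω m hm le_rfl)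
        have q3 := mul_le_mul_of_nonneg_left (hγanti (Nat.zero_le m)) hK.le
        rw [Real.log_mul hK.ne' (hγ _).ne'] at q1
        rw [hH, hC₀]
        linarith [(sq_nonneg _).trans q2]
      exact (le_abs_self _).trans
        (norm_setIntegral_le_of_norm_le_const (measure_lt_top _ _) hle)
    have g4 : ∑ k ∈ Finset.Ico N m, γ k ^ 2 ≤ S₂ :=
      hγ2.sum_le_tsum _ fun _ _ => sq_nonneg _
    have g5 : H * P.real (B N) ≤ |C₀| - Real.log (γ m) := by
      have q1 : H ≤ |C₀| - Real.log (γ m) := by rw [hH]; linarith [le_abs_self C₀]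
      have q2 : 0 ≤ |C₀| - Real.log (γ m) := by linarith [abs_nonneg C₀]
      have q3 : P.real (B N) ≤ 1 := measureReal_le_one
      have q4 : 0 ≤ P.real (B N) := measureReal_nonneg
      nlinarith
    have g6 := mul_le_mul_of_nonneg_left g4 (by positivity : 0 ≤ 2 * B₂)
    linarith
  have hzero := eq_zero_of_weighted_sum_le hγlog (mul_nonneg hκ.le measureReal_nonneg) hmain
  have hp0 : p = 0 := (mul_eq_zero.1 hzero).resolve_left hκ.ne'
  rwa [hp, measureReal_eq_zero_iff] at hp0

end Escape

/-! ### Step sizes -/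

section StepSize

variable {C α : ℝ}

theorem stepSize_succ_pos (hC : 0 < C) (n : ℕ) : 0 < stepSize C α (n + 1) :=
  mul_pos hC (Real.rpow_pos_of_pos (by positivity) _)

theorem antitone_stepSize_succ (hC : 0 < C) (hα : 0 < α) :
    Antitone fun n => stepSize C α (n + 1) := by
  intro m n hmn
  refine mul_le_mul_of_nonneg_left ?_ hC.le
  refine Real.rpow_le_rpow_of_nonpos (by positivity) ?_ (by linarith)
  exact_mod_cast Nat.succ_le_succ hmn

theorem tendsto_stepSize_succ (hα : 0 < α) :
    Tendsto (fun n => stepSize C α (n + 1)) atTop (𝓝 0) := by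
  have h1 := (tendsto_rpow_neg_atTop hα).comp
    ((tendsto_natCast_atTop_atTop (R := ℝ)).comp (tendsto_add_atTop_nat 1))
  simpa [stepSize] using h1.const_mul C

theorem summable_stepSize_succ_sq (hα : 1 / 2 < α) :
    Summable fun n => stepSize C α (n + 1) ^ 2 := by
  have h1 : Summable fun n : ℕ => (n : ℝ) ^ (-(2 * α)) :=
    Real.summable_nat_rpow.2 (by linarith)
  have h2 := ((summable_nat_add_iff 1).2 h1).mul_left (C ^ 2)
  refine h2.congr fun n => ?_
  rw [stepSize, mul_pow, ← Real.rpow_mul_natCast (by positivity)]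
  congr 2
  push_cast
  ring

/-- The accumulated step sizes grow like a power, hence beat every multiple of `log γ`. -/
theorem tendsto_sum_stepSize_add_log (hC : 0 < C) (hα0 : 0 < α) (hα : α < 1) (A : ℝ) :
    Tendsto (fun m => ∑ k ∈ Finset.range m, stepSize C α (k + 1)
      + A * Real.log (stepSize C α (m + 1))) atTop atTop := by
  -- the sum is at least `m` times its last term
  have hsum : ∀ m : ℕ, C * (m : ℝ) * ((m : ℝ) + 1) ^ (-α)
      ≤ ∑ k ∈ Finset.range m, stepSize C α (k + 1) := by
    intro m
    have h1 : ∀ k ∈ Finset.range m, stepSize C α (m + 1) ≤ stepSize C α (k + 1) := fun k hk =>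
      antitone_stepSize_succ hC hα0 (Finset.mem_range.1 hk).le
    have h2 := Finset.card_nsmul_le_sum _ _ _ h1
    rw [Finset.card_range, nsmul_eq_mul] at h2
    refine le_trans (le_of_eq ?_) h2
    rw [stepSize]
    push_cast
    ring
  have hlog : ∀ m : ℕ, Real.log (stepSize C α (m + 1))
      = Real.log C - α * Real.log ((m : ℝ) + 1) := by
    intro m
    rw [stepSize, Real.log_mul hC.ne' (Real.rpow_pos_of_pos (by positivity) _).ne',
      Real.log_rpow (by positivity)]
    push_cast
    ring
  have hlim : Tendsto (fun t : ℝ => C / 4 * t ^ (1 - α)) atTop atTop :=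
    (tendsto_rpow_atTop (by linarith)).const_mul_atTop (by positivity)
  have hsmall : ∀ᶠ t : ℝ in atTop, |A| * α * Real.log t ≤ C / 4 * t ^ (1 - α) := by
    have h1 := (isLittleO_log_rpow_atTop (show 0 < 1 - α by linarith)).bound
      (show 0 < C / 4 / (|A| * α + 1) by positivity)
    filter_upwards [h1, eventually_ge_atTop 1] with t ht ht1
    rw [Real.norm_of_nonneg (Real.log_nonneg ht1), Real.norm_of_nonneg (by positivity)] at ht
    have h2 : |A| * α * Real.log t ≤ (|A| * α + 1) * Real.log t := by
      nlinarith [Real.log_nonneg ht1]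
    refine h2.trans ?_
    calc (|A| * α + 1) * Real.log t
        ≤ (|A| * α + 1) * (C / 4 / (|A| * α + 1) * t ^ (1 - α)) := by gcongr
      _ = _ := by field_simp
  have hcast : Tendsto (fun m : ℕ => (m : ℝ) + 1) atTop atTop :=
    tendsto_atTop_add_const_right _ _ tendsto_natCast_atTop_atTop
  refine tendsto_atTop_mono' _ ?_ (tendsto_atTop_add_const_right _ (A * Real.log C)
    (hlim.comp hcast))
  filter_upwards [hcast.eventually hsmall, eventually_ge_atTop 1] with m hm hm1
  have hm1' : (1 : ℝ) ≤ m := by exact_mod_cast hm1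
  have h0 : (0 : ℝ) < (m : ℝ) + 1 := by positivity
  have h1 : C / 2 * ((m : ℝ) + 1) ^ (1 - α) ≤ C * (m : ℝ) * ((m : ℝ) + 1) ^ (-α) := by
    rw [sub_eq_add_neg, Real.rpow_add h0, Real.rpow_one]
    have h2 : 0 < ((m : ℝ) + 1) ^ (-α) := Real.rpow_pos_of_pos h0 _
    have h3 : C / 2 * ((m : ℝ) + 1) ≤ C * m := by nlinarith
    calc _ = C / 2 * ((m : ℝ) + 1) * ((m : ℝ) + 1) ^ (-α) := by ring
      _ ≤ _ := mul_le_mul_of_nonneg_right h3 h2.le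
  have h4 : A * α * Real.log ((m : ℝ) + 1) ≤ |A| * α * Real.log ((m : ℝ) + 1) := by
    refine mul_le_mul_of_nonneg_right (mul_le_mul_of_nonneg_right (le_abs_self A) hα0.le) ?_
    exact Real.log_nonneg (by linarith)
  have h5 := hsum m
  rw [hlog m]
  simp only [Function.comp_apply]
  linarith

theorem tendsto_sum_stepSize (hC : 0 < C) (hα0 : 0 < α) (hα : α < 1) :
    Tendsto (fun m => ∑ k ∈ Finset.range m, stepSize C α (k + 1)) atTop atTop := by
  simpa using tendsto_sum_stepSize_add_log hC hα0 hα 0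

end StepSize

/-! ### The gradients of the surrogate and of the objective -/

section

variable {d : ℕ}

theorem norm_sub_sq_sub_norm_add_sq (y θ : EuclideanSpace ℝ (Fin d)) :
    ‖y + θ‖ ^ 2 - ‖y - θ‖ ^ 2 = 4 * inner ℝ y θ := by
  rw [norm_add_sq_real, norm_sub_sq_real]
  ring

/-- The posterior mean of the label sign `2 a - 1`. -/
theorem two_mul_labelPosterior_sub_one {σ : ℝ} (hσ : 0 < σ) (y θ : EuclideanSpace ℝ (Fin d)) :
    2 * labelPosterior σ y θ - 1 = Real.tanh (inner ℝ y θ / σ ^ 2) := by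
  set A := -(1 / (2 * σ ^ 2)) * ‖y - θ‖ ^ 2 with hA
  set B := -(1 / (2 * σ ^ 2)) * ‖y + θ‖ ^ 2 with hB
  have h : inner ℝ y θ / σ ^ 2 = A - (A + B) / 2 := by
    have := norm_sub_sq_sub_norm_add_sq y θ
    rw [hA, hB]
    field_simp
    linarith
  have h' : -(inner ℝ y θ / σ ^ 2) = B - (A + B) / 2 := by
    rw [h]; ring
  have hE : 0 < Real.exp A + Real.exp B := by positivity
  rw [Real.tanh_eq, h', h, Real.exp_sub, Real.exp_sub, ← sub_div, ← add_div,
    div_div_div_cancel_right₀ (Real.exp_pos _).ne', labelPosterior, ← hA, ← hB]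
  field_simp
  ring

/-- The stochastic gradient of the EM surrogate at the current parameter. -/
theorem gradEmQ_self {σ : ℝ} (hσ : 0 < σ) (θ y : EuclideanSpace ℝ (Fin d)) :
    gradEmQ σ θ θ y = (1 / σ ^ 2) • (Real.tanh (inner ℝ y θ / σ ^ 2) • y - θ) := by
  set τ := Real.tanh (inner ℝ y θ / σ ^ 2) with hτ
  have hform : (fun ϑ => emQ σ ϑ θ y) = fun ϑ =>
      (Real.log (1 / 2) - (d : ℝ) / 2 * Real.log (2 * Real.pi) - (d : ℝ) / 2 * Real.log (σ ^ 2)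
        - 1 / (2 * σ ^ 2) * ‖y‖ ^ 2)
        + (-(1 / (2 * σ ^ 2)) * ‖ϑ‖ ^ 2 + τ / σ ^ 2 * inner ℝ y ϑ) := by
    ext ϑ
    rw [hτ, ← two_mul_labelPosterior_sub_one hσ, emQ, completeLogLik, completeLogLik,
      norm_add_sq_real, norm_sub_sq_real]
    field_simp
    ring
  refine HasGradientAt.gradient ?_
  rw [hform, hasGradientAt_iff_hasFDerivAt]
  have h1 := ((hasStrictFDerivAt_norm_sq θ).hasFDerivAt).const_mul (-(1 / (2 * σ ^ 2)))
  have h2 := ((innerSL ℝ y).hasFDerivAt (x := θ)).const_mul (τ / σ ^ 2)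
  refine ((h1.add h2).const_add _).congr_fderiv ?_
  ext v
  simp
  field_simp
  ring

section Objective

variable {σ : ℝ}

theorem hasDerivAt_logisticPrimitive (σ t : ℝ) : HasDerivAt (logisticPrimitive σ)
    (1 / (1 + Real.exp (-(2 / σ ^ 2) * t))) t := by
  have hc : Continuous fun u : ℝ => 1 / (1 + Real.exp (-(2 / σ ^ 2) * u)) := by
    refine continuous_const.div (by fun_prop) fun u => ?_
    positivity
  exact intervalIntegral.integral_hasDerivAt_right (hc.intervalIntegrable _ _)
    hc.aestronglyMeasurable.stronglyMeasurableAtFilter hc.continuousAt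

/-- The logistic function is a shifted and rescaled `tanh`. -/
theorem one_div_one_add_exp_eq (σ t : ℝ) : 1 / (1 + Real.exp (-(2 / σ ^ 2) * t))
    = (1 + Real.tanh (t / σ ^ 2)) / 2 := by
  rw [Real.tanh_eq, show -(2 / σ ^ 2) * t = -(t / σ ^ 2) - t / σ ^ 2 by ring, Real.exp_sub]
  have h1 := Real.exp_pos (t / σ ^ 2)
  have h2 := Real.exp_pos (-(t / σ ^ 2))
  field_simp
  ring

theorem continuous_logisticPrimitive (σ : ℝ) : Continuous (logisticPrimitive σ) :=
  continuous_iff_continuousAt.2 fun t => (hasDerivAt_logisticPrimitive σ t).continuousAt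

theorem abs_logisticPrimitive_le (σ t : ℝ) : |logisticPrimitive σ t| ≤ |t| := by
  have h := intervalIntegral.norm_integral_le_of_norm_le_const (a := 0) (b := t) (C := 1)
    (f := fun u : ℝ => 1 / (1 + Real.exp (-(2 / σ ^ 2) * u))) fun u _ => by
      have := Real.exp_pos (-(2 / σ ^ 2) * u)
      rw [Real.norm_of_nonneg (by positivity), div_le_one (by positivity)]
      linarith
  simpa [logisticPrimitive] using h

/-- The gradient of the population objective is the displacement of the EM map. -/
theorem hasGradientAt_objective (σ : ℝ) (θopt θ : EuclideanSpace ℝ (Fin d)) :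
    HasGradientAt (objective σ θopt) ((1 / σ ^ 2) • (θ - emMap σ θopt θ)) θ := by
  have hcd : Continuous fun y : EuclideanSpace ℝ (Fin d) =>
      (1 + Real.tanh (inner ℝ y θ / σ ^ 2)) / 2 := by fun_prop
  have hint := hasFDerivAt_integral_of_dominated_of_fderiv_le (μ := mixtureLaw σ θopt)
    (F := fun θ y => logisticPrimitive σ (inner ℝ y θ)) (s := Set.univ)
    (F' := fun θ y => ((1 + Real.tanh (inner ℝ y θ / σ ^ 2)) / 2) • innerSL ℝ y)
    (bound := fun y => ‖y‖) (x₀ := θ) univ_mem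
    (Eventually.of_forall fun θ =>
      ((continuous_logisticPrimitive σ).comp (by fun_prop)).aestronglyMeasurable)
    (integrable_mixtureLaw_of_norm_le σ θopt
      ((continuous_logisticPrimitive σ).comp (by fun_prop)).aestronglyMeasurable ‖θ‖ 1 fun y => by
        rw [pow_one, mul_comm]
        exact (abs_logisticPrimitive_le _ _).trans (abs_real_inner_le_norm _ _))
    (hcd.smul (innerSL ℝ).continuous).aestronglyMeasurable
    (Eventually.of_forall fun y θ _ => by
      rw [norm_smul, innerSL_apply_norm]
      refine mul_le_of_le_one_left (norm_nonneg _) ?_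
      rw [Real.norm_eq_abs, abs_le]
      constructor <;>
        linarith [Real.tanh_lt_one (inner ℝ y θ / σ ^ 2),
          Real.neg_one_lt_tanh (inner ℝ y θ / σ ^ 2)])
    (by simpa using integrable_norm_pow_mixtureLaw σ θopt 1)
    (Eventually.of_forall fun y θ _ => by
      have h1 := hasDerivAt_logisticPrimitive σ (inner ℝ y θ)
      rw [one_div_one_add_exp_eq] at h1
      exact h1.comp_hasFDerivAt θ (innerSL ℝ y).hasFDerivAt)
  have hF'i : Integrable (fun y : EuclideanSpace ℝ (Fin d) =>
      ((1 + Real.tanh (inner ℝ y θ / σ ^ 2)) / 2) • innerSL ℝ y) (mixtureLaw σ θopt) := by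
    refine integrable_mixtureLaw_of_norm_le σ θopt
      (hcd.smul (innerSL ℝ).continuous).aestronglyMeasurable 1 1 fun y => ?_
    rw [norm_smul, innerSL_apply_norm, pow_one]
    refine mul_le_mul_of_nonneg_right ?_ (norm_nonneg _)
    rw [Real.norm_eq_abs, abs_le]
    constructor <;>
      linarith [Real.tanh_lt_one (inner ℝ y θ / σ ^ 2), Real.neg_one_lt_tanh (inner ℝ y θ / σ ^ 2)]
  rw [hasGradientAt_iff_hasFDerivAt]
  have h1 := ((hasStrictFDerivAt_norm_sq θ).hasFDerivAt).const_mul (1 / 2 : ℝ)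
  refine ((h1.sub (hint.const_mul 2)).const_mul (1 / σ ^ 2)).congr_fderiv ?_
  ext v
  have h2 : (∫ y, ((1 + Real.tanh (inner ℝ y θ / σ ^ 2)) / 2) • innerSL ℝ y
      ∂mixtureLaw σ θopt) v = 1 / 2 * inner ℝ (emMap σ θopt θ) v := by
    rw [ContinuousLinearMap.integral_apply hF'i]
    have hi1 : Integrable (fun y : EuclideanSpace ℝ (Fin d) => (inner ℝ y v : ℝ))
        (mixtureLaw σ θopt) := by
      refine integrable_mixtureLaw_of_norm_le σ θopt (by fun_prop) ‖v‖ 1 fun y => ?_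
      rw [pow_one, mul_comm]
      exact norm_inner_le_norm _ _
    have hi2 := integrable_tanh_mul_inner σ θopt _ (continuous_inner_div σ θ) v
    have h3 := integral_add hi1 hi2
    rw [integral_inner_mixtureLaw, zero_add, ← inner_emMap] at h3
    rw [← h3, ← integral_const_mul]
    refine integral_congr_ae (Eventually.of_forall fun y => ?_)
    simp only [smul_apply, innerSL_apply_apply, smul_eq_mul]
    ring
  simp [h2]

/-- A single Gaussian (`θopt = 0`) has a degenerate objective at the origin: its gradient along a
line is of third order there, so the Hessian is not positive definite. -/
theorem inner_hessian_objective_zero (hσ : 0 < σ) {e : EuclideanSpace ℝ (Fin d)}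
    (he : ‖e‖ = 1) : inner ℝ (hessian (objective σ (0 : EuclideanSpace ℝ (Fin d))) 0 e) e = 0 := by
  have hgrad : gradient (objective σ (0 : EuclideanSpace ℝ (Fin d)))
      = fun θ => (1 / σ ^ 2) • (θ - emMap σ 0 θ) := gradient_eq (hasGradientAt_objective σ 0)
  rw [hessian, hgrad]
  -- the gradient is in fact smooth, but this need not be known: without a derivative, `fderiv`
  -- is `0`
  by_cases hd : DifferentiableAt ℝ
    (fun θ : EuclideanSpace ℝ (Fin d) => (1 / σ ^ 2) • (θ - emMap σ 0 θ)) 0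
  swap
  · rw [fderiv_zero_of_not_differentiableAt hd]
    simp
  set K := 9 / σ ^ 6 * ∫ y, ‖y‖ ^ 4 ∂mixtureLaw σ (0 : EuclideanSpace ℝ (Fin d))
  have hee : inner ℝ e e = (1 : ℝ) := by rw [real_inner_self_eq_norm_sq, he, one_pow]
  set h : ℝ → ℝ := fun t => inner ℝ ((1 / σ ^ 2) • (t • e - emMap σ 0 (t • e))) e with hh
  have hbound : ∀ t : ℝ, |h t| ≤ 1 / σ ^ 2 * K * |t| ^ 3 := by
    intro t
    have h1 := abs_inner_emMap_sub_le hσ he (ρ := 0) (θopt := (0 : EuclideanSpace ℝ (Fin d)))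
      (by simp) (t • e)
    rw [inner_smul_left, hee, norm_smul, he] at h1
    simp only [conj_trivial, mul_one, ne_eq, OfNat.ofNat_ne_zero, not_false_eq_true, zero_pow,
      zero_div, add_zero, Real.norm_eq_abs] at h1
    have h2 : h t = -(1 / σ ^ 2 * (inner ℝ (emMap σ 0 (t • e)) e - t)) := by
      simp only [hh, inner_smul_left, inner_sub_left, hee, conj_trivial]
      ring
    rw [h2, abs_neg, abs_mul, abs_of_pos (by positivity : 0 < 1 / σ ^ 2)]
    calc _ ≤ 1 / σ ^ 2 * (|t| * (|t| ^ 2 * K)) := by gcongr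
      _ = _ := by ring
  have h0 : h 0 = 0 := by
    have := hbound 0
    simpa using this
  have hder0 : HasDerivAt h 0 0 := by
    have hO : h =O[𝓝 0] fun t : ℝ => t ^ 3 := by
      refine Asymptotics.IsBigO.of_bound (1 / σ ^ 2 * K) (Eventually.of_forall fun t => ?_)
      rw [Real.norm_eq_abs, norm_pow, Real.norm_eq_abs]
      exact hbound t
    have ho : (fun t : ℝ => t ^ 3) =o[𝓝 0] fun t : ℝ => t := by
      simpa using Asymptotics.isLittleO_pow_pow (𝕜 := ℝ) (show 1 < 3 by norm_num)
    rw [hasDerivAt_iff_isLittleO]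
    simpa [h0] using hO.trans_isLittleO ho
  have hline : HasDerivAt (fun t : ℝ => t • e) e 0 := by
    simpa using (hasDerivAt_id (0 : ℝ)).smul_const e
  have hd' : HasFDerivAt (fun θ : EuclideanSpace ℝ (Fin d) => (1 / σ ^ 2) • (θ - emMap σ 0 θ))
      (fderiv ℝ (fun θ : EuclideanSpace ℝ (Fin d) => (1 / σ ^ 2) • (θ - emMap σ 0 θ)) 0)
      ((0 : ℝ) • e) := by
    rw [zero_smul]; exact hd.hasFDerivAt
  have hcomp := (hd'.comp_hasDerivAt (0 : ℝ) hline).inner ℝ (hasDerivAt_const (0 : ℝ) e)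
  have heq := hcomp.unique hder0
  simpa using heq

end Objective

end

/-! ### The noise of one update -/

section

variable {d : ℕ}

/-- The centred noise of one update at state `a`, with observation `s.1` and disturbance `s.2`. -/
noncomputable def updateNoise (σ : ℝ) (θopt a : EuclideanSpace ℝ (Fin d))
    (s : EuclideanSpace ℝ (Fin d) × EuclideanSpace ℝ (Fin d)) : EuclideanSpace ℝ (Fin d) :=
  (1 / σ ^ 2) • (Real.tanh (inner ℝ s.1 a / σ ^ 2) • s.1 - emMap σ θopt a) - s.2

/-- A bound for the update noise that does not depend on the state. -/
noncomputable def updateNoiseBound (σ : ℝ) (θopt : EuclideanSpace ℝ (Fin d))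
    (s : EuclideanSpace ℝ (Fin d) × EuclideanSpace ℝ (Fin d)) : ℝ :=
  1 / σ ^ 2 * (‖s.1‖ + ∫ y, ‖y‖ ∂mixtureLaw σ θopt) + ‖s.2‖

/-- The joint law of the observation and the disturbance of one update. -/
noncomputable def updateLaw (σ σξ : ℝ) (θopt : EuclideanSpace ℝ (Fin d)) :
    Measure (EuclideanSpace ℝ (Fin d) × EuclideanSpace ℝ (Fin d)) :=
  (mixtureLaw σ θopt).prod
    (multivariateGaussian 0 (σξ ^ 2 • (1 : Matrix (Fin d) (Fin d) ℝ)))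

section Noise

variable (σ σξ : ℝ) (θopt : EuclideanSpace ℝ (Fin d))

instance isProbabilityMeasure_updateLaw : IsProbabilityMeasure (updateLaw σ σξ θopt) := by
  unfold updateLaw
  infer_instance

theorem continuous_updateNoise : Continuous (Function.uncurry (updateNoise σ θopt)) := by
  have := (continuous_emMap σ θopt).comp (continuous_fst (X := EuclideanSpace ℝ (Fin d))
    (Y := EuclideanSpace ℝ (Fin d) × EuclideanSpace ℝ (Fin d)))
  simp only [Function.comp_def] at this
  unfold Function.uncurry updateNoise
  fun_prop

theorem norm_updateNoise_le (a : EuclideanSpace ℝ (Fin d))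
    (s : EuclideanSpace ℝ (Fin d) × EuclideanSpace ℝ (Fin d)) :
    ‖updateNoise σ θopt a s‖ ≤ updateNoiseBound σ θopt s := by
  refine (norm_sub_le _ _).trans (add_le_add ?_ le_rfl)
  rw [norm_smul, Real.norm_of_nonneg (by positivity)]
  refine mul_le_mul_of_nonneg_left ((norm_sub_le _ _).trans ?_) (by positivity)
  exact add_le_add (norm_tanh_smul_le _ _) (norm_emMap_le _ _ _)

theorem memLp_updateNoiseBound : MemLp (updateNoiseBound σ θopt) 3 (updateLaw σ σξ θopt) := by
  have h1 : MemLp (fun y : EuclideanSpace ℝ (Fin d) => ‖y‖) 3 (mixtureLaw σ θopt) := by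
    have h := integrable_norm_pow_mixtureLaw σ θopt 3
    rw [← memLp_one_iff_integrable] at h
    refine MemLp.norm ((integrable_norm_rpow_iff (f := fun y : EuclideanSpace ℝ (Fin d) => y)
      (by fun_prop) (p := 3) (by norm_num) (by norm_num)).1 ?_)
    rw [memLp_one_iff_integrable] at h
    simpa using h
  have h2 : MemLp (fun y : EuclideanSpace ℝ (Fin d) => ‖y‖) 3
      (multivariateGaussian 0 (σξ ^ 2 • (1 : Matrix (Fin d) (Fin d) ℝ))) :=
    (IsGaussian.memLp_id _ 3 (by norm_num)).norm
  have h3 := h1.comp_fst (multivariateGaussian 0 (σξ ^ 2 • (1 : Matrix (Fin d) (Fin d) ℝ)))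
  have h4 := h2.comp_snd (mixtureLaw σ θopt)
  exact ((h3.add (memLp_const _)).const_mul (1 / σ ^ 2)).add h4

theorem inner_updateNoise (a v : EuclideanSpace ℝ (Fin d))
    (s : EuclideanSpace ℝ (Fin d) × EuclideanSpace ℝ (Fin d)) :
    inner ℝ (updateNoise σ θopt a s) v
      = 1 / σ ^ 2 * (Real.tanh (inner ℝ s.1 a / σ ^ 2) * inner ℝ s.1 v
        - inner ℝ (emMap σ θopt a) v) - inner ℝ s.2 v := by
  simp only [updateNoise, inner_sub_left, inner_smul_left, conj_trivial]

theorem abs_inner_updateNoise_le (a : EuclideanSpace ℝ (Fin d)) {v : EuclideanSpace ℝ (Fin d)}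
    (hv : ‖v‖ = 1) (s : EuclideanSpace ℝ (Fin d) × EuclideanSpace ℝ (Fin d)) :
    |inner ℝ (updateNoise σ θopt a s) v| ≤ updateNoiseBound σ θopt s := by
  have := abs_real_inner_le_norm (updateNoise σ θopt a s) v
  rw [hv, mul_one] at this
  exact this.trans (norm_updateNoise_le σ θopt a s)

theorem integrable_inner_isotropic (m v : EuclideanSpace ℝ (Fin d)) (r : ℝ) :
    Integrable (fun y : EuclideanSpace ℝ (Fin d) => (inner ℝ y v : ℝ))
      (multivariateGaussian m (r ^ 2 • (1 : Matrix (Fin d) (Fin d) ℝ))) :=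
  IsGaussian.integrable_fun_id.inner_const v

theorem integrable_observationNoise (a v : EuclideanSpace ℝ (Fin d)) :
    Integrable (fun y : EuclideanSpace ℝ (Fin d) =>
      1 / σ ^ 2 * (Real.tanh (inner ℝ y a / σ ^ 2) * inner ℝ y v
        - inner ℝ (emMap σ θopt a) v)) (mixtureLaw σ θopt) :=
  ((integrable_tanh_mul_inner σ θopt _ (continuous_inner_div σ a) v).sub
    (integrable_const _)).const_mul _

theorem integral_observationNoise (a v : EuclideanSpace ℝ (Fin d)) :
    ∫ y, 1 / σ ^ 2 * (Real.tanh (inner ℝ y a / σ ^ 2) * inner ℝ y v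
        - inner ℝ (emMap σ θopt a) v) ∂mixtureLaw σ θopt = 0 := by
  rw [integral_const_mul, integral_sub
    (integrable_tanh_mul_inner σ θopt _ (continuous_inner_div σ a) v) (integrable_const _),
    ← inner_emMap]
  simp

theorem integral_inner_updateNoise (a v : EuclideanSpace ℝ (Fin d)) :
    ∫ s, inner ℝ (updateNoise σ θopt a s) v ∂updateLaw σ σξ θopt = 0 := by
  simp_rw [inner_updateNoise]
  rw [updateLaw, integral_sub ((integrable_observationNoise σ θopt a v).comp_fst _)
    ((integrable_inner_isotropic 0 v σξ).comp_snd _),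
    integral_fun_fst (fun y : EuclideanSpace ℝ (Fin d) => 1 / σ ^ 2 *
      (Real.tanh (inner ℝ y a / σ ^ 2) * inner ℝ y v - inner ℝ (emMap σ θopt a) v)),
    integral_fun_snd (fun y : EuclideanSpace ℝ (Fin d) => (inner ℝ y v : ℝ)),
    integral_observationNoise, integral_inner_isotropic]
  simp

/-- The Gaussian disturbance keeps the noise nondegenerate in every direction. -/
theorem sq_le_integral_inner_updateNoise_sq (a : EuclideanSpace ℝ (Fin d))
    {v : EuclideanSpace ℝ (Fin d)} (hv : ‖v‖ = 1) :
    σξ ^ 2 ≤ ∫ s, (inner ℝ (updateNoise σ θopt a s) v : ℝ) ^ 2 ∂updateLaw σ σξ θopt := by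
  set N := multivariateGaussian (0 : EuclideanSpace ℝ (Fin d))
    (σξ ^ 2 • (1 : Matrix (Fin d) (Fin d) ℝ)) with hN
  set f : EuclideanSpace ℝ (Fin d) → ℝ := fun y => 1 / σ ^ 2 *
      (Real.tanh (inner ℝ y a / σ ^ 2) * inner ℝ y v - inner ℝ (emMap σ θopt a) v) with hf
  set g : EuclideanSpace ℝ (Fin d) → ℝ := fun y => inner ℝ y v with hg
  have hfi : Integrable f (mixtureLaw σ θopt) := integrable_observationNoise σ θopt a v
  have hgi : Integrable g N := integrable_inner_isotropic 0 v σξ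
  have hL2 : MemLp (fun s => inner ℝ (updateNoise σ θopt a s) v) 2 (updateLaw σ σξ θopt) := by
    refine ((memLp_updateNoiseBound σ σξ θopt).mono_exponent (by norm_num)).mono' ?_
      (Eventually.of_forall (abs_inner_updateNoise_le σ θopt a hv))
    exact (((continuous_updateNoise σ θopt).comp (Continuous.prodMk_right a)).inner
      continuous_const).aestronglyMeasurable
  have hg2 : Integrable (fun y => g y ^ 2) N := by
    have h := (integrable_norm_pow_isotropic σξ (0 : EuclideanSpace ℝ (Fin d)) 2)
    refine h.mono' (by fun_prop : Continuous _).aestronglyMeasurable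
      (Eventually.of_forall fun y => ?_)
    have := abs_real_inner_le_norm y v
    rw [hv, mul_one] at this
    rw [norm_pow]
    exact pow_le_pow_left₀ (norm_nonneg _) this 2
  have hcross : Integrable (fun s => 2 * (f s.1 * g s.2)) ((mixtureLaw σ θopt).prod N) :=
    (hfi.mul_prod hgi).const_mul 2
  -- observation and disturbance are independent and centred, so the cross term integrates to zero
  have h1 : ∫ s, (g s.2 ^ 2 - 2 * (f s.1 * g s.2)) ∂(mixtureLaw σ θopt).prod N = σξ ^ 2 := by
    rw [integral_sub (hg2.comp_snd _) hcross, integral_const_mul, integral_prod_mul,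
      integral_fun_snd (fun y => g y ^ 2)]
    have e1 : ∫ y, f y ∂mixtureLaw σ θopt = 0 := integral_observationNoise σ θopt a v
    have e2 : ∫ y, g y ^ 2 ∂N = σξ ^ 2 := by
      rw [hN, hg, integral_inner_sq_isotropic, hv]
      simp
    rw [e1, e2]
    simp
  rw [← h1]
  refine integral_mono ((hg2.comp_snd _).sub hcross) hL2.integrable_sq fun s => ?_
  simp only [inner_updateNoise]
  change g s.2 ^ 2 - 2 * (f s.1 * g s.2) ≤ (f s.1 - g s.2) ^ 2
  nlinarith [sq_nonneg (f s.1)]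

end Noise

end

/-! ### Convergence of the recursion -/

section

variable {d : ℕ} {Ω : Type*} [MeasurableSpace Ω] {P : Measure Ω} [IsProbabilityMeasure P]
  {σ σξ C α : ℝ} {θopt : EuclideanSpace ℝ (Fin d)}
  {θ : ℕ → Ω → EuclideanSpace ℝ (Fin d)}
  {z : ℕ → Ω → EuclideanSpace ℝ (Fin d) × EuclideanSpace ℝ (Fin d)}

/-- The update as a relaxation towards the EM map plus centred noise. -/
theorem update_eq (hσ : 0 < σ) (γ : ℝ) (a y ξ : EuclideanSpace ℝ (Fin d)) :
    a - γ • (-gradEmQ σ a a y + ξ)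
      = a + (γ / σ ^ 2) • (emMap σ θopt a - a) + γ • updateNoise σ θopt a (y, ξ) := by
  rw [gradEmQ_self hσ, updateNoise]
  simp only
  module

theorem measurable_update (σ γ : ℝ) (θopt : EuclideanSpace ℝ (Fin d)) :
    Measurable (Function.uncurry fun (a : EuclideanSpace ℝ (Fin d))
      (s : EuclideanSpace ℝ (Fin d) × EuclideanSpace ℝ (Fin d)) =>
        a + (γ / σ ^ 2) • (emMap σ θopt a - a) + γ • updateNoise σ θopt a s) := by
  have h1 : Continuous fun p : EuclideanSpace ℝ (Fin d) ×
      (EuclideanSpace ℝ (Fin d) × EuclideanSpace ℝ (Fin d)) => updateNoise σ θopt p.1 p.2 :=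
    continuous_updateNoise σ θopt
  have h2 := continuous_emMap σ θopt
  refine Continuous.measurable ?_
  simp only [Function.uncurry_def]
  fun_prop

theorem measurable_inner_updateNoise (σ : ℝ) (θopt v : EuclideanSpace ℝ (Fin d)) :
    Measurable (Function.uncurry fun (a : EuclideanSpace ℝ (Fin d))
      (s : EuclideanSpace ℝ (Fin d) × EuclideanSpace ℝ (Fin d)) =>
        (inner ℝ (updateNoise σ θopt a s) v : ℝ)) := by
  have h1 : Continuous fun p : EuclideanSpace ℝ (Fin d) ×
      (EuclideanSpace ℝ (Fin d) × EuclideanSpace ℝ (Fin d)) => updateNoise σ θopt p.1 p.2 :=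
    continuous_updateNoise σ θopt
  refine Continuous.measurable ?_
  simp only [Function.uncurry_def]
  fun_prop

/-- The accumulated noise converges almost surely. -/
theorem ae_exists_tendsto_sum_updateNoise (hα : 1 / 2 < α)
    (hθ₀ : Measurable (θ 0)) (hz : ∀ n, Measurable (z n)) (hind : iIndepFun z P)
    (hind₀ : IndepFun (θ 0) (fun ω n => z n ω) P)
    (hν : ∀ n, P.map (z n) = updateLaw σ σξ θopt)
    (hθ : ∀ n, Measurable[historyFiltration hθ₀ hz n] (θ n)) :
    ∀ᵐ ω ∂P, ∃ c, Tendsto (fun n => ∑ k ∈ Finset.range n,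
      stepSize C α (k + 1) • updateNoise σ θopt (θ k ω) (z k ω)) atTop (𝓝 c) := by
  -- coordinate by coordinate, the sums are real martingales
  have hcoord : ∀ i : Fin d, ∀ᵐ ω ∂P, ∃ c, Tendsto (fun n => ∑ k ∈ Finset.range n,
      stepSize C α (k + 1) * inner ℝ (updateNoise σ θopt (θ k ω) (z k ω))
        (EuclideanSpace.basisFun (Fin d) ℝ i)) atTop (𝓝 c) := by
    intro i
    have hi : ‖EuclideanSpace.basisFun (Fin d) ℝ i‖ = 1 :=
      (EuclideanSpace.basisFun (Fin d) ℝ).norm_eq_one i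
    exact ae_exists_tendsto_sum_innovations hθ₀ hz hind hind₀ hν hθ
      (g := fun a s => inner ℝ (updateNoise σ θopt a s) (EuclideanSpace.basisFun (Fin d) ℝ i))
      (measurable_inner_updateNoise σ θopt _)
      (fun a => integral_inner_updateNoise σ σξ θopt a _)
      ((memLp_updateNoiseBound σ σξ θopt).mono_exponent (by norm_num))
      (fun a s => abs_inner_updateNoise_le σ θopt a hi s)
      (summable_stepSize_succ_sq hα)
  filter_upwards [ae_all_iff.2 hcoord] with ω hω
  choose c hc using hω
  refine ⟨∑ i, c i • EuclideanSpace.basisFun (Fin d) ℝ i, ?_⟩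
  refine (tendsto_finsetSum Finset.univ fun i _ =>
    (hc i).smul_const (EuclideanSpace.basisFun (Fin d) ℝ i)).congr fun n => ?_
  rw [← (EuclideanSpace.basisFun (Fin d) ℝ).sum_repr' (∑ k ∈ Finset.range n,
    stepSize C α (k + 1) • updateNoise σ θopt (θ k ω) (z k ω))]
  refine Finset.sum_congr rfl fun i _ => ?_
  rw [inner_sum]
  congr 1
  refine Finset.sum_congr rfl fun k _ => ?_
  rw [inner_smul_right, real_inner_comm]

/-- On almost every trajectory the iterates converge to one of the fixed points `0`, `± θopt` of
the EM map. -/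
theorem ae_tendsto_zero_or (hσ : 0 < σ) (hC : 0 < C) (hα : 1 / 2 < α) (hα' : α < 1)
    (hθopt : θopt ≠ 0)
    (hθ₀ : Measurable (θ 0)) (hz : ∀ n, Measurable (z n)) (hind : iIndepFun z P)
    (hind₀ : IndepFun (θ 0) (fun ω n => z n ω) P)
    (hν : ∀ n, P.map (z n) = updateLaw σ σξ θopt)
    (hθ : ∀ n, Measurable[historyFiltration hθ₀ hz n] (θ n))
    (hstep : ∀ n ω, θ (n + 1) ω = θ n ω
      + (stepSize C α (n + 1) / σ ^ 2) • (emMap σ θopt (θ n ω) - θ n ω)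
      + stepSize C α (n + 1) • updateNoise σ θopt (θ n ω) (z n ω)) :
    ∀ᵐ ω ∂P, Tendsto (fun n => θ n ω) atTop (𝓝 0) ∨ Tendsto (fun n => θ n ω) atTop (𝓝 θopt) ∨
      Tendsto (fun n => θ n ω) atTop (𝓝 (-θopt)) := by
  set ρ := ‖θopt‖ with hρdef
  have hρ : 0 < ρ := norm_pos_iff.2 hθopt
  set e := ρ⁻¹ • θopt with hedef
  have he : ‖e‖ = 1 := by
    rw [hedef, norm_smul, norm_inv, Real.norm_of_nonneg hρ.le, inv_mul_cancel₀ hρ.ne']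
  have hee : inner ℝ e e = (1 : ℝ) := by rw [real_inner_self_eq_norm_sq, he, one_pow]
  have hθe : θopt = ρ • e := by rw [hedef, smul_inv_smul₀ hρ.ne']
  have hfix : ∀ t : ℝ, inner ℝ (emMap σ θopt (t • e)) e = t → t = 0 ∨ t = ρ ∨ t = -ρ := by
    intro t ht
    have h1 : t • e = (t / ρ) • θopt := by rw [hedef, smul_smul]; rfl
    have h2 : inner ℝ (emMap σ θopt ((t / ρ) • θopt)) θopt = t / ρ * ‖θopt‖ ^ 2 := by
      rw [← h1]
      conv_lhs => rw [hθe, inner_smul_right, ← hθe, ht]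
      rw [← hρdef]
      field_simp
    rcases eq_zero_or_of_inner_emMap_smul_eq hσ hθopt h2 with h | h | h
    · exact Or.inl ((div_eq_zero_iff.1 h).resolve_right hρ.ne')
    · exact Or.inr (Or.inl (by rwa [div_eq_one_iff_eq hρ.ne'] at h))
    · exact Or.inr (Or.inr (by rw [div_eq_iff hρ.ne'] at h; linarith))
  filter_upwards [ae_exists_tendsto_sum_updateNoise hα hθ₀ hz hind hind₀ hν hθ (C := C)]
    with ω ⟨S', hS'⟩
  obtain ⟨t, ht, hlim⟩ := exists_tendsto_fixedPoint (continuous_emMap σ θopt)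
    (norm_emMap_le σ θopt) he (x := fun n => θ n ω)
    (lam := fun n => stepSize C α (n + 1) / σ ^ 2) (fun x hx => by
      refine inner_emMap_lt_of_orthogonal hσ hx ?_ ?_
      · rw [hθe, inner_smul_left, inner_sub_right, inner_smul_right, hee, real_inner_comm]
        simp
      · rw [← real_inner_self_eq_norm_sq]
        simp only [inner_sub_left, inner_sub_right, inner_smul_left, inner_smul_right, hee,
          real_inner_comm x e]
        simp)
    (Set.Finite.subset (Set.toFinite {0, ρ, -ρ}) fun t ht => hfix t ht)
    (fun n => div_pos (stepSize_succ_pos hC n) (by positivity))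
    (by simpa using (tendsto_stepSize_succ (C := C) (by linarith : 0 < α)).div_const (σ ^ 2))
    (by
      simp_rw [← Finset.sum_div]
      exact (tendsto_sum_stepSize hC (by linarith) hα').atTop_div_const (by positivity))
    hS' (fun n => by
      rw [Finset.sum_range_succ, add_sub_cancel_left]
      exact hstep n ω)
  rcases hfix t ht with h | h | h
  · rw [h, zero_smul] at hlim
    exact Or.inl hlim
  · rw [h, ← hθe] at hlim
    exact Or.inr (Or.inl hlim)
  · rw [h, neg_smul, ← hθe] at hlim
    exact Or.inr (Or.inr hlim)

/-- The iterates almost surely do not converge to the origin, a saddle point of the objective. -/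
theorem ae_not_tendsto_zero (hσ : 0 < σ) (hσξ : 0 < σξ) (hC : 0 < C) (hα : 1 / 2 < α)
    (hα' : α < 1) (hθopt : θopt ≠ 0)
    (hθ₀ : Measurable (θ 0)) (hz : ∀ n, Measurable (z n)) (hind : iIndepFun z P)
    (hind₀ : IndepFun (θ 0) (fun ω n => z n ω) P)
    (hν : ∀ n, P.map (z n) = updateLaw σ σξ θopt)
    (hθ : ∀ n, Measurable[historyFiltration hθ₀ hz n] (θ n))
    (hstep : ∀ n ω, θ (n + 1) ω = θ n ω
      + (stepSize C α (n + 1) / σ ^ 2) • (emMap σ θopt (θ n ω) - θ n ω)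
      + stepSize C α (n + 1) • updateNoise σ θopt (θ n ω) (z n ω)) :
    ∀ᵐ ω ∂P, ¬Tendsto (fun n => θ n ω) atTop (𝓝 0) := by
  obtain ⟨ρ, e, hρ, he, hθe⟩ : ∃ (ρ : ℝ) (e : EuclideanSpace ℝ (Fin d)),
      0 < ρ ∧ ‖e‖ = 1 ∧ θopt = ρ • e := by
    have hρ : 0 < ‖θopt‖ := norm_pos_iff.2 hθopt
    refine ⟨‖θopt‖, ‖θopt‖⁻¹ • θopt, hρ, ?_, (smul_inv_smul₀ hρ.ne' θopt).symm⟩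
    rw [norm_smul, norm_inv, norm_norm, inv_mul_cancel₀ hρ.ne']
  obtain ⟨r, hr, hdrift⟩ := exists_le_inner_emMap_sub_mul hσ he hρ hθe
  obtain ⟨γ, hγdef⟩ : ∃ γ : ℕ → ℝ, γ = fun n => stepSize C α (n + 1) := ⟨_, rfl⟩
  have hγ : ∀ n, 0 < γ n := hγdef ▸ stepSize_succ_pos hC
  have hγanti : Antitone γ := hγdef ▸ antitone_stepSize_succ hC (by linarith)
  obtain ⟨m₁, hm₁, hM⟩ : ∃ m₁ : ℝ, 0 ≤ m₁ ∧ ∀ a, ‖emMap σ θopt a‖ ≤ m₁ :=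
    ⟨∫ y, ‖y‖ ∂mixtureLaw σ θopt, integral_nonneg fun _ => norm_nonneg _, norm_emMap_le σ θopt⟩
  obtain ⟨R₀, hR₀⟩ : ∃ R₀ : ℝ, R₀ = r + γ 0 / σ ^ 2 * (m₁ + r) := ⟨_, rfl⟩
  have hγ0 := hγ 0
  have hcoord : ∀ a : EuclideanSpace ℝ (Fin d), |inner ℝ a e| ≤ ‖a‖ := fun a => by
    simpa [he] using abs_real_inner_le_norm a e
  -- `w n` is the conditional mean of the coordinate `⟨θ, e⟩` after the update at time `n`
  obtain ⟨w, hw⟩ : ∃ w : ℕ → EuclideanSpace ℝ (Fin d) → ℝ, ∀ n a,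
      w n a = inner ℝ a e + γ n / σ ^ 2 * (inner ℝ (emMap σ θopt a) e - inner ℝ a e) :=
    ⟨_, fun _ _ => rfl⟩
  have hrR : r ≤ R₀ := hR₀ ▸ le_add_of_nonneg_right (by positivity)
  have hsq : ∀ {t : ℝ}, |t| ≤ R₀ → t ^ 2 ≤ R₀ ^ 2 := fun {t} ht =>
    sq_le_sq' (neg_le_of_abs_le ht) (le_of_abs_le ht)
  have hwm : ∀ n, Measurable (w n) := by
    intro n
    have h1 := continuous_emMap σ θopt
    rw [show w n = _ from funext (hw n)]
    exact Continuous.measurable (by fun_prop)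
  have hwR : ∀ n a, ‖a‖ ≤ r → |w n a| ≤ R₀ := by
    intro n a ha
    have hγn : γ n ≤ γ 0 := hγanti (Nat.zero_le n)
    have hγn0 := hγ n
    have h1 : |inner ℝ (emMap σ θopt a) e - inner ℝ a e| ≤ m₁ + r :=
      (abs_sub _ _).trans (add_le_add ((hcoord _).trans (hM a)) ((hcoord a).trans ha))
    rw [hw, hR₀]
    refine (abs_add_le _ _).trans (add_le_add ((hcoord a).trans ha) ?_)
    rw [abs_mul, abs_of_pos (by positivity : 0 < γ n / σ ^ 2)]
    gcongr
  have hexp : ∀ n a, ‖a‖ ≤ r →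
      (1 + 2 * (ρ ^ 2 / (2 * σ ^ 4) * γ n)) * inner ℝ a e ^ 2 ≤ w n a ^ 2 := by
    intro n a ha
    have h2 : 0 < γ n / σ ^ 2 := div_pos (hγ n) (by positivity)
    have h3 := mul_le_mul_of_nonneg_left (hdrift a ha) h2.le
    have h4 : 2 * (ρ ^ 2 / (2 * σ ^ 4) * γ n) * inner ℝ a e ^ 2
        = 2 * (γ n / σ ^ 2 * (ρ ^ 2 / (2 * σ ^ 2) * inner ℝ a e ^ 2)) := by
      field_simp
    rw [hw]
    nlinarith [sq_nonneg (γ n / σ ^ 2 * (inner ℝ (emMap σ θopt a) e - inner ℝ a e))]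
  have hu : ∀ n ω, inner ℝ (θ (n + 1) ω) e
      = w n (θ n ω) + γ n * inner ℝ (updateNoise σ θopt (θ n ω) (z n ω)) e := by
    intro n ω
    simp only [hw, hγdef, hstep n ω, inner_add_left, inner_smul_left, inner_sub_left,
      conj_trivial]
  have hstay : ∀ N, P {ω | ∀ n, N ≤ n → θ n ω ∈ Metric.closedBall 0 r} = 0 :=
    measure_forall_mem_eq_zero hθ₀ hz hind hind₀ hν hθ
      (u := fun a => inner ℝ a e) (ζ := fun a s => inner ℝ (updateNoise σ θopt a s) e)
      (Continuous.measurable (by fun_prop)) (measurable_inner_updateNoise σ θopt e)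
      (memLp_updateNoiseBound σ σξ θopt) (abs_inner_updateNoise_le σ θopt · he)
      (integral_inner_updateNoise σ σξ θopt · e) (pow_pos hσξ 2)
      (sq_le_integral_inner_updateNoise_sq σ σξ θopt · he) hwm
      Metric.isClosed_closedBall.measurableSet hγ hγanti
      (hγdef ▸ tendsto_stepSize_succ (by linarith)) (hγdef ▸ summable_stepSize_succ_sq hα)
      (hγdef ▸ tendsto_sum_stepSize_add_log hC (by linarith) hα')
      (by positivity : 0 < ρ ^ 2 / (2 * σ ^ 4)) (fun n ω _ => hu n ω)
      (fun a ha => hsq ((hcoord a).trans ((mem_closedBall_zero_iff.1 ha).trans hrR)))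
      (fun n a ha => hsq (hwR n a (mem_closedBall_zero_iff.1 ha)))
      (fun n a ha => hexp n a (mem_closedBall_zero_iff.1 ha))
  have hall : ∀ᵐ ω ∂P, ∀ N, ¬∀ n, N ≤ n → θ n ω ∈ Metric.closedBall 0 r := by
    refine ae_all_iff.2 fun N => ?_
    rw [ae_iff]
    simpa using hstay N
  filter_upwards [hall] with ω hω hlim
  obtain ⟨N, hN⟩ := eventually_atTop.1
    (hlim.eventually (Metric.closedBall_mem_nhds (0 : EuclideanSpace ℝ (Fin d)) hr))
  exact hω N hN

end

end GaussianMixture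

theorem proposition1 {d : ℕ} {Ω : Type*} [MeasurableSpace Ω]
    (P : Measure Ω) [IsProbabilityMeasure P]
    (σ σξ C α : ℝ) (hσ : 0 < σ) (hσξ : 0 < σξ) (hC : 0 < C)
    (hα : 1 / 2 < α) (hα' : α < 1)
    (θopt : EuclideanSpace ℝ (Fin d))
    -- the Hessian `A` of the objective at `θopt` is positive definite
    (hA : ∀ v : EuclideanSpace ℝ (Fin d), v ≠ 0 →
      0 < inner ℝ (GaussianMixture.hessian (GaussianMixture.objective σ θopt) θopt v) v)
    -- iterates `θ n` for `n ≥ 0`; observations `y n` and disturbances `ξ n` for `n ≥ 1`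
    (θ y ξ : ℕ → Ω → EuclideanSpace ℝ (Fin d))
    (hθ_meas : Measurable (θ 0))
    (hy_meas : ∀ n, Measurable (y (n + 1)))
    (hξ_meas : ∀ n, Measurable (ξ (n + 1)))
    (hy_law : ∀ n, P.map (y (n + 1)) = GaussianMixture.mixtureLaw σ θopt)
    (hξ_law : ∀ n, P.map (ξ (n + 1)) =
      multivariateGaussian 0 (σξ ^ 2 • (1 : Matrix (Fin d) (Fin d) ℝ)))
    -- `θ 0, y 1, ξ 1, y 2, ξ 2, …` are mutually independent
    (hyξ_indep : ∀ n, IndepFun (y (n + 1)) (ξ (n + 1)) P)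
    (hz_indep : iIndepFun (fun (n : ℕ) (ω : Ω) => (y (n + 1) ω, ξ (n + 1) ω)) P)
    (hθ_indep : IndepFun (θ 0) (fun (ω : Ω) (n : ℕ) => (y (n + 1) ω, ξ (n + 1) ω)) P)
    (hθ_step : ∀ (n : ℕ) (ω : Ω), θ (n + 1) ω = θ n ω -
      GaussianMixture.stepSize C α (n + 1) •
        (-GaussianMixture.gradEmQ σ (θ n ω) (θ n ω) (y (n + 1) ω) + ξ (n + 1) ω)) :
    ∀ᵐ ω ∂P, Tendsto (fun n => θ n ω) atTop (𝓝 θopt) ∨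
      Tendsto (fun n => θ n ω) atTop (𝓝 (-θopt)) := by
  rcases subsingleton_or_nontrivial (EuclideanSpace ℝ (Fin d)) with hsub | hnt
  -- in dimension zero every sequence converges
  · refine Eventually.of_forall fun ω => Or.inl ?_
    exact tendsto_const_nhds.congr fun n => Subsingleton.elim _ _
  have hθopt : θopt ≠ 0 := by
    rintro rfl
    obtain ⟨e, he⟩ := exists_norm_eq (EuclideanSpace ℝ (Fin d)) zero_le_one
    have he0 : e ≠ 0 := by
      rintro rfl
      simp at he
    exact (hA e he0).ne' (GaussianMixture.inner_hessian_objective_zero hσ he)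
  set z : ℕ → Ω → EuclideanSpace ℝ (Fin d) × EuclideanSpace ℝ (Fin d) :=
    fun n ω => (y (n + 1) ω, ξ (n + 1) ω) with hzdef
  have hz : ∀ n, Measurable (z n) := fun n => (hy_meas n).prodMk (hξ_meas n)
  have hν : ∀ n, P.map (z n) = GaussianMixture.updateLaw σ σξ θopt := by
    intro n
    rw [GaussianMixture.updateLaw, ← hy_law n, ← hξ_law n]
    exact (indepFun_iff_map_prod_eq_prod_map_map (hy_meas n).aemeasurable
      (hξ_meas n).aemeasurable).1 (hyξ_indep n)
  have hstep : ∀ n ω, θ (n + 1) ω = θ n ω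
      + (GaussianMixture.stepSize C α (n + 1) / σ ^ 2) •
        (GaussianMixture.emMap σ θopt (θ n ω) - θ n ω)
      + GaussianMixture.stepSize C α (n + 1) •
        GaussianMixture.updateNoise σ θopt (θ n ω) (z n ω) := fun n ω => by
    rw [hθ_step n ω, GaussianMixture.update_eq (θopt := θopt) hσ]
  have hadapted := GaussianMixture.measurable_state_history hθ_meas hz
    (fun n => GaussianMixture.measurable_update σ (GaussianMixture.stepSize C α (n + 1)) θopt)
    hstep
  filter_upwards [GaussianMixture.ae_tendsto_zero_or hσ hC hα hα' hθopt hθ_meas hz hz_indep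
      hθ_indep hν hadapted hstep,
    GaussianMixture.ae_not_tendsto_zero hσ hσξ hC hα hα' hθopt hθ_meas hz hz_indep hθ_indep hν
      hadapted hstep] with ω h1 h2
  exact h1.resolve_left h2
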